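/- **Setting (finitary type theories, Bauer, Haselwarter and Petković Komel).** There are four syntactic classes: types and terms (the *object* classes), type equations and term equations (the *equality* classes). A signature assigns to each symbol $\mathsf{S}$ an arity $(c,[(c_1,n_1),\dots,(c_k,n_k)])$: $\mathsf S$ forms expressions of object class $c$ from $k$ arguments, the $i$-th of class $c_i$ and binding $n_i$ variables. Expressions are built from free variables, bound variables, symbols applied to (abstracted) arguments $\{\vec x\}e$, and metavariables $\mathsf{M}(t_1,\dots,t_n)$ of an object class applied to terms; the only expressions of the equality classes are the dummies $\star$. A boundary thesis $\mathcal B$ is one of $\Box\ \mathsf{type}$, $\Box:A$ (object boundaries), $A\equiv B\ \mathsf{by}\ \Box$, $s\equiv t:A\ \mathsf{by}\ \Box$ (equality boundaries); an abstracted boundary is $\mathbb{B}=\{x_1{:}A_1\}\cdots\{x_m{:}A_m\}\,\mathcal B$. Filling $\Box$ with a head $e$ gives a judgement $\mathbb B[e]$, and filling an object boundary with $e\equiv e'$ gives the corresponding equation $\mathbb B[e\equiv e']$. A metavariable context is a list $\Xi=[\mathsf M_1{:}\mathbb B_1,\dots,\mathsf M_n{:}\mathbb B_n]$ with distinct names $|\Xi|$,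 each $\mathbb B_i$ closed and using only the metavariables $\mathsf M_1,\dots,\mathsf M_{i-1}$; $\mathrm{objmv}(\Xi)$ is the set of those $\mathsf M_i$ for which $\mathbb B_i$ is an object boundary. Hypothetical judgements and boundaries are written $\Theta;\Gamma\vdash\mathcal J$ with a metavariable context $\Theta$ and a variable context $\Gamma$. All syntactic entities are assumed to be well scoped and to respect arities. An *instantiation* $I=\langle\mathsf M_1\mapsto e_1,\dots,\mathsf M_n\mapsto e_n\rangle$ of $\Xi$ over $\Theta;\Gamma$ assigns to each $\mathsf M_i$ an argument over $\Theta;\Gamma$ of the arity of $\mathbb B_i$; it acts on syntax by $I_*(\mathsf M_i(\vec t))=e[I_*\vec t/\vec x]$ if $e_i=\{\vec x\}e$. Write $I_{(i)}$ for its restriction to $\mathsf M_1,\dots,\mathsf M_{i-1}$. It is *derivable* if $\Theta;\Gamma\vdash(I_{(i)*}\mathbb B_i)[e_i]$ is derivable for all $i$. The generic application $\widehat{\mathsf M}_i$ is $\{\vec x\}\mathsf M_i(\vec x)$ for an object metavariable, and $\{\vec x\}\star$ for an equality one. A *raw rule* $\Xi\Longrightarrow\mathcal B[e]$ is a judgement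 $\Xi;[\,]\vdash\mathcal B[e]$, and it is *derivable* if this judgement is. A *raw type theory* over a signature is a family of raw rules (its specific rules); its derivable judgements and boundaries are generated by the variable, metavariable, metavariable congruence and abstraction rules, reflexivity, symmetry, transitivity and conversion for type and term equations, the rules for well-formed boundaries, all instantiations of the specific rules (with premises $\Theta;\Gamma\vdash(I_{(i)*}\mathbb B_i)[e_i]$ for all $i$, and $\Theta;\Gamma\vdash I_*\mathcal B$), and the congruence rules associated with the specific object rules. The judgement $\vdash\Xi\ \mathsf{mctx}$ means that $[\mathsf M_1{:}\mathbb B_1,\dots,\mathsf M_{i-1}{:}\mathbb B_{i-1}];[\,]\vdash\mathbb B_i$ is derivable for every $i$. A rule $\Xi\Longrightarrow\mathcal B[e]$ is *finitary* if $\vdash\Xi\ \mathsf{mctx}$ and $\Xi;[\,]\vdash\mathcal B$ are derivable. A raw type theory is *standard* if all its specific rules are finitary, each specific object rule is a symbol rule, i.e. of the form $\Xi\Longrightarrow\mathcal B[\mathsf S(\widehat{\mathsf M}_1,\dots,\widehat{\mathsf M}_n)]$ for a symbol $\mathsf S$ whose arity is given by $\mathcal B$ and $\mathbb B_1,\dots,\mathbb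 B_n$, and each symbol has precisely one symbol rule. **Patterns.** Type patterns $P$, term patterns $p$ and argument patterns $q$ are given by $$P::=\mathsf M()\mid\mathsf S(q_1,\dots,q_n),\qquad p::=\mathsf S(q_1,\dots,q_n),\qquad q::=\{\vec x\}\mathsf M(\vec x)\mid P\mid p,$$ where $\mathsf S$ is a type symbol in the first case and a term symbol in the second, and in $\mathsf S(q_1,\dots,q_n)$ the sets $\mathrm{mv}(q_i)$ of metavariables occurring in the $q_i$ are pairwise disjoint. **Naturality.** An object judgement $\Theta;\Gamma\vdash\mathcal J$ is *natural for variables* if $\Theta;\Gamma\Vdash\mathcal J$ follows from these rules: (i) $\Theta;\Gamma\Vdash\mathsf a:\Gamma(\mathsf a)$; (ii) $\Theta;\Gamma\Vdash\{x{:}A\}\mathcal J$ if $\Theta;\Gamma,\mathsf a{:}A\Vdash\mathcal J[\mathsf a/x]$ and $\mathsf a\notin|\Gamma|$; (iii) if $\Theta(\mathsf M)=\{\vec x{:}\vec A\}\,\Box\ \mathsf{type}$ and $\Theta;\Gamma\Vdash t_i:A_i[t_1/x_1,\dots,t_{i-1}/x_{i-1}]$ for all $i$, then $\Theta;\Gamma\Vdash\mathsf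 M(\vec t)\ \mathsf{type}$; (iv) if $\Theta(\mathsf M)=\{\vec x{:}\vec A\}\,\Box:B$ and the same conditions on $\vec t$ hold, then $\Theta;\Gamma\Vdash\mathsf M(\vec t):B[\vec t/\vec x]$; (v) if the symbol rule for $\mathsf S$ has premises $\mathsf M_1{:}\mathbb B_1,\dots,\mathsf M_n{:}\mathbb B_n$ and, with $I=\langle\mathsf M_1\mapsto e_1,\dots,\mathsf M_n\mapsto e_n\rangle$, $\Theta;\Gamma\Vdash(I_{(i)*}\mathbb B_i)[e_i]$ for every object boundary $\mathbb B_i$, then $\Theta;\Gamma\Vdash\mathcal B'[\mathsf S(e_1,\dots,e_n)]$ for any boundary $\mathcal B'$ of the class of $\mathsf S$. **Deterministic and object-invertible rules.** A raw rule $\Xi\Longrightarrow\mathcal J$ is *deterministic* if for each judgement $\Theta;\Gamma\vdash\mathcal J'$ there is at most one instantiation $I$ of $\Xi$ over $\Theta;\Gamma$ with $I_*\mathcal J=\mathcal J'$. A derivable raw rule $\Xi\Longrightarrow\mathcal J$ is *object-invertible* if, whenever $I$ is an instantiation of $\Xi$ over $\Theta;[\,]$ such that $\vdash\Theta\ \mathsf{mctx}$,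 $|\Xi|\cap|\Theta|=\emptyset$ and $\Theta;[\,]\vdash I_*\mathcal J$ is derivable, the residual instantiation $I^\circ$ of $\Xi$, given by $I^\circ(\mathsf M_i)=I(\mathsf M_i)$ for object metavariables and $I^\circ(\mathsf M_i)=\widehat{\mathsf M}_i$ for equality metavariables, is derivable over the metavariable context $[\Theta,\mathsf M_{i_1}{:}I_{(i_1)*}\mathbb B_{i_1},\dots,\mathsf M_{i_m}{:}I_{(i_m)*}\mathbb B_{i_m}]$ and the empty variable context, where $\mathsf M_{i_1},\dots,\mathsf M_{i_m}$ are the equality metavariables of $\Xi$. An *extensionality rule* is a derivable finitary rule of the form $$\Xi,\ \mathsf s{:}(\Box:A),\ \mathsf t{:}(\Box:A),\ \Phi\ \Longrightarrow\ \mathsf s\equiv\mathsf t:A$$ such that $\Phi$ contains only equational premises and $\Xi\Longrightarrow A\ \mathsf{type}$ is deterministic and object-invertible. **Proposition.** In a standard type theory, let $$\Xi,\ \mathsf s{:}(\Box:P),\ \mathsf t{:}(\Box:P),\ \Phi\ \Longrightarrow\ \mathsf s\equiv\mathsf t:P$$ be a derivable finitary rule. If $\Phi$ contains only equational premises, $P$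 is a type pattern, $\mathrm{mv}(P)=\mathrm{objmv}(\Xi)$, and $\Xi\Longrightarrow P\ \mathsf{type}$ is natural for variables, then the rule is an extensionality rule. -/

import Mathlib

/-!
Finitary type theories. Free variables and metavariables are named (names are natural numbers);
bound variables are de Bruijn indices, index `0` being the innermost one. Every judgement and every
boundary that takes part in a derivation has to be syntactically valid.
-/

universe u v

namespace FTT

/-! ### Arities and signatures -/

/-- Syntactic classes: types, terms, type equations, term equations. -/
inductive SynClass
  | ty
  | tm
  | eqTy
  | eqTm

/-- The object classes are `ty` and `tm`, the other two are the equality classes. -/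
def SynClass.isObj : SynClass → Bool
  | .ty => true
  | .tm => true
  | .eqTy => false
  | .eqTm => false

/-- A signature: each symbol has an object class, and for each of its arguments
the syntactic class of the argument and the number of variables bound in it. -/
structure Signature where
  Sym : Type u
  cls : Sym → SynClass
  cls_isObj : ∀ S, (cls S).isObj = true
  args : Sym → List (SynClass × ℕ)

variable {Sg : Signature.{u}}

/-! ### Expressions -/

/-- Raw expressions. The `j`-th argument of a symbol `S` is an iterated abstraction
`{x₁}…{xₙ} e`, where `n` is prescribed by the arity of `S`; only its body `e` is recorded, with
`xₙ, …, x₁` being the bound variables `0, …, n - 1`. In the same way an argument of arity `(c, n)`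
is represented by its body everywhere below. -/
inductive Expr (Sg : Signature.{u}) : Type u
  | fvar (a : ℕ)
  | bvar (i : ℕ)
  | sym (S : Sg.Sym) (args : Fin (Sg.args S).length → Expr Sg)
  | mvar (M : ℕ) (n : ℕ) (ts : Fin n → Expr Sg)
  | dummy (c : SynClass)

/-- A renaming of bound variables, pushed under `n` binders. -/
def liftRen (n : ℕ) (ρ : ℕ → ℕ) (i : ℕ) : ℕ :=
  if i < n then i else ρ (i - n) + n

/-- Renaming of bound variables. -/
def Expr.rename : (ℕ → ℕ) → Expr Sg → Expr Sg
  | _, .fvar a => .fvar a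
  | ρ, .bvar i => .bvar (ρ i)
  | ρ, .sym S args => .sym S fun j => (args j).rename (liftRen ((Sg.args S).get j).2 ρ)
  | ρ, .mvar M n ts => .mvar M n fun j => (ts j).rename ρ
  | _, .dummy c => .dummy c

/-- A substitution for bound variables, pushed under `n` binders. -/
def liftSub (n : ℕ) (σ : ℕ → Expr Sg) (i : ℕ) : Expr Sg :=
  if i < n then .bvar i else (σ (i - n)).rename (· + n)

/-- Simultaneous capture-avoiding substitution for bound variables. -/
def Expr.subst : (ℕ → Expr Sg) → Expr Sg → Expr Sg
  | _, .fvar a => .fvar a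
  | σ, .bvar i => σ i
  | σ, .sym S args => .sym S fun j => (args j).subst (liftSub ((Sg.args S).get j).2 σ)
  | σ, .mvar M n ts => .mvar M n fun j => (ts j).subst σ
  | _, .dummy c => .dummy c

/-- The substitution `[t₁/x₁, …, tₙ/xₙ]` where `x₁, …, xₙ` are the `n` innermost bound variables,
so that `xₙ` has index `0` and `x₁` has index `n - 1`. -/
def instSub {n : ℕ} (ts : Fin n → Expr Sg) (i : ℕ) : Expr Sg :=
  if h : i < n then ts (Fin.rev ⟨i, h⟩) else .bvar (i - n)

/-- `e[t₁/x₁, …, tₙ/xₙ]`. -/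
def Expr.inst {n : ℕ} (ts : Fin n → Expr Sg) (e : Expr Sg) : Expr Sg :=
  e.subst (instSub ts)

/-- The set of metavariables that occur in an expression. -/
def Expr.mv : Expr Sg → Set ℕ
  | .fvar _ => ∅
  | .bvar _ => ∅
  | .sym _ args => ⋃ j, (args j).mv
  | .mvar M _ ts => {M} ∪ ⋃ j, (ts j).mv
  | .dummy _ => ∅

/-- The application `M(t₁, …, tₙ)` of a metavariable of class `c`. An equality metavariable
has no applications, the dummy expression stands for them. -/
def mapp (c : SynClass) (M : ℕ) {n : ℕ} (ts : Fin n → Expr Sg) : Expr Sg :=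
  if c.isObj = true then .mvar M n ts else .dummy c

/-! ### Boundaries, judgements, contexts -/

/-- Boundary theses: `□ type`, `□ : A`, `A ≡ B by □`, `s ≡ t : A by □`. -/
inductive Bdry (Sg : Signature.{u}) : Type u
  | isTy
  | isTm (A : Expr Sg)
  | eqTy (A B : Expr Sg)
  | eqTm (s t A : Expr Sg)

/-- The syntactic class of a boundary thesis, i.e., of the heads that fill it. -/
def Bdry.cls : Bdry Sg → SynClass
  | .isTy => .ty
  | .isTm _ => .tm
  | .eqTy _ _ => .eqTy
  | .eqTm _ _ _ => .eqTm

def Bdry.map (f : Expr Sg → Expr Sg) : Bdry Sg → Bdry Sg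
  | .isTy => .isTy
  | .isTm A => .isTm (f A)
  | .eqTy A B => .eqTy (f A) (f B)
  | .eqTm s t A => .eqTm (f s) (f t) (f A)

/-- Abstracted boundaries `{x₁ : A₁} … {xₙ : Aₙ} ℬ`. -/
inductive ABdry (Sg : Signature.{u}) : Type u
  | thesis (B : Bdry Sg)
  | abs (A : Expr Sg) (BB : ABdry Sg)

/-- The types `A₁, …, Aₙ` in `{x₁ : A₁} … {xₙ : Aₙ} ℬ`. -/
def ABdry.tel : ABdry Sg → List (Expr Sg)
  | .thesis _ => []
  | .abs A BB => A :: BB.tel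

/-- The thesis `ℬ` in `{x₁ : A₁} … {xₙ : Aₙ} ℬ`. -/
def ABdry.concl : ABdry Sg → Bdry Sg
  | .thesis B => B
  | .abs _ BB => BB.concl

/-- The metavariable arity of an abstracted boundary. -/
def ABdry.arity (BB : ABdry Sg) : SynClass × ℕ :=
  (BB.concl.cls, BB.tel.length)

/-- Whether a boundary is an object boundary. -/
def ABdry.isObj (BB : ABdry Sg) : Bool :=
  BB.concl.cls.isObj

/-- A thesis is either a boundary thesis `ℬ`, or a judgement thesis, which is a boundary thesis
filled with a head. Thus `A type` is `jdg .isTy A`, `t : A` is `jdg (.isTm A) t`, and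
`A ≡ B by ⋆` is `jdg (.eqTy A B) (.dummy .eqTy)`. -/
inductive Thesis (Sg : Signature.{u}) : Type u
  | bdry (B : Bdry Sg)
  | jdg (B : Bdry Sg) (e : Expr Sg)

def Thesis.map (f : Expr Sg → Expr Sg) : Thesis Sg → Thesis Sg
  | .bdry B => .bdry (B.map f)
  | .jdg B e => .jdg (B.map f) (f e)

/-- Abstracted statements: abstracted judgements and abstracted boundaries. -/
inductive AStmt (Sg : Signature.{u}) : Type u
  | thesis (θ : Thesis Sg)
  | abs (A : Expr Sg) (J : AStmt Sg)

/-- Simultaneous substitution for bound variables in an abstracted statement. -/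
def AStmt.subst : (ℕ → Expr Sg) → AStmt Sg → AStmt Sg
  | σ, .thesis θ => .thesis (θ.map (Expr.subst σ))
  | σ, .abs A J => .abs (A.subst σ) (J.subst (liftSub 1 σ))

/-- `J[a/x]` for the outermost variable `x` and a free variable `a`. -/
def AStmt.openVar (a : ℕ) (J : AStmt Sg) : AStmt Sg :=
  J.subst (instSub fun _ : Fin 1 => .fvar a)

/-- An abstracted boundary as a statement. -/
def ABdry.toStmt : ABdry Sg → AStmt Sg
  | .thesis B => .thesis (.bdry B)
  | .abs A BB => .abs A BB.toStmt

/-- Filling an abstracted boundary `{x₁ : A₁} … {xₙ : Aₙ} ℬ` with the head `{x₁} … {xₙ} e`. -/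
def ABdry.fill : ABdry Sg → Expr Sg → AStmt Sg
  | .thesis B, e => .thesis (.jdg B e)
  | .abs A BB, e => .abs A (BB.fill e)

/-- `A type`. -/
def isTy (A : Expr Sg) : AStmt Sg := .thesis (.jdg .isTy A)

/-- `t : A`. -/
def isTm (t A : Expr Sg) : AStmt Sg := .thesis (.jdg (.isTm A) t)

/-- `A ≡ B by ⋆`. -/
def eqTy (A B : Expr Sg) : AStmt Sg := .thesis (.jdg (.eqTy A B) (.dummy .eqTy))

/-- `s ≡ t : A by ⋆`. -/
def eqTm (s t A : Expr Sg) : AStmt Sg := .thesis (.jdg (.eqTm s t A) (.dummy .eqTm))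

/-- A boundary thesis as a statement. -/
def bdry (B : Bdry Sg) : AStmt Sg := .thesis (.bdry B)

/-- Filling an object boundary thesis with an equation `e ≡ e'` (equality boundaries, for which the
operation is meaningless, are returned with a dummy head). -/
def Bdry.fillEq : Bdry Sg → Expr Sg → Expr Sg → AStmt Sg
  | .isTy, e, e' => FTT.eqTy e e'
  | .isTm A, e, e' => FTT.eqTm e e' A
  | .eqTy A B, _, _ => FTT.eqTy A B
  | .eqTm s t A, _, _ => FTT.eqTm s t A

/-- Filling an abstracted object boundary with an equation. -/
def ABdry.fillEq : ABdry Sg → Expr Sg → Expr Sg → AStmt Sg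
  | .thesis B, e, e' => B.fillEq e e'
  | .abs A BB, e, e' => .abs A (BB.fillEq e e')

/-- Metavariable contexts `[M₁ : ℬ₁, …, Mₙ : ℬₙ]`. -/
abbrev MCtx (Sg : Signature.{u}) := List (ℕ × ABdry Sg)

/-- Variable contexts `[a₁ : A₁, …, aₙ : Aₙ]`. -/
abbrev VCtx (Sg : Signature.{u}) := List (ℕ × Expr Sg)

/-- The names declared by a context, in order. -/
def dom {α : Type u} (Γ : List (ℕ × α)) : List ℕ := Γ.map Prod.fst

/-- The object metavariables of a metavariable context. -/
def objmv (Ξ : MCtx Sg) : Set ℕ :=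
  {M | ∃ BB : ABdry Sg, (M, BB) ∈ Ξ ∧ BB.isObj = true}

/-! ### Syntactic validity -/

/-- `e` is a syntactically valid expression of class `c` over the metavariable arities given
by `Θ`, with free variables among `X` and bound variables among `0, …, k - 1`. -/
def Expr.Valid (Θ : MCtx Sg) (X : List ℕ) : ℕ → SynClass → Expr Sg → Prop
  | _, c, .fvar a => c = .tm ∧ a ∈ X
  | k, c, .bvar i => c = .tm ∧ i < k
  | k, c, .sym S args => c = Sg.cls S ∧
      ∀ j, (args j).Valid Θ X (k + ((Sg.args S).get j).2) ((Sg.args S).get j).1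
  | k, c, .mvar M n ts => c.isObj = true ∧
      (∃ BB : ABdry Sg, Θ.lookup M = some BB ∧ BB.arity = (c, n)) ∧
      ∀ j, (ts j).Valid Θ X k .tm
  | _, c, .dummy c' => c = c' ∧ c.isObj = false

def Bdry.Valid (Θ : MCtx Sg) (X : List ℕ) (k : ℕ) : Bdry Sg → Prop
  | .isTy => True
  | .isTm A => A.Valid Θ X k .ty
  | .eqTy A B => A.Valid Θ X k .ty ∧ B.Valid Θ X k .ty
  | .eqTm s t A => s.Valid Θ X k .tm ∧ t.Valid Θ X k .tm ∧ A.Valid Θ X k .ty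

def Thesis.Valid (Θ : MCtx Sg) (X : List ℕ) (k : ℕ) : Thesis Sg → Prop
  | .bdry B => B.Valid Θ X k
  | .jdg B e => B.Valid Θ X k ∧ e.Valid Θ X k B.cls

def AStmt.Valid (Θ : MCtx Sg) (X : List ℕ) : ℕ → AStmt Sg → Prop
  | k, .thesis θ => θ.Valid Θ X k
  | k, .abs A J => A.Valid Θ X k .ty ∧ J.Valid Θ X (k + 1)

/-- Distinct names, and each boundary is valid and closed over the preceding metavariables. -/
def MCtx.Valid (Θ : MCtx Sg) : Prop :=
  (dom Θ).Nodup ∧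
    ∀ i : Fin Θ.length, ((Θ.get i).2.toStmt).Valid (Θ.take i) [] 0

/-- Distinct names, and each type is valid over the preceding variables. -/
def VCtx.Valid (Θ : MCtx Sg) (Γ : VCtx Sg) : Prop :=
  (dom Γ).Nodup ∧
    ∀ i : Fin Γ.length, (Γ.get i).2.Valid Θ (dom (Γ.take i)) 0 .ty

/-- `Θ; Γ ⊢ J` is a syntactically valid hypothetical judgement or boundary. -/
def HValid (Θ : MCtx Sg) (Γ : VCtx Sg) (J : AStmt Sg) : Prop :=
  MCtx.Valid Θ ∧ VCtx.Valid Θ Γ ∧ J.Valid Θ (dom Γ) 0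

/-! ### Instantiations -/

/-- The action of an instantiation, given as a list of assignments `Mᵢ ↦ eᵢ`. -/
def Expr.act (I : List (ℕ × Expr Sg)) : Expr Sg → Expr Sg
  | .fvar a => .fvar a
  | .bvar i => .bvar i
  | .sym S args => .sym S fun j => (args j).act I
  | .mvar M n ts =>
      match I.lookup M with
      | some e => e.inst fun j => (ts j).act I
      | none => .mvar M n fun j => (ts j).act I
  | .dummy c => .dummy c

def Bdry.act (I : List (ℕ × Expr Sg)) (B : Bdry Sg) : Bdry Sg := B.map (Expr.act I)

def ABdry.act (I : List (ℕ × Expr Sg)) : ABdry Sg → ABdry Sg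
  | .thesis B => .thesis (B.act I)
  | .abs A BB => .abs (A.act I) (BB.act I)

/-- The assignment `⟨M₁ ↦ e₁, …, Mₙ ↦ eₙ⟩` for `Ξ = [M₁ : ℬ₁, …, Mₙ : ℬₙ]`. -/
def assign (Ξ : MCtx Sg) (es : Fin Ξ.length → Expr Sg) : List (ℕ × Expr Sg) :=
  List.ofFn fun i => ((Ξ.get i).1, es i)

/-- The boundary `ℬᵢ` of the `i`-th premise, instantiated by the restriction of `I` to the
preceding metavariables. -/
def premBdry (Ξ : MCtx Sg) (es : Fin Ξ.length → Expr Sg) (i : Fin Ξ.length) : ABdry Sg :=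
  (Ξ.get i).2.act ((assign Ξ es).take i)

/-- `es` is an instantiation of `Ξ` over `Θ; Γ`: a valid argument of the right arity for each
metavariable. -/
def IsInst (Ξ Θ : MCtx Sg) (Γ : VCtx Sg) (es : Fin Ξ.length → Expr Sg) : Prop :=
  MCtx.Valid Θ ∧ VCtx.Valid Θ Γ ∧
    ∀ i, (es i).Valid Θ (dom Γ) (Ξ.get i).2.arity.2 (Ξ.get i).2.arity.1

/-- The generic application of a metavariable `M : ℬ`, i.e., (the body of)
`{x₁} … {xₙ} M(x₁, …, xₙ)` for an object metavariable and `{x₁} … {xₙ} ⋆` for an equality one. -/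
def genApp (M : ℕ) (BB : ABdry Sg) : Expr Sg :=
  mapp BB.concl.cls M fun j : Fin BB.tel.length => .bvar (Fin.rev j)

/-! ### Raw rules and type theories -/

/-- A raw rule `Ξ ⟹ ℬ[e]`. -/
structure RawRule (Sg : Signature.{u}) where
  prem : MCtx Sg
  bdry : Bdry Sg
  head : Expr Sg

/-- The conclusion of a raw rule. -/
def RawRule.concl (R : RawRule Sg) : AStmt Sg := .thesis (.jdg R.bdry R.head)

/-- A raw type theory: a family of syntactically valid raw rules. -/
structure RawTT (Sg : Signature.{u}) where
  Idx : Type v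
  rule : Idx → RawRule Sg
  rule_valid : ∀ r, HValid (rule r).prem [] (rule r).concl

/-- Derivability of `Θ; Γ ⊢ J`, where `J` is an abstracted judgement or an abstracted boundary, in
the deductive system of a raw type theory. All conclusions are required to be valid, hence all
premises are valid as well. -/
inductive Der (T : RawTT.{u, v} Sg) (Θ : MCtx Sg) : VCtx Sg → AStmt Sg → Prop
  /- variables, metavariables, abstraction -/
  | var {Γ : VCtx Sg} {a : ℕ} {A : Expr Sg}
      (hv : HValid Θ Γ (isTm (.fvar a) A))
      (ha : Γ.lookup a = some A) :
      Der T Θ Γ (isTm (.fvar a) A)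
  | mvar {Γ : VCtx Sg} {M : ℕ} {BB : ABdry Sg} (ts : Fin BB.tel.length → Expr Sg)
      (hv : HValid Θ Γ
        (.thesis (.jdg (BB.concl.map (Expr.inst ts)) (mapp BB.concl.cls M ts))))
      (hM : Θ.lookup M = some BB)
      (ht : ∀ j, Der T Θ Γ (isTm (ts j)
        ((BB.tel.get j).inst fun i : Fin j => ts (i.castLE j.isLt.le))))
      (hB : Der T Θ Γ (bdry (BB.concl.map (Expr.inst ts)))) :
      Der T Θ Γ (.thesis (.jdg (BB.concl.map (Expr.inst ts)) (mapp BB.concl.cls M ts)))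
  | mvarCongr {Γ : VCtx Sg} {M : ℕ} {BB : ABdry Sg} (ss ts : Fin BB.tel.length → Expr Sg)
      (hv : HValid Θ Γ ((BB.concl.map (Expr.inst ss)).fillEq
        (mapp BB.concl.cls M ss) (mapp BB.concl.cls M ts)))
      (hM : Θ.lookup M = some BB)
      (hobj : BB.isObj = true)
      (hs : ∀ j, Der T Θ Γ (isTm (ss j)
        ((BB.tel.get j).inst fun i : Fin j => ss (i.castLE j.isLt.le))))
      (ht : ∀ j, Der T Θ Γ (isTm (ts j)
        ((BB.tel.get j).inst fun i : Fin j => ts (i.castLE j.isLt.le))))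
      (hst : ∀ j, Der T Θ Γ (eqTm (ss j) (ts j)
        ((BB.tel.get j).inst fun i : Fin j => ss (i.castLE j.isLt.le))))
      (hC : ∀ C, BB.concl = .isTm C → Der T Θ Γ (eqTy (C.inst ss) (C.inst ts))) :
      Der T Θ Γ ((BB.concl.map (Expr.inst ss)).fillEq
        (mapp BB.concl.cls M ss) (mapp BB.concl.cls M ts))
  | abstr {Γ : VCtx Sg} {A : Expr Sg} {J : AStmt Sg} (a : ℕ)
      (hv : HValid Θ Γ (.abs A J))
      (hA : Der T Θ Γ (isTy A))
      (ha : a ∉ dom Γ)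
      (hJ : Der T Θ (Γ ++ [(a, A)]) (J.openVar a)) :
      Der T Θ Γ (.abs A J)
  /- equality -/
  | tyRefl {Γ : VCtx Sg} {A : Expr Sg}
      (hv : HValid Θ Γ (eqTy A A))
      (h : Der T Θ Γ (isTy A)) :
      Der T Θ Γ (eqTy A A)
  | tySym {Γ : VCtx Sg} {A B : Expr Sg}
      (hv : HValid Θ Γ (eqTy B A))
      (h : Der T Θ Γ (eqTy A B)) :
      Der T Θ Γ (eqTy B A)
  | tyTran {Γ : VCtx Sg} {A B C : Expr Sg}
      (hv : HValid Θ Γ (eqTy A C))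
      (h₁ : Der T Θ Γ (eqTy A B))
      (h₂ : Der T Θ Γ (eqTy B C)) :
      Der T Θ Γ (eqTy A C)
  | tmRefl {Γ : VCtx Sg} {t A : Expr Sg}
      (hv : HValid Θ Γ (eqTm t t A))
      (h : Der T Θ Γ (isTm t A)) :
      Der T Θ Γ (eqTm t t A)
  | tmSym {Γ : VCtx Sg} {s t A : Expr Sg}
      (hv : HValid Θ Γ (eqTm t s A))
      (h : Der T Θ Γ (eqTm s t A)) :
      Der T Θ Γ (eqTm t s A)
  | tmTran {Γ : VCtx Sg} {s t w A : Expr Sg}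
      (hv : HValid Θ Γ (eqTm s w A))
      (h₁ : Der T Θ Γ (eqTm s t A))
      (h₂ : Der T Θ Γ (eqTm t w A)) :
      Der T Θ Γ (eqTm s w A)
  | convTm {Γ : VCtx Sg} {t A B : Expr Sg}
      (hv : HValid Θ Γ (isTm t B))
      (h₁ : Der T Θ Γ (isTm t A))
      (h₂ : Der T Θ Γ (eqTy A B)) :
      Der T Θ Γ (isTm t B)
  | convEq {Γ : VCtx Sg} {s t A B : Expr Sg}
      (hv : HValid Θ Γ (eqTm s t B))
      (h₁ : Der T Θ Γ (eqTm s t A))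
      (h₂ : Der T Θ Γ (eqTy A B)) :
      Der T Θ Γ (eqTm s t B)
  /- boundaries; abstracted boundaries are covered by `abstr` -/
  | bdryTy {Γ : VCtx Sg}
      (hv : HValid Θ Γ (bdry .isTy)) :
      Der T Θ Γ (bdry .isTy)
  | bdryTm {Γ : VCtx Sg} {A : Expr Sg}
      (hv : HValid Θ Γ (bdry (.isTm A)))
      (hA : Der T Θ Γ (isTy A)) :
      Der T Θ Γ (bdry (.isTm A))
  | bdryEqTy {Γ : VCtx Sg} {A B : Expr Sg}
      (hv : HValid Θ Γ (bdry (.eqTy A B)))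
      (hA : Der T Θ Γ (isTy A))
      (hB : Der T Θ Γ (isTy B)) :
      Der T Θ Γ (bdry (.eqTy A B))
  | bdryEqTm {Γ : VCtx Sg} {s t A : Expr Sg}
      (hv : HValid Θ Γ (bdry (.eqTm s t A)))
      (hA : Der T Θ Γ (isTy A))
      (hs : Der T Θ Γ (isTm s A))
      (ht : Der T Θ Γ (isTm t A)) :
      Der T Θ Γ (bdry (.eqTm s t A))
  /- instantiations of the specific rules and their congruence rules -/
  | rule {Γ : VCtx Sg} (r : T.Idx) (es : Fin (T.rule r).prem.length → Expr Sg)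
      (hv : HValid Θ Γ (.thesis (.jdg ((T.rule r).bdry.act (assign (T.rule r).prem es))
        ((T.rule r).head.act (assign (T.rule r).prem es)))))
      (hp : ∀ i, Der T Θ Γ ((premBdry (T.rule r).prem es i).fill (es i)))
      (hq : Der T Θ Γ (bdry ((T.rule r).bdry.act (assign (T.rule r).prem es)))) :
      Der T Θ Γ (.thesis (.jdg ((T.rule r).bdry.act (assign (T.rule r).prem es))
        ((T.rule r).head.act (assign (T.rule r).prem es))))
  | ruleCongr {Γ : VCtx Sg} (r : T.Idx) (fs gs : Fin (T.rule r).prem.length → Expr Sg)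
      (hv : HValid Θ Γ (((T.rule r).bdry.act (assign (T.rule r).prem fs)).fillEq
        ((T.rule r).head.act (assign (T.rule r).prem fs))
        ((T.rule r).head.act (assign (T.rule r).prem gs))))
      (hobj : (T.rule r).bdry.cls.isObj = true)
      (hf : ∀ i, Der T Θ Γ ((premBdry (T.rule r).prem fs i).fill (fs i)))
      (hg : ∀ i, Der T Θ Γ ((premBdry (T.rule r).prem gs i).fill (gs i)))
      (hfg : ∀ i, ((T.rule r).prem.get i).2.isObj = true →
        Der T Θ Γ ((premBdry (T.rule r).prem fs i).fillEq (fs i) (gs i)))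
      (hB : ∀ B, (T.rule r).bdry = .isTm B →
        Der T Θ Γ (eqTy (B.act (assign (T.rule r).prem fs)) (B.act (assign (T.rule r).prem gs)))) :
      Der T Θ Γ (((T.rule r).bdry.act (assign (T.rule r).prem fs)).fillEq
        ((T.rule r).head.act (assign (T.rule r).prem fs))
        ((T.rule r).head.act (assign (T.rule r).prem gs)))

/-- Derivability of `⊢ Θ mctx`: well-formed metavariable contexts. -/
inductive MCtxDer (T : RawTT.{u, v} Sg) : MCtx Sg → Prop
  | empty : MCtxDer T []
  | extend {Θ : MCtx Sg} {M : ℕ} {BB : ABdry Sg}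
      (hΘ : MCtxDer T Θ)
      (hB : Der T Θ [] BB.toStmt)
      (hM : M ∉ dom Θ) :
      MCtxDer T (Θ ++ [(M, BB)])

/-- An instantiation is derivable when all its arguments have the required boundaries. -/
def InstDer (T : RawTT.{u, v} Sg) (Ξ Θ : MCtx Sg) (Γ : VCtx Sg)
    (es : Fin Ξ.length → Expr Sg) : Prop :=
  ∀ i, Der T Θ Γ ((premBdry Ξ es i).fill (es i))

/-- A raw rule is derivable when it is so as a judgement. -/
def RawRule.Derivable (T : RawTT.{u, v} Sg) (R : RawRule Sg) : Prop :=
  Der T R.prem [] R.concl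

/-- Finitary rules: the premises and the boundary of the conclusion are well-formed. -/
def RawRule.Finitary (T : RawTT.{u, v} Sg) (R : RawRule Sg) : Prop :=
  MCtxDer T R.prem ∧ Der T R.prem [] (FTT.bdry R.bdry)

/-- `R` is a symbol rule for `S`: an object rule whose premises and conclusion boundary give the
arity of `S`, and whose head is `S` applied to the generic applications of the metavariables. -/
def RawRule.IsSymbolRule (R : RawRule Sg) (S : Sg.Sym) : Prop :=
  R.bdry.cls.isObj = true ∧ Sg.cls S = R.bdry.cls ∧
    Sg.args S = R.prem.map (fun p => p.2.arity) ∧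
    ∃ h : (Sg.args S).length = R.prem.length,
      R.head = .sym S fun j =>
        genApp (R.prem.get (j.cast h)).1 (R.prem.get (j.cast h)).2

/-- Standard type theories: finitary type theories whose object rules are symbol rules, with
precisely one rule for each symbol. -/
def RawTT.IsStandard (T : RawTT.{u, v} Sg) : Prop :=
  (∀ r, (T.rule r).Finitary T) ∧
  (∀ r, (T.rule r).bdry.cls.isObj = true → ∃ S, (T.rule r).IsSymbolRule S) ∧
  (∀ S, ∃! r, (T.rule r).IsSymbolRule S)

/-! ### Patterns, deterministic and object-invertible rules -/

/-- The three kinds of patterns; an argument pattern may bind variables. -/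
inductive PatKind
  | ty
  | tm
  | arg (n : ℕ)

/-- Patterns. An argument pattern binding `n` variables is again represented by its body. -/
inductive IsPattern : PatKind → Expr Sg → Prop
  | tyMvar (M : ℕ) (ts : Fin 0 → Expr Sg) :
      IsPattern .ty (.mvar M 0 ts)
  | tySym (S : Sg.Sym) (qs : Fin (Sg.args S).length → Expr Sg)
      (hS : Sg.cls S = .ty)
      (hq : ∀ i, IsPattern (.arg ((Sg.args S).get i).2) (qs i))
      (hd : ∀ i j, i ≠ j → (qs i).mv ∩ (qs j).mv = ∅) :
      IsPattern .ty (.sym S qs)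
  | tmSym (S : Sg.Sym) (qs : Fin (Sg.args S).length → Expr Sg)
      (hS : Sg.cls S = .tm)
      (hq : ∀ i, IsPattern (.arg ((Sg.args S).get i).2) (qs i))
      (hd : ∀ i j, i ≠ j → (qs i).mv ∩ (qs j).mv = ∅) :
      IsPattern .tm (.sym S qs)
  | argMvar (M n : ℕ) :
      IsPattern (.arg n) (.mvar M n fun j : Fin n => .bvar (Fin.rev j))
  | argTy (P : Expr Sg) (hP : IsPattern .ty P) :
      IsPattern (.arg 0) P
  | argTm (p : Expr Sg) (hp : IsPattern .tm p) :
      IsPattern (.arg 0) p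

/-- A raw rule `Ξ ⟹ 𝒥` is deterministic when each judgement `Θ; Γ ⊢ 𝒥'` has at most one
matching instantiation. -/
def RawRule.Deterministic (R : RawRule Sg) : Prop :=
  ∀ (Θ : MCtx Sg) (Γ : VCtx Sg) (J : AStmt Sg), HValid Θ Γ J →
    ∀ es es' : Fin R.prem.length → Expr Sg,
      IsInst R.prem Θ Γ es → IsInst R.prem Θ Γ es' →
      AStmt.thesis (.jdg (R.bdry.act (assign R.prem es)) (R.head.act (assign R.prem es))) = J →
      AStmt.thesis (.jdg (R.bdry.act (assign R.prem es')) (R.head.act (assign R.prem es'))) = J →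
      es = es'

/-- The equational residue: `Θ` extended by the instantiated equational premises of `Ξ`. -/
def residue (Ξ Θ : MCtx Sg) (es : Fin Ξ.length → Expr Sg) : MCtx Sg :=
  Θ ++ (List.finRange Ξ.length).filterMap fun i =>
    if (Ξ.get i).2.isObj = true then none else some ((Ξ.get i).1, premBdry Ξ es i)

/-- The residual instantiation, an instantiation of `Ξ` over the equational residue. -/
def residualInst (Ξ : MCtx Sg) (es : Fin Ξ.length → Expr Sg) (i : Fin Ξ.length) : Expr Sg :=
  if (Ξ.get i).2.isObj = true then es i else genApp (Ξ.get i).1 (Ξ.get i).2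

/-- Object-invertible rules. -/
def RawRule.ObjectInvertible (T : RawTT.{u, v} Sg) (R : RawRule Sg) : Prop :=
  R.Derivable T ∧
  ∀ (Θ : MCtx Sg) (es : Fin R.prem.length → Expr Sg),
    IsInst R.prem Θ [] es → MCtxDer T Θ → List.Disjoint (dom R.prem) (dom Θ) →
    Der T Θ [] (.thesis (.jdg (R.bdry.act (assign R.prem es)) (R.head.act (assign R.prem es)))) →
    InstDer T R.prem (residue R.prem Θ es) [] (residualInst R.prem es)

/-- `Natural T Θ Γ J`: the object judgement `Θ; Γ ⊢ J` is natural for variables. -/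
inductive Natural (T : RawTT.{u, v} Sg) (Θ : MCtx Sg) : VCtx Sg → AStmt Sg → Prop
  | var {Γ : VCtx Sg} {a : ℕ} {A : Expr Sg}
      (hv : HValid Θ Γ (isTm (.fvar a) A))
      (ha : Γ.lookup a = some A) :
      Natural T Θ Γ (isTm (.fvar a) A)
  | abstr {Γ : VCtx Sg} {A : Expr Sg} {J : AStmt Sg} (a : ℕ)
      (hv : HValid Θ Γ (.abs A J))
      (ha : a ∉ dom Γ)
      (hJ : Natural T Θ (Γ ++ [(a, A)]) (J.openVar a)) :
      Natural T Θ Γ (.abs A J)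
  | tyMvar {Γ : VCtx Sg} {M : ℕ} {BB : ABdry Sg} (ts : Fin BB.tel.length → Expr Sg)
      (hv : HValid Θ Γ (isTy (.mvar M BB.tel.length ts)))
      (hM : Θ.lookup M = some BB)
      (hB : BB.concl = .isTy)
      (ht : ∀ j, Natural T Θ Γ (isTm (ts j)
        ((BB.tel.get j).inst fun i : Fin j => ts (i.castLE j.isLt.le)))) :
      Natural T Θ Γ (isTy (.mvar M BB.tel.length ts))
  | tmMvar {Γ : VCtx Sg} {M : ℕ} {BB : ABdry Sg} {B : Expr Sg}
      (ts : Fin BB.tel.length → Expr Sg)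
      (hv : HValid Θ Γ (isTm (.mvar M BB.tel.length ts) (B.inst ts)))
      (hM : Θ.lookup M = some BB)
      (hB : BB.concl = .isTm B)
      (ht : ∀ j, Natural T Θ Γ (isTm (ts j)
        ((BB.tel.get j).inst fun i : Fin j => ts (i.castLE j.isLt.le)))) :
      Natural T Θ Γ (isTm (.mvar M BB.tel.length ts) (B.inst ts))
  | sym {Γ : VCtx Sg} (r : T.Idx) (S : Sg.Sym) (B' : Bdry Sg)
      (es : Fin (Sg.args S).length → Expr Sg)
      (hv : HValid Θ Γ (.thesis (.jdg B' (.sym S es))))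
      (hS : (T.rule r).IsSymbolRule S)
      (h : (T.rule r).prem.length = (Sg.args S).length)
      (he : ∀ i, ((T.rule r).prem.get i).2.isObj = true →
        Natural T Θ Γ
          ((premBdry (T.rule r).prem (fun k => es (k.cast h)) i).fill (es (i.cast h)))) :
      Natural T Θ Γ (.thesis (.jdg B' (.sym S es)))

/-! ### Extensionality rules -/

/-- The rule `Ξ ⟹ A type`. -/
def tyRule (Ξ : MCtx Sg) (A : Expr Sg) : RawRule Sg where
  prem := Ξ
  bdry := .isTy
  head := A

/-- The rule `Ξ, s : (□ : A), t : (□ : A), Φ ⟹ s ≡ t : A`. -/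
def extRule (Ξ : MCtx Sg) (s t : ℕ) (A : Expr Sg) (Φ : MCtx Sg) : RawRule Sg where
  prem := Ξ ++ [(s, .thesis (.isTm A)), (t, .thesis (.isTm A))] ++ Φ
  bdry := .eqTm (.mvar s 0 Fin.elim0) (.mvar t 0 Fin.elim0) A
  head := .dummy .eqTm

/-- All premises in `Φ` are equational. -/
def OnlyEquational (Φ : MCtx Sg) : Prop :=
  ∀ p ∈ Φ, p.2.isObj = false

/-- Extensionality rules. -/
def RawRule.IsExtensionalityRule (T : RawTT.{u, v} Sg) (R : RawRule Sg) : Prop :=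
  R.Derivable T ∧ R.Finitary T ∧
  ∃ (Ξ : MCtx Sg) (s t : ℕ) (A : Expr Sg) (Φ : MCtx Sg),
    R = extRule Ξ s t A Φ ∧ OnlyEquational Φ ∧
    (tyRule Ξ A).Deterministic ∧ (tyRule Ξ A).ObjectInvertible T

end FTT

namespace FTT
variable {Sg : Signature.{u}}

/-! ### Substitution for bound variables -/

/-! The given rule is already derivable and finitary, so the content is that `Ξ ⟹ P type` is
deterministic and object-invertible.

Determinism. Each object metavariable M of Ξ occurs in P, and a pattern applies M only to the
variables bound at that very place. Hence I(M) can be read off as a subexpression of I_*P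
(`IsPattern.lookup_eq_of_hom_eq`). An equality metavariable has no possible value besides ⋆.

Object-invertibility. Suppose I_*P type is derivable, and descend through P with two inversions in
parallel. By `Der.sym_inv`, a derivation about S(e₁, …, eₙ) ends, up to conversions, with the unique
symbol rule of S, so the arguments are derivable at the instantiated premises. By `Natural.sym_inv`,
the object arguments of the pattern itself are natural at the corresponding premises before I acts
on them, and I carries these boundaries to the former ones (`Natural.der_arg`). At a leaf {x}M(x),
naturality determines the boundary syntactically: it has no conversion rule and gives a variable
only its declared type, so the boundary met there is Ξ(M) on the nose (`Natural.lookup_of_generic`).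
Therefore I(M) is derivable at I_*Ξ(M), and mv(P) = objmv(Ξ) says that every object metavariable is
reached.

The equality metavariables are handled by induction along Ξ (`instDer_residue`). Once the earlier
arguments are derivable, instantiating the derivation of 𝔹ᵢ makes I_*𝔹ᵢ well-formed. The residue
declares Mᵢ with exactly this boundary, so the metavariable rule supplies ⋆.

What remains is the admissibility of instantiation, `Der.instantiate`, which takes up most of the
proof. Renaming, substitution and instantiation are cases of one operation `Expr.hom`, and `Der.hom`
does the induction on derivations once, leaving open only the variable and metavariable rules.
Renaming yields weakening; weakening carries substitutions under binders; substitution lets an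
argument {x}e be applied to terms, which is what a metavariable application becomes. The
metavariable congruence rule becomes e[s] ≡ e[t], which calls for substitution of equal terms,
`Der.hom_eqv`. Many of the syntactic identities hold for well-scoped syntax only, whence the
validity hypotheses. -/

theorem liftSub_bvar (n : ℕ) (ρ : ℕ → ℕ) :
    liftSub n (fun i => (.bvar (ρ i) : Expr Sg)) = fun i => .bvar (liftRen n ρ i) := by
  funext i
  unfold liftSub liftRen
  split_ifs <;> simp [Expr.rename]

theorem Expr.rename_eq_subst (ρ : ℕ → ℕ) (e : Expr Sg) :
    e.rename ρ = e.subst fun i => .bvar (ρ i) := by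
  induction e generalizing ρ with
  | sym S args ih => simp only [Expr.rename, Expr.subst, liftSub_bvar, ih]
  | mvar M n ts ih => simp only [Expr.rename, Expr.subst, ih]
  | _ => rfl

theorem liftRen_comp (n : ℕ) (ρ ρ' : ℕ → ℕ) (i : ℕ) :
    liftRen n ρ' (liftRen n ρ i) = liftRen n (fun i => ρ' (ρ i)) i := by
  unfold liftRen
  split_ifs <;> simp_all

theorem Expr.rename_rename (ρ ρ' : ℕ → ℕ) (e : Expr Sg) :
    (e.rename ρ).rename ρ' = e.rename fun i => ρ' (ρ i) := by
  induction e generalizing ρ ρ' with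
  | sym S args ih =>
    simp only [Expr.rename, ih, liftRen_comp]
  | mvar M n ts ih => simp only [Expr.rename, ih]
  | _ => rfl

theorem liftSub_liftRen (n : ℕ) (ρ : ℕ → ℕ) (σ : ℕ → Expr Sg) (i : ℕ) :
    liftSub n σ (liftRen n ρ i) = liftSub n (fun i => σ (ρ i)) i := by
  unfold liftSub liftRen
  split_ifs <;> simp_all

theorem Expr.subst_rename (ρ : ℕ → ℕ) (σ : ℕ → Expr Sg) (e : Expr Sg) :
    (e.rename ρ).subst σ = e.subst fun i => σ (ρ i) := by
  induction e generalizing ρ σ with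
  | sym S args ih => simp only [Expr.rename, Expr.subst, ih, liftSub_liftRen]
  | mvar M n ts ih => simp only [Expr.rename, Expr.subst, ih]
  | _ => rfl

theorem liftSub_rename (n : ℕ) (ρ : ℕ → ℕ) (σ : ℕ → Expr Sg) (i : ℕ) :
    (liftSub n σ i).rename (liftRen n ρ) = liftSub n (fun i => (σ i).rename ρ) i := by
  unfold liftSub
  split_ifs with h
  · simp [Expr.rename, liftRen, h]
  · simp only [Expr.rename_rename]
    congr 1
    funext j
    simp [liftRen]

theorem Expr.rename_subst (ρ : ℕ → ℕ) (σ : ℕ → Expr Sg) (e : Expr Sg) :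
    (e.subst σ).rename ρ = e.subst fun i => (σ i).rename ρ := by
  induction e generalizing ρ σ with
  | sym S args ih => simp only [Expr.rename, Expr.subst, ih, liftSub_rename]
  | mvar M n ts ih => simp only [Expr.rename, Expr.subst, ih]
  | _ => rfl

theorem liftSub_subst (n : ℕ) (σ τ : ℕ → Expr Sg) (i : ℕ) :
    (liftSub n σ i).subst (liftSub n τ) = liftSub n (fun i => (σ i).subst τ) i := by
  by_cases h : i < n
  · simp [liftSub, h, Expr.subst]
  · simp only [liftSub, h, if_false, Expr.subst_rename, Expr.rename_subst]
    congr 1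
    funext j
    simp

theorem Expr.subst_subst (σ τ : ℕ → Expr Sg) (e : Expr Sg) :
    (e.subst σ).subst τ = e.subst fun i => (σ i).subst τ := by
  induction e generalizing σ τ with
  | sym S args ih => simp only [Expr.subst, ih, liftSub_subst]
  | mvar M n ts ih => simp only [Expr.subst, ih]
  | _ => rfl

theorem Expr.subst_bvar (e : Expr Sg) : e.subst .bvar = e := by
  have h (n : ℕ) : liftSub n (.bvar : ℕ → Expr Sg) = .bvar := by
    funext i
    unfold liftSub
    split_ifs with h
    · rfl
    · simp only [Expr.rename, Expr.bvar.injEq]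
      omega
  induction e with
  | sym S args ih => simp only [Expr.subst, h, ih]
  | mvar M n ts ih => simp only [Expr.subst, ih]
  | _ => rfl

theorem liftSub_zero (σ : ℕ → Expr Sg) : liftSub 0 σ = σ := by
  funext i
  simp only [liftSub, Nat.not_lt_zero, if_false, Nat.sub_zero, Nat.add_zero,
    Expr.rename_eq_subst, Expr.subst_bvar]

theorem liftSub_add (m n : ℕ) (σ : ℕ → Expr Sg) :
    liftSub m (liftSub n σ) = liftSub (n + m) σ := by
  funext i
  unfold liftSub
  split_ifs with h₁ h₂ h₃ h₄ h₅
  · rfl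
  · omega
  · simp only [Expr.rename, Expr.bvar.injEq]
    omega
  · omega
  · omega
  · simp only [Expr.rename_rename]
    congr 1
    · funext j; omega
    · congr 1; omega

theorem liftSub_instSub {n : ℕ} (ts : Fin (n + 1) → Expr Sg) (i : ℕ) :
    (liftSub n (instSub fun _ : Fin 1 => ts 0) i).subst (instSub fun j : Fin n => ts j.succ) =
      instSub ts i := by
  unfold liftSub
  split_ifs with h
  · have h' : i < n + 1 := by omega
    simp only [Expr.subst, instSub, h, h', dif_pos]
    congr 1
    ext
    simp [Fin.rev]
    omega
  · rw [Expr.subst_rename]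
    have e : (fun i => instSub (fun j : Fin n => ts j.succ) (i + n)) = .bvar := by
      funext i
      simp [instSub]
    rw [e, Expr.subst_bvar]
    unfold instSub
    by_cases h' : i < n + 1
    · have : i = n := by omega
      subst this
      simp [Fin.rev]
    · have h'' : ¬ i - n < 1 := by omega
      simp only [h', h'', dif_neg, not_false_eq_true, Expr.bvar.injEq]
      omega

/-- Abstractions are opened one at a time from the outside, while boundaries are instantiated
simultaneously; this reconciles the two. The outermost variable, replaced by `ts 0`, has index `n`
below the remaining `n` binders, whence the lift. -/
theorem Expr.inst_succ {n : ℕ} (ts : Fin (n + 1) → Expr Sg) (e : Expr Sg) :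
    (e.subst (liftSub n (instSub fun _ : Fin 1 => ts 0))).inst (fun j : Fin n => ts j.succ) =
      e.inst ts := by
  simp only [Expr.inst, Expr.subst_subst, liftSub_instSub]

theorem Expr.inst_zero (ts : Fin 0 → Expr Sg) (e : Expr Sg) : e.inst ts = e := by
  have : instSub ts = .bvar := by
    funext i
    simp [instSub]
  rw [Expr.inst, this, Expr.subst_bvar]

/-! ### Validity of expressions under substitution -/

theorem Expr.Valid.mono {Θ Θ' : MCtx Sg} {X X' : List ℕ} {k k' : ℕ} {c : SynClass} {e : Expr Sg}
    (h : e.Valid Θ X k c) (hΘ : ∀ M BB, Θ.lookup M = some BB → Θ'.lookup M = some BB)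
    (hX : X ⊆ X') (hk : k ≤ k') : e.Valid Θ' X' k' c := by
  induction e generalizing k k' c with
  | fvar a => exact ⟨h.1, hX h.2⟩
  | bvar i => exact ⟨h.1, h.2.trans_le hk⟩
  | sym S args ih => exact ⟨h.1, fun j => ih j (h.2 j) (by omega)⟩
  | mvar M n ts ih =>
    obtain ⟨hc, ⟨BB, hM, hB⟩, ht⟩ := h
    exact ⟨hc, ⟨BB, hΘ _ _ hM, hB⟩, fun j => ih j (ht j) hk⟩
  | dummy c => exact h

theorem Expr.Valid.rename {Θ : MCtx Sg} {X : List ℕ} {k k' : ℕ} {c : SynClass} {e : Expr Sg}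
    (h : e.Valid Θ X k c) {ρ : ℕ → ℕ} (hρ : ∀ i < k, ρ i < k') : (e.rename ρ).Valid Θ X k' c := by
  induction e generalizing k k' c ρ with
  | fvar a => exact h
  | bvar i => exact ⟨h.1, hρ _ h.2⟩
  | sym S args ih =>
    refine ⟨h.1, fun j => ih j (h.2 j) fun i hi => ?_⟩
    unfold liftRen
    split_ifs with h'
    · omega
    · have := hρ (i - ((Sg.args S).get j).2) (by omega)
      omega
  | mvar M n ts ih => exact ⟨h.1, h.2.1, fun j => ih j (h.2.2 j) hρ⟩
  | dummy c => exact h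

theorem liftSub_valid {Θ : MCtx Sg} {X : List ℕ} {k k' n : ℕ} {τ : ℕ → Expr Sg}
    (hτ : ∀ i < k, (τ i).Valid Θ X k' .tm) :
    ∀ i < k + n, (liftSub n τ i).Valid Θ X (k' + n) .tm := by
  intro i hi
  unfold liftSub
  split_ifs with h
  · exact ⟨rfl, by omega⟩
  · exact (hτ _ (by omega)).rename fun i hi => by omega

theorem Expr.Valid.subst {Θ : MCtx Sg} {X : List ℕ} {k k' : ℕ} {c : SynClass} {e : Expr Sg}
    (h : e.Valid Θ X k c) {τ : ℕ → Expr Sg} (hτ : ∀ i < k, (τ i).Valid Θ X k' .tm) :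
    (e.subst τ).Valid Θ X k' c := by
  induction e generalizing k k' c τ with
  | fvar a => exact h
  | bvar i =>
    obtain ⟨rfl, h⟩ := h
    exact hτ _ h
  | sym S args ih => exact ⟨h.1, fun j => ih j (h.2 j) (liftSub_valid hτ)⟩
  | mvar M n ts ih => exact ⟨h.1, h.2.1, fun j => ih j (h.2.2 j) hτ⟩
  | dummy c => exact h

theorem instSub_valid {Θ : MCtx Sg} {X : List ℕ} {k n : ℕ} {ts : Fin n → Expr Sg}
    (ht : ∀ j, (ts j).Valid Θ X k .tm) : ∀ i < k + n, (instSub ts i).Valid Θ X k .tm := by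
  intro i hi
  unfold instSub
  split_ifs with h
  · exact ht _
  · exact ⟨rfl, by omega⟩

theorem Expr.Valid.inst {Θ : MCtx Sg} {X : List ℕ} {k n : ℕ} {c : SynClass} {e : Expr Sg}
    (h : e.Valid Θ X n c) {ts : Fin n → Expr Sg} (ht : ∀ j, (ts j).Valid Θ X k .tm) :
    (e.inst ts).Valid Θ X k c :=
  h.subst fun i hi => instSub_valid ht i (by omega)

theorem Expr.Valid.subst_congr {Θ : MCtx Sg} {X : List ℕ} {k : ℕ} {c : SynClass} {e : Expr Sg}
    (h : e.Valid Θ X k c) {τ τ' : ℕ → Expr Sg} (hτ : ∀ i < k, τ i = τ' i) :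
    e.subst τ = e.subst τ' := by
  induction e generalizing k c τ τ' with
  | fvar a => rfl
  | bvar i => exact hτ _ h.2
  | sym S args ih =>
    simp only [Expr.subst]
    congr 1
    funext j
    refine ih j (h.2 j) fun i hi => ?_
    unfold liftSub
    split_ifs with h'
    · rfl
    · rw [hτ _ (by omega)]
  | mvar M n ts ih =>
    simp only [Expr.subst]
    congr 1
    funext j
    exact ih j (h.2.2 j) hτ
  | dummy c => rfl

theorem Expr.Valid.subst_self {Θ : MCtx Sg} {X : List ℕ} {k : ℕ} {c : SynClass} {e : Expr Sg}
    (h : e.Valid Θ X k c) {τ : ℕ → Expr Sg} (hτ : ∀ i < k, τ i = .bvar i) : e.subst τ = e := by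
  rw [h.subst_congr hτ, Expr.subst_bvar]

/-- All bound variables of `e` are among the `n` replaced ones, so `τ` only ever meets the terms
`ts`. -/
theorem Expr.Valid.inst_subst {Θ : MCtx Sg} {X : List ℕ} {n : ℕ} {c : SynClass} {e : Expr Sg}
    (h : e.Valid Θ X n c) (ts : Fin n → Expr Sg) (τ : ℕ → Expr Sg) :
    (e.inst ts).subst τ = e.inst fun j => (ts j).subst τ := by
  simp only [Expr.inst, Expr.subst_subst]
  exact h.subst_congr fun i hi => by simp [instSub, hi]

theorem Expr.Valid.inst_generic {Θ : MCtx Sg} {X : List ℕ} {n : ℕ} {c : SynClass} {e : Expr Sg}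
    (h : e.Valid Θ X n c) : (e.inst fun j : Fin n => .bvar (Fin.rev j)) = e :=
  h.subst_self fun i hi => by simp [instSub, hi]

/-! ### Substitution for free variables and metavariables -/

/-- Simultaneous replacement of the free variables, as given by `σ`, and of those metavariables
to which `I` assigns a value. -/
def Expr.hom (σ : ℕ → Expr Sg) (I : List (ℕ × Expr Sg)) : Expr Sg → Expr Sg
  | .fvar a => σ a
  | .bvar i => .bvar i
  | .sym S args => .sym S fun j => (args j).hom σ I
  | .mvar M n ts =>
      match I.lookup M with
      | some e => e.inst fun j => (ts j).hom σ I
      | none => .mvar M n fun j => (ts j).hom σ I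
  | .dummy c => .dummy c

theorem Expr.act_eq_hom (I : List (ℕ × Expr Sg)) : Expr.act I = Expr.hom .fvar I := by
  funext e
  induction e with
  | sym S args ih => simp only [Expr.act, Expr.hom, ih]
  | mvar M n ts ih =>
    cases hI : I.lookup M <;> simp only [Expr.act, Expr.hom, hI, ih]
  | _ => rfl

theorem Expr.hom_fvar_nil (e : Expr Sg) : e.hom .fvar [] = e := by
  induction e with
  | sym S args ih => simp only [Expr.hom, ih]
  | mvar M n ts ih => simp only [Expr.hom, ih, List.lookup]
  | _ => rfl

/-- The values of `σ` and `I` are valid over `Θ'` and `X'`. -/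
structure HomValid (Θ : MCtx Sg) (X : List ℕ) (Θ' : MCtx Sg) (X' : List ℕ)
    (σ : ℕ → Expr Sg) (I : List (ℕ × Expr Sg)) : Prop where
  var : ∀ a ∈ X, (σ a).Valid Θ' X' 0 .tm
  mvar : ∀ M BB, Θ.lookup M = some BB → ∀ e, I.lookup M = some e →
    e.Valid Θ' X' BB.arity.2 BB.arity.1
  none : ∀ M BB, Θ.lookup M = some BB → I.lookup M = none → Θ'.lookup M = some BB

section
variable {Θ Θ' : MCtx Sg} {X X' : List ℕ} {σ σ' : ℕ → Expr Sg} {I I' : List (ℕ × Expr Sg)}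
  {k k' : ℕ} {c : SynClass} {e : Expr Sg}

theorem Expr.Valid.hom (h : e.Valid Θ X k c) (H : HomValid Θ X Θ' X' σ I) :
    (e.hom σ I).Valid Θ' X' k c := by
  induction e generalizing k c with
  | fvar a =>
    obtain ⟨rfl, h⟩ := h
    exact (H.var a h).mono (fun _ _ h => h) (fun _ h => h) (Nat.zero_le _)
  | bvar i => exact h
  | sym S args ih => exact ⟨h.1, fun j => ih j (h.2 j)⟩
  | mvar M n ts ih =>
    obtain ⟨hc, ⟨BB, hM, hB⟩, ht⟩ := h
    simp only [Expr.hom]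
    cases hI : I.lookup M with
    | none => exact ⟨hc, ⟨BB, H.none M BB hM hI, hB⟩, fun j => ih j (ht j)⟩
    | some e =>
      have := H.mvar M BB hM e hI
      rw [hB] at this
      exact this.inst fun j => ih j (ht j)
  | dummy c => exact h

theorem Expr.Valid.hom_congr (h : e.Valid Θ X k c) (hσ : ∀ a ∈ X, σ a = σ' a)
    (hI : ∀ M BB, Θ.lookup M = some BB → I.lookup M = I'.lookup M) :
    e.hom σ I = e.hom σ' I' := by
  induction e generalizing k c with
  | fvar a => exact hσ a h.2
  | bvar i => rfl
  | sym S args ih =>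
    simp only [Expr.hom]
    congr 1
    funext j
    exact ih j (h.2 j)
  | mvar M n ts ih =>
    obtain ⟨hc, ⟨BB, hM, hB⟩, ht⟩ := h
    simp only [Expr.hom, hI M BB hM, fun j => ih j (ht j)]
  | dummy c => rfl

/-- The values of `σ` have no loose bound variables, and the body assigned to a metavariable has
only those replaced by its arguments; so `ρ` acts on neither. -/
theorem Expr.Valid.hom_rename (h : e.Valid Θ X k c) (H : HomValid Θ X Θ' X' σ I) (ρ : ℕ → ℕ) :
    (e.rename ρ).hom σ I = (e.hom σ I).rename ρ := by
  induction e generalizing k c ρ with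
  | fvar a =>
    simp only [Expr.rename, Expr.hom, Expr.rename_eq_subst]
    exact ((H.var a h.2).subst_self fun i hi => absurd hi (Nat.not_lt_zero i)).symm
  | bvar i => rfl
  | sym S args ih =>
    simp only [Expr.rename, Expr.hom]
    congr 1
    funext j
    exact ih j (h.2 j) _
  | mvar M n ts ih =>
    obtain ⟨hc, ⟨BB, hM, hB⟩, ht⟩ := h
    simp only [Expr.rename, Expr.hom, fun j => ih j (ht j)]
    cases hI : I.lookup M with
    | none => rfl
    | some e =>
      have := H.mvar M BB hM e hI
      rw [hB] at this
      simp only [Expr.rename_eq_subst _ (e.inst _), this.inst_subst, Expr.rename_eq_subst]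
  | dummy c => rfl

theorem Expr.Valid.hom_subst (h : e.Valid Θ X k c) (H : HomValid Θ X Θ' X' σ I)
    {τ : ℕ → Expr Sg} (hτ : ∀ i < k, (τ i).Valid Θ X k' .tm) :
    (e.subst τ).hom σ I = (e.hom σ I).subst fun i => (τ i).hom σ I := by
  induction e generalizing k k' c τ with
  | fvar a =>
    exact ((H.var a h.2).subst_self fun i hi => absurd hi (Nat.not_lt_zero i)).symm
  | bvar i => rfl
  | sym S args ih =>
    simp only [Expr.subst, Expr.hom]
    congr 1
    funext j
    rw [ih j (h.2 j) (liftSub_valid hτ)]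
    refine ((h.2 j).hom H).subst_congr fun i hi => ?_
    unfold liftSub
    split_ifs with h'
    · rfl
    · exact (hτ _ (by omega)).hom_rename H _
  | mvar M n ts ih =>
    obtain ⟨hc, ⟨BB, hM, hB⟩, ht⟩ := h
    simp only [Expr.subst, Expr.hom, fun j => ih j (ht j) hτ]
    cases hI : I.lookup M with
    | none => rfl
    | some e =>
      have := H.mvar M BB hM e hI
      rw [hB] at this
      simp only [this.inst_subst]
  | dummy c => rfl

theorem Expr.Valid.hom_inst {n : ℕ} (h : e.Valid Θ X n c) (H : HomValid Θ X Θ' X' σ I)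
    {ts : Fin n → Expr Sg} (ht : ∀ j, (ts j).Valid Θ X k .tm) :
    (e.inst ts).hom σ I = (e.hom σ I).inst fun j => (ts j).hom σ I := by
  unfold Expr.inst
  rw [h.hom_subst H (k' := k) fun i hi => instSub_valid ht i (by omega)]
  exact (h.hom H).subst_congr fun i hi => by simp [instSub, hi]

theorem List.lookup_map_snd {α β : Type*} (f : α → β) (I : List (ℕ × α)) (M : ℕ) :
    (I.map fun p => (p.1, f p.2)).lookup M = (I.lookup M).map f := by
  induction I with
  | nil => rfl
  | cons p I ih =>
    obtain ⟨N, e⟩ := p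
    simp only [List.map_cons, List.lookup_cons, ih]
    split <;> simp_all

/-- Totality of `I` on `Θ` matters: a metavariable left alone by `I` would still be replaced by `I'`
on the left, but not on the right. -/
theorem Expr.Valid.hom_hom (h : e.Valid Θ X k c) (H : HomValid Θ X Θ' X' σ I)
    (hI : ∀ M BB, Θ.lookup M = some BB → ∃ e, I.lookup M = some e)
    {Θ₁ : MCtx Sg} {X₁ : List ℕ} (H' : HomValid Θ' X' Θ₁ X₁ σ' I') :
    (e.hom σ I).hom σ' I' =
      e.hom (fun a => (σ a).hom σ' I') (I.map fun p => (p.1, p.2.hom σ' I')) := by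
  induction e generalizing k c with
  | fvar a => rfl
  | bvar i => rfl
  | sym S args ih =>
    simp only [Expr.hom]
    congr 1
    funext j
    exact ih j (h.2 j)
  | mvar M n ts ih =>
    obtain ⟨hc, ⟨BB, hM, hB⟩, ht⟩ := h
    obtain ⟨e, he⟩ := hI M BB hM
    have := H.mvar M BB hM e he
    rw [hB] at this
    simp only [Expr.hom, he, List.lookup_map_snd, Option.map_some, ← fun j => ih j (ht j)]
    exact this.hom_inst H' fun j => (ht j).hom H
  | dummy c => rfl

end

/-! ### Association lists -/

theorem lookup_eq_none_iff {α : Type*} {L : List (ℕ × α)} {M : ℕ} :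
    L.lookup M = none ↔ M ∉ dom L := by
  induction L with
  | nil => simp [dom]
  | cons p L ih =>
    obtain ⟨N, x⟩ := p
    simp only [List.lookup_cons, dom, List.map_cons, List.mem_cons, not_or]
    by_cases h : M = N
    · simp [h]
    · have : (M == N) = false := by simpa using h
      simp only [this, h, not_false_eq_true, true_and]
      exact ih

theorem mem_dom_of_lookup {α : Type*} {L : List (ℕ × α)} {M : ℕ} {x : α}
    (h : L.lookup M = some x) : M ∈ dom L := by
  by_contra h'
  rw [lookup_eq_none_iff.2 h'] at h
  cases h

theorem exists_lookup_of_mem_dom {α : Type*} {L : List (ℕ × α)} {M : ℕ} (h : M ∈ dom L) :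
    ∃ x, L.lookup M = some x := by
  rw [← not_not (a := M ∈ dom L), ← lookup_eq_none_iff] at h
  exact Option.ne_none_iff_exists'.1 h

theorem lookup_append_left {α : Type*} {L L' : List (ℕ × α)} {M : ℕ} {x : α}
    (h : L.lookup M = some x) : (L ++ L').lookup M = some x := by
  rw [List.lookup_append, h]
  rfl

theorem lookup_append_right {α : Type*} {L L' : List (ℕ × α)} {M : ℕ} (h : M ∉ dom L) :
    (L ++ L').lookup M = L'.lookup M := by
  rw [List.lookup_append, lookup_eq_none_iff.2 h]
  rfl

theorem lookup_of_mem {α : Type*} {L : List (ℕ × α)} (hL : (dom L).Nodup) {M : ℕ} {x : α}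
    (h : (M, x) ∈ L) : L.lookup M = some x := by
  induction L with
  | nil => cases h
  | cons p L ih =>
    obtain ⟨N, y⟩ := p
    simp only [dom, List.map_cons, List.nodup_cons] at hL
    rcases List.mem_cons.1 h with h | h
    · cases h
      simp
    · have : M ∈ dom L := List.mem_map.2 ⟨_, h, rfl⟩
      have hne : (M == N) = false := by
        rw [beq_eq_false_iff_ne]
        rintro rfl
        exact hL.1 this
      rw [List.lookup_cons, hne]
      exact ih hL.2 h

theorem mem_of_lookup {α : Type*} {L : List (ℕ × α)} {M : ℕ} {x : α}
    (h : L.lookup M = some x) : (M, x) ∈ L := by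
  induction L with
  | nil => cases h
  | cons p L ih =>
    obtain ⟨N, y⟩ := p
    rw [List.lookup_cons] at h
    by_cases hMN : M = N
    · subst hMN
      simp_all
    · have : (M == N) = false := by simpa using hMN
      rw [this] at h
      exact List.mem_cons_of_mem _ (ih h)

theorem dom_append {α : Type*} (L L' : List (ℕ × α)) : dom (L ++ L') = dom L ++ dom L' :=
  List.map_append

theorem nodup_dom_concat {α : Type*} {L : List (ℕ × α)} {M : ℕ} {x : α} :
    (dom (L ++ [(M, x)])).Nodup ↔ (dom L).Nodup ∧ M ∉ dom L := by
  rw [dom_append, List.nodup_append]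
  constructor
  · rintro ⟨h, -, h'⟩
    exact ⟨h, fun hM => h' _ hM M (by simp [dom]) rfl⟩
  · rintro ⟨h, h'⟩
    refine ⟨h, by simp [dom], fun a ha b hb hab => h' ?_⟩
    simp only [dom, List.map_cons, List.map_nil, List.mem_singleton] at hb
    rwa [← hb, ← hab]

theorem exists_not_mem_dom {α : Type*} (L : List (ℕ × α)) : ∃ a, a ∉ dom L :=
  (dom L).toFinset.exists_notMem.imp fun a h => by simpa using h

/-- Contexts are described by a condition on each entry relative to the prefix before it. This turns
such a condition into a recursion on the last entry, for variable and metavariable contexts alike.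
-/
theorem forall_concat {α : Type*} {p : (L : List α) → α → Prop} {L : List α} {x : α} :
    (∀ i : Fin (L ++ [x]).length, p ((L ++ [x]).take i) ((L ++ [x]).get i)) ↔
      (∀ i : Fin L.length, p (L.take i) (L.get i)) ∧ p L x := by
  constructor
  · intro h
    constructor
    · intro i
      have := h ⟨i, by rw [List.length_append]; omega⟩
      simpa [List.take_append_of_le_length i.2.le, List.getElem_append_left i.2] using this
    · simpa using h ⟨L.length, by simp⟩
  · rintro ⟨h, h'⟩ ⟨i, hi⟩
    by_cases hi' : i < L.length
    · have := h ⟨i, hi'⟩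
      simpa [List.take_append_of_le_length hi'.le, List.getElem_append_left hi'] using this
    · have : i = L.length := by
        simp at hi
        omega
      subst this
      simpa using h'

/-! ### Statements -/

def ABdry.map (f : Expr Sg → Expr Sg) : ABdry Sg → ABdry Sg
  | .thesis B => .thesis (B.map f)
  | .abs A BB => .abs (f A) (BB.map f)

def AStmt.map (f : Expr Sg → Expr Sg) : AStmt Sg → AStmt Sg
  | .thesis θ => .thesis (θ.map f)
  | .abs A J => .abs (f A) (J.map f)

/-- The types of the abstracted variables of a statement. -/
def AStmt.tel : AStmt Sg → List (Expr Sg)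
  | .thesis _ => []
  | .abs A J => A :: J.tel

/-- The thesis of an abstracted statement. -/
def AStmt.concl : AStmt Sg → Thesis Sg
  | .thesis θ => θ
  | .abs _ J => J.concl

/-- Replacement of the thesis of an abstracted statement. -/
def AStmt.withConcl (θ : Thesis Sg) : AStmt Sg → AStmt Sg
  | .thesis _ => .thesis θ
  | .abs A J => .abs A (J.withConcl θ)

@[simp] theorem Bdry.cls_map (f : Expr Sg → Expr Sg) (B : Bdry Sg) : (B.map f).cls = B.cls := by
  cases B <;> rfl

theorem Bdry.map_map (f g : Expr Sg → Expr Sg) (B : Bdry Sg) :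
    (B.map f).map g = B.map fun e => g (f e) := by
  cases B <;> rfl

theorem Thesis.map_map (f g : Expr Sg → Expr Sg) (θ : Thesis Sg) :
    (θ.map f).map g = θ.map fun e => g (f e) := by
  cases θ <;> simp only [Thesis.map, Bdry.map_map]

theorem Bdry.map_id {f : Expr Sg → Expr Sg} (hf : ∀ e, f e = e) (B : Bdry Sg) : B.map f = B := by
  cases B <;> simp only [Bdry.map, hf]

theorem Thesis.map_id {f : Expr Sg → Expr Sg} (hf : ∀ e, f e = e) (θ : Thesis Sg) :
    θ.map f = θ := by
  cases θ <;> simp only [Thesis.map, hf, Bdry.map_id hf]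

theorem ABdry.act_eq_map (I : List (ℕ × Expr Sg)) (BB : ABdry Sg) :
    BB.act I = BB.map (Expr.act I) := by
  induction BB with
  | thesis B => rfl
  | abs A BB ih => simp only [ABdry.act, ABdry.map, ih]

@[simp] theorem ABdry.tel_map (f : Expr Sg → Expr Sg) (BB : ABdry Sg) :
    (BB.map f).tel = BB.tel.map f := by
  induction BB with
  | thesis B => rfl
  | abs A BB ih => simp only [ABdry.map, ABdry.tel, ih, List.map_cons]

@[simp] theorem ABdry.concl_map (f : Expr Sg → Expr Sg) (BB : ABdry Sg) :
    (BB.map f).concl = BB.concl.map f := by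
  induction BB with
  | thesis B => rfl
  | abs A BB ih => exact ih

@[simp] theorem ABdry.arity_map (f : Expr Sg → Expr Sg) (BB : ABdry Sg) :
    (BB.map f).arity = BB.arity := by
  simp [ABdry.arity]

theorem ABdry.map_fill (f : Expr Sg → Expr Sg) (BB : ABdry Sg) (e : Expr Sg) :
    (BB.fill e).map f = (BB.map f).fill (f e) := by
  induction BB with
  | thesis B => rfl
  | abs A BB ih => simp only [ABdry.fill, ABdry.map, AStmt.map, ih]

theorem ABdry.map_toStmt (f : Expr Sg → Expr Sg) (BB : ABdry Sg) :
    BB.toStmt.map f = (BB.map f).toStmt := by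
  induction BB with
  | thesis B => rfl
  | abs A BB ih => simp only [ABdry.toStmt, ABdry.map, AStmt.map, ih]

theorem Bdry.map_fillEq {f : Expr Sg → Expr Sg} (hf : ∀ c, f (.dummy c) = .dummy c) (B : Bdry Sg)
    (e e' : Expr Sg) : (B.fillEq e e').map f = (B.map f).fillEq (f e) (f e') := by
  cases B <;> simp only [Bdry.fillEq, Bdry.map, FTT.eqTy, FTT.eqTm, AStmt.map, Thesis.map, hf]

theorem ABdry.map_fillEq {f : Expr Sg → Expr Sg} (hf : ∀ c, f (.dummy c) = .dummy c)
    (BB : ABdry Sg) (e e' : Expr Sg) :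
    (BB.fillEq e e').map f = (BB.map f).fillEq (f e) (f e') := by
  induction BB with
  | thesis B => exact Bdry.map_fillEq hf B e e'
  | abs A BB ih => simp only [ABdry.fillEq, ABdry.map, AStmt.map, ih]

@[simp] theorem ABdry.tel_fill (BB : ABdry Sg) (e : Expr Sg) : (BB.fill e).tel = BB.tel := by
  induction BB with
  | thesis B => rfl
  | abs A BB ih => simp only [ABdry.fill, ABdry.tel, AStmt.tel, ih]

@[simp] theorem ABdry.concl_fill (BB : ABdry Sg) (e : Expr Sg) :
    (BB.fill e).concl = .jdg BB.concl e := by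
  induction BB with
  | thesis B => rfl
  | abs A BB ih => exact ih

@[simp] theorem ABdry.tel_toStmt (BB : ABdry Sg) : BB.toStmt.tel = BB.tel := by
  induction BB with
  | thesis B => rfl
  | abs A BB ih => simp only [ABdry.toStmt, ABdry.tel, AStmt.tel, ih]

@[simp] theorem ABdry.concl_toStmt (BB : ABdry Sg) : BB.toStmt.concl = .bdry BB.concl := by
  induction BB with
  | thesis B => rfl
  | abs A BB ih => exact ih

theorem ABdry.withConcl_toStmt (BB : ABdry Sg) (e : Expr Sg) :
    BB.toStmt.withConcl (.jdg BB.concl e) = BB.fill e := by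
  induction BB with
  | thesis B => rfl
  | abs A BB ih => simp only [ABdry.toStmt, ABdry.fill, ABdry.concl, AStmt.withConcl, ih]

theorem ABdry.ext_tel_concl {BB BB' : ABdry Sg} (h : BB.tel = BB'.tel)
    (h' : BB.concl = BB'.concl) : BB = BB' := by
  induction BB generalizing BB' with
  | thesis B =>
    cases BB' with
    | thesis B' => exact congrArg _ h'
    | abs A BB' => simp [ABdry.tel] at h
  | abs A BB ih =>
    cases BB' with
    | thesis B' => simp [ABdry.tel] at h
    | abs A' BB' =>
      simp only [ABdry.tel, List.cons.injEq] at h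
      rw [h.1, ih h.2 h']

theorem AStmt.concl_subst (σ : ℕ → Expr Sg) (J : AStmt Sg) :
    (J.subst σ).concl = J.concl.map (Expr.subst (liftSub J.tel.length σ)) := by
  induction J generalizing σ with
  | thesis θ => simp [AStmt.concl, AStmt.subst, AStmt.tel, liftSub_zero]
  | abs A J ih =>
    simp only [AStmt.concl, AStmt.subst, AStmt.tel, ih, liftSub_add, List.length_cons, add_comm]

theorem AStmt.tel_subst (σ : ℕ → Expr Sg) (J : AStmt Sg) (j : ℕ) :
    (J.subst σ).tel[j]? = J.tel[j]?.map (Expr.subst (liftSub j σ)) := by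
  induction J generalizing σ j with
  | thesis θ => simp [AStmt.subst, AStmt.tel]
  | abs A J ih =>
    cases j with
    | zero => simp [AStmt.subst, AStmt.tel, liftSub_zero]
    | succ j => simp [AStmt.subst, AStmt.tel, ih, liftSub_add, add_comm]

theorem AStmt.length_tel_subst (σ : ℕ → Expr Sg) (J : AStmt Sg) :
    (J.subst σ).tel.length = J.tel.length := by
  induction J generalizing σ with
  | thesis θ => rfl
  | abs A J ih => simp [AStmt.subst, AStmt.tel, ih]

theorem AStmt.withConcl_subst (σ : ℕ → Expr Sg) (J : AStmt Sg) (θ : Thesis Sg) :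
    (J.withConcl θ).subst σ =
      (J.subst σ).withConcl (θ.map (Expr.subst (liftSub J.tel.length σ))) := by
  induction J generalizing σ with
  | thesis θ => simp [AStmt.withConcl, AStmt.subst, AStmt.tel, liftSub_zero]
  | abs A J ih =>
    simp only [AStmt.withConcl, AStmt.subst, AStmt.tel, ih, liftSub_add, List.length_cons, add_comm]

/-! ### Validity of statements -/

section
variable {Θ Θ' : MCtx Sg} {X X' : List ℕ} {σ σ' : ℕ → Expr Sg} {I I' : List (ℕ × Expr Sg)}
  {k k' : ℕ}

theorem Bdry.Valid.map {B : Bdry Sg} (h : B.Valid Θ X k) {f : Expr Sg → Expr Sg}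
    (hf : ∀ e c, e.Valid Θ X k c → (f e).Valid Θ' X' k' c) : (B.map f).Valid Θ' X' k' := by
  cases B with
  | isTy => trivial
  | isTm A => exact hf _ _ h
  | eqTy A B => exact ⟨hf _ _ h.1, hf _ _ h.2⟩
  | eqTm s t A => exact ⟨hf _ _ h.1, hf _ _ h.2.1, hf _ _ h.2.2⟩

theorem Bdry.Valid.map_congr {B : Bdry Sg} (h : B.Valid Θ X k) {f g : Expr Sg → Expr Sg}
    (hf : ∀ e c, e.Valid Θ X k c → f e = g e) : B.map f = B.map g := by
  cases B with
  | isTy => rfl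
  | isTm A => exact congrArg _ (hf _ _ h)
  | eqTy A B => simp only [Bdry.map, hf _ _ h.1, hf _ _ h.2]
  | eqTm s t A => simp only [Bdry.map, hf _ _ h.1, hf _ _ h.2.1, hf _ _ h.2.2]

theorem Thesis.Valid.map {θ : Thesis Sg} (h : θ.Valid Θ X k) {f : Expr Sg → Expr Sg}
    (hf : ∀ e c, e.Valid Θ X k c → (f e).Valid Θ' X' k' c) : (θ.map f).Valid Θ' X' k' := by
  cases θ with
  | bdry B => exact Bdry.Valid.map h hf
  | jdg B e => exact ⟨h.1.map hf, by rw [Bdry.cls_map]; exact hf _ _ h.2⟩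

theorem Thesis.Valid.map_congr {θ : Thesis Sg} (h : θ.Valid Θ X k) {f g : Expr Sg → Expr Sg}
    (hf : ∀ e c, e.Valid Θ X k c → f e = g e) : θ.map f = θ.map g := by
  cases θ with
  | bdry B => exact congrArg _ (Bdry.Valid.map_congr h hf)
  | jdg B e => simp only [Thesis.map, h.1.map_congr hf, hf _ _ h.2]

theorem AStmt.Valid.mono {J : AStmt Sg} (h : J.Valid Θ X k)
    (hΘ : ∀ M BB, Θ.lookup M = some BB → Θ'.lookup M = some BB) (hX : X ⊆ X') :
    J.Valid Θ' X' k := by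
  induction J generalizing k with
  | thesis θ =>
    have := Thesis.Valid.map (f := fun e => e) h
      fun e c he => Expr.Valid.mono (k' := k) he hΘ hX le_rfl
    rwa [Thesis.map_id fun _ => rfl] at this
  | abs A J ih => exact ⟨Expr.Valid.mono h.1 hΘ hX le_rfl, ih h.2⟩

theorem AStmt.Valid.subst {J : AStmt Sg} (h : J.Valid Θ X k) {τ : ℕ → Expr Sg}
    (hτ : ∀ i < k, (τ i).Valid Θ X k' .tm) : (J.subst τ).Valid Θ X k' := by
  induction J generalizing k k' τ with
  | thesis θ => exact Thesis.Valid.map h fun e c he => he.subst hτ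
  | abs A J ih => exact ⟨h.1.subst hτ, ih h.2 (liftSub_valid hτ)⟩

theorem AStmt.Valid.subst_congr {J : AStmt Sg} (h : J.Valid Θ X k) {τ τ' : ℕ → Expr Sg}
    (hτ : ∀ i < k, τ i = τ' i) : J.subst τ = J.subst τ' := by
  induction J generalizing k τ τ' with
  | thesis θ => exact congrArg _ (Thesis.Valid.map_congr h fun e c he => he.subst_congr hτ)
  | abs A J ih =>
    simp only [AStmt.subst]
    rw [h.1.subst_congr hτ, ih h.2]
    intro i hi
    unfold liftSub
    split_ifs with h'
    · rfl
    · rw [hτ _ (by omega)]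

theorem AStmt.Valid.hom {J : AStmt Sg} (h : J.Valid Θ X k) (H : HomValid Θ X Θ' X' σ I) :
    (J.map (Expr.hom σ I)).Valid Θ' X' k := by
  induction J generalizing k with
  | thesis θ => exact Thesis.Valid.map h fun e c he => he.hom H
  | abs A J ih => exact ⟨h.1.hom H, ih h.2⟩

theorem AStmt.Valid.hom_congr {J : AStmt Sg} (h : J.Valid Θ X k) (hσ : ∀ a ∈ X, σ a = σ' a)
    (hI : ∀ M BB, Θ.lookup M = some BB → I.lookup M = I'.lookup M) :
    J.map (Expr.hom σ I) = J.map (Expr.hom σ' I') := by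
  induction J generalizing k with
  | thesis θ => exact congrArg _ (Thesis.Valid.map_congr h fun e c he => he.hom_congr hσ hI)
  | abs A J ih => simp only [AStmt.map, ih h.2, h.1.hom_congr hσ hI]

theorem AStmt.Valid.hom_subst {J : AStmt Sg} (h : J.Valid Θ X k) (H : HomValid Θ X Θ' X' σ I)
    {τ : ℕ → Expr Sg} (hτ : ∀ i < k, (τ i).Valid Θ X k' .tm) :
    (J.subst τ).map (Expr.hom σ I) =
      (J.map (Expr.hom σ I)).subst fun i => (τ i).hom σ I := by
  induction J generalizing k k' τ with
  | thesis θ =>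
    simp only [AStmt.map, AStmt.subst, Thesis.map_map]
    exact congrArg _ (Thesis.Valid.map_congr h fun e c he => he.hom_subst H hτ)
  | abs A J ih =>
    simp only [AStmt.map, AStmt.subst]
    rw [h.1.hom_subst H hτ, ih h.2 (liftSub_valid hτ)]
    congr 1
    refine (h.2.hom H).subst_congr fun i hi => ?_
    unfold liftSub
    split_ifs with h'
    · rfl
    · exact (hτ _ (by omega)).hom_rename H _

theorem fvar_valid {a : ℕ} (ha : a ∈ X) : (.fvar a : Expr Sg).Valid Θ X k .tm := ⟨rfl, ha⟩

theorem instSub_one_valid {t : Expr Sg} (ht : t.Valid Θ X k .tm) :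
    ∀ i < 1, (instSub (fun _ : Fin 1 => t) i).Valid Θ X k .tm :=
  fun i hi => instSub_valid (fun _ => ht) i (by omega)

theorem AStmt.Valid.openVar {J : AStmt Sg} (h : J.Valid Θ X 1) {a : ℕ} (ha : a ∈ X) :
    (J.openVar a).Valid Θ X 0 :=
  h.subst (instSub_one_valid (fvar_valid ha))

/-- The abstraction case of every action on derivations: a body opened at `a` and then mapped is the
mapped body opened at `b`. On the body itself `σ'` agrees with `σ`, which never sees `a`. -/
theorem AStmt.Valid.hom_openVar {J : AStmt Sg} (h : J.Valid Θ X 1) {a b : ℕ}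
    (hσ : ∀ x ∈ X, σ' x = σ x) (hσ' : σ' a = .fvar b)
    (H : HomValid Θ (X ++ [a]) Θ' X' σ' I) :
    (J.openVar a).map (Expr.hom σ' I) = (J.map (Expr.hom σ I)).openVar b := by
  have hJ : J.Valid Θ (X ++ [a]) 1 := h.mono (fun _ _ h => h) (by simp)
  rw [AStmt.openVar, hJ.hom_subst H (k' := 0) (instSub_one_valid (fvar_valid (by simp))),
    ← h.hom_congr hσ fun _ _ _ => rfl]
  refine (hJ.hom H).subst_congr fun i hi => ?_
  simp [instSub, hi, Expr.hom, hσ']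

theorem AStmt.Valid.tel {J : AStmt Sg} (h : J.Valid Θ X k) {j : ℕ} {A : Expr Sg}
    (hj : J.tel[j]? = some A) : A.Valid Θ X (k + j) .ty := by
  induction J generalizing k j with
  | thesis θ => simp [AStmt.tel] at hj
  | abs A' J ih =>
    cases j with
    | zero =>
      simp only [AStmt.tel, List.getElem?_cons_zero, Option.some.injEq] at hj
      rw [← hj]
      exact h.1
    | succ j =>
      simp only [AStmt.tel, List.getElem?_cons_succ] at hj
      have := ih h.2 hj
      rwa [show k + (j + 1) = k + 1 + j by omega]

theorem AStmt.Valid.concl {J : AStmt Sg} (h : J.Valid Θ X k) :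
    J.concl.Valid Θ X (k + J.tel.length) := by
  induction J generalizing k with
  | thesis θ => exact h
  | abs A' J ih =>
    have := ih h.2
    rw [AStmt.tel, List.length_cons, show k + (J.tel.length + 1) = k + 1 + J.tel.length by omega]
    exact this

theorem AStmt.Valid.withConcl {J : AStmt Sg} (h : J.Valid Θ X k) {θ : Thesis Sg}
    (hθ : θ.Valid Θ X (k + J.tel.length)) : (J.withConcl θ).Valid Θ X k := by
  induction J generalizing k with
  | thesis θ => exact hθ
  | abs A' J ih =>
    refine ⟨h.1, ih h.2 ?_⟩
    rwa [AStmt.tel, List.length_cons,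
      show k + (J.tel.length + 1) = k + 1 + J.tel.length by omega] at hθ

theorem ABdry.fill_valid_iff {BB : ABdry Sg} {e : Expr Sg} :
    (BB.fill e).Valid Θ X k ↔
      BB.toStmt.Valid Θ X k ∧ e.Valid Θ X (k + BB.arity.2) BB.arity.1 := by
  constructor
  · intro h
    have h' := h.concl
    simp only [ABdry.tel_fill, ABdry.concl_fill] at h'
    refine ⟨?_, h'.2⟩
    have := h.withConcl (θ := .bdry BB.concl) (by rw [ABdry.tel_fill]; exact h'.1)
    suffices hs : (BB.fill e).withConcl (.bdry BB.concl) = BB.toStmt by rwa [hs] at this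
    clear h h' this
    induction BB with
    | thesis B => rfl
    | abs A BB ih => simp only [ABdry.toStmt, ABdry.fill, ABdry.concl, AStmt.withConcl, ih]
  · rintro ⟨h, h'⟩
    rw [← ABdry.withConcl_toStmt]
    refine h.withConcl ?_
    have := h.concl
    simp only [ABdry.tel_toStmt, ABdry.concl_toStmt] at this ⊢
    exact ⟨this, h'⟩

/-! ### Validity of contexts -/

theorem VCtx.valid_concat {Γ : VCtx Sg} {a : ℕ} {A : Expr Sg} :
    VCtx.Valid Θ (Γ ++ [(a, A)]) ↔ VCtx.Valid Θ Γ ∧ a ∉ dom Γ ∧ A.Valid Θ (dom Γ) 0 .ty := by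
  have h := forall_concat (p := fun L x => x.2.Valid Θ (dom L) 0 .ty) (L := Γ) (x := (a, A))
  have h' := nodup_dom_concat (L := Γ) (M := a) (x := A)
  exact ⟨fun ⟨h₁, h₂⟩ => ⟨⟨(h'.1 h₁).1, (h.1 h₂).1⟩, (h'.1 h₁).2, (h.1 h₂).2⟩,
    fun ⟨h₁, h₂, h₃⟩ => ⟨h'.2 ⟨h₁.1, h₂⟩, h.2 ⟨h₁.2, h₃⟩⟩⟩

theorem MCtx.valid_concat {M : ℕ} {BB : ABdry Sg} :
    MCtx.Valid (Θ ++ [(M, BB)]) ↔ MCtx.Valid Θ ∧ M ∉ dom Θ ∧ BB.toStmt.Valid Θ [] 0 := by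
  have h := forall_concat (p := fun L x => x.2.toStmt.Valid L [] 0) (L := Θ) (x := (M, BB))
  have h' := nodup_dom_concat (L := Θ) (M := M) (x := BB)
  exact ⟨fun ⟨h₁, h₂⟩ => ⟨⟨(h'.1 h₁).1, (h.1 h₂).1⟩, (h'.1 h₁).2, (h.1 h₂).2⟩,
    fun ⟨h₁, h₂, h₃⟩ => ⟨h'.2 ⟨h₁.1, h₂⟩, h.2 ⟨h₁.2, h₃⟩⟩⟩

theorem VCtx.valid_nil : VCtx.Valid Θ [] := ⟨List.nodup_nil, fun i => i.elim0⟩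

theorem MCtx.valid_nil : MCtx.Valid ([] : MCtx Sg) := ⟨List.nodup_nil, fun i => i.elim0⟩

theorem lookup_take {α : Type*} {L : List (ℕ × α)} {n M : ℕ} {x : α}
    (h : (L.take n).lookup M = some x) : L.lookup M = some x := by
  rw [← List.take_append_drop n L]
  exact lookup_append_left h

theorem MCtx.Valid.lookup {M : ℕ} {BB : ABdry Sg} (h : MCtx.Valid Θ)
    (hM : Θ.lookup M = some BB) : BB.toStmt.Valid Θ [] 0 := by
  obtain ⟨i, hi⟩ := List.get_of_mem (mem_of_lookup hM)
  have := h.2 i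
  rw [hi] at this
  exact this.mono (fun _ _ => lookup_take) fun _ h => h

theorem VCtx.Valid.lookup {Γ : VCtx Sg} {a : ℕ} {A : Expr Sg} (h : VCtx.Valid Θ Γ)
    (ha : Γ.lookup a = some A) : A.Valid Θ (dom Γ) 0 .ty := by
  obtain ⟨i, hi⟩ := List.get_of_mem (mem_of_lookup ha)
  have := h.2 i
  rw [hi] at this
  refine this.mono (fun _ _ h => h) ?_ le_rfl
  exact List.map_subset _ (List.take_subset _ _)

end

/-! ### Instantiations of premises -/

theorem Der.valid {T : RawTT.{u, v} Sg} {Θ : MCtx Sg} {Γ : VCtx Sg} {J : AStmt Sg}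
    (h : Der T Θ Γ J) : HValid Θ Γ J := by
  cases h <;> assumption

theorem lookup_get {α : Type*} {L : List (ℕ × α)} (h : (dom L).Nodup) (i : Fin L.length) :
    L.lookup (L.get i).1 = some (L.get i).2 :=
  lookup_of_mem h (List.get_mem L i)

theorem dom_assign (Ξ : MCtx Sg) (es : Fin Ξ.length → Expr Sg) : dom (assign Ξ es) = dom Ξ := by
  rw [dom, assign, List.map_ofFn, dom]
  exact List.ofFn_getElem_eq_map Ξ Prod.fst

theorem lookup_assign {Ξ : MCtx Sg} (h : (dom Ξ).Nodup) (es : Fin Ξ.length → Expr Sg)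
    (i : Fin Ξ.length) : (assign Ξ es).lookup (Ξ.get i).1 = some (es i) :=
  lookup_of_mem (by rwa [dom_assign]) ((List.mem_ofFn' _ _).2 ⟨i, rfl⟩)

theorem exists_get_of_lookup {α : Type*} {L : List (ℕ × α)} {M : ℕ} {x : α}
    (h : L.lookup M = some x) : ∃ i : Fin L.length, (L.get i) = (M, x) := by
  obtain ⟨i, hi⟩ := List.get_of_mem (mem_of_lookup h)
  exact ⟨i, hi⟩

theorem assign_homValid {Ξ : MCtx Sg} (h : (dom Ξ).Nodup) {es : Fin Ξ.length → Expr Sg}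
    {Θ : MCtx Sg} {X : List ℕ}
    (he : ∀ i, (es i).Valid Θ X (Ξ.get i).2.arity.2 (Ξ.get i).2.arity.1) :
    HomValid Ξ [] Θ X .fvar (assign Ξ es) where
  var a ha := by cases ha
  mvar M BB hM e hI := by
    obtain ⟨i, hi⟩ := exists_get_of_lookup hM
    have := lookup_assign h es i
    rw [hi, hI] at this
    have hh := he i
    rw [hi] at hh
    rw [Option.some.inj this]
    exact hh
  none M BB hM hI := by
    obtain ⟨i, hi⟩ := exists_get_of_lookup hM
    have := lookup_assign h es i
    rw [hi, hI] at this
    cases this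

theorem exists_lookup_assign {Ξ : MCtx Sg} (h : (dom Ξ).Nodup) (es : Fin Ξ.length → Expr Sg)
    (M : ℕ) (BB : ABdry Sg) (hM : Ξ.lookup M = some BB) :
    ∃ e, (assign Ξ es).lookup M = some e := by
  obtain ⟨i, hi⟩ := exists_get_of_lookup hM
  exact ⟨_, by simpa only [hi] using lookup_assign h es i⟩

theorem dom_take {α : Type*} (L : List (ℕ × α)) (n : ℕ) : dom (L.take n) = (dom L).take n :=
  List.map_take

theorem lookup_assign_take {Ξ : MCtx Sg} (es : Fin Ξ.length → Expr Sg)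
    (n : ℕ) {M : ℕ} {BB : ABdry Sg} (hM : (Ξ.take n).lookup M = some BB) :
    ((assign Ξ es).take n).lookup M = (assign Ξ es).lookup M := by
  have h' : M ∈ dom ((assign Ξ es).take n) := by
    rw [dom_take, dom_assign, ← dom_take]
    exact mem_dom_of_lookup hM
  obtain ⟨e, he⟩ := exists_lookup_of_mem_dom h'
  rw [he, lookup_take he]

theorem ABdry.toStmt_injective {BB BB' : ABdry Sg} (h : BB.toStmt = BB'.toStmt) : BB = BB' := by
  apply ABdry.ext_tel_concl
  · rw [← ABdry.tel_toStmt, h, ABdry.tel_toStmt]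
  · have := congrArg AStmt.concl h
    simpa using this

/-- The `i`-th boundary mentions only earlier metavariables, so the restricted instantiation may be
replaced by the whole one, which is the same for all premises. -/
theorem premBdry_eq {Ξ : MCtx Sg} (h : MCtx.Valid Ξ) (es : Fin Ξ.length → Expr Sg)
    (i : Fin Ξ.length) : premBdry Ξ es i = (Ξ.get i).2.map (Expr.hom .fvar (assign Ξ es)) := by
  apply ABdry.toStmt_injective
  rw [premBdry, ABdry.act_eq_map, Expr.act_eq_hom, ← ABdry.map_toStmt, ← ABdry.map_toStmt]
  exact (h.2 i).hom_congr (fun _ _ => rfl) fun M BB hM => lookup_assign_take es i hM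

theorem ABdry.map_hom_of_valid {BB : ABdry Sg} {Θ : MCtx Sg} (h : BB.toStmt.Valid Θ [] 0)
    (σ σ' : ℕ → Expr Sg) (I : List (ℕ × Expr Sg)) :
    BB.map (Expr.hom σ I) = BB.map (Expr.hom σ' I) := by
  apply ABdry.toStmt_injective
  rw [← ABdry.map_toStmt, ← ABdry.map_toStmt]
  exact h.hom_congr (fun a ha => by cases ha) fun _ _ _ => rfl

theorem map_assign {Ξ : MCtx Sg} (es : Fin Ξ.length → Expr Sg) (f : Expr Sg → Expr Sg) :
    ((assign Ξ es).map fun p => (p.1, f p.2)) = assign Ξ fun i => f (es i) := by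
  rw [assign, List.map_ofFn]
  rfl

section
variable {Ξ Θ Θ' : MCtx Sg} {X X' : List ℕ} {σ : ℕ → Expr Sg} {I : List (ℕ × Expr Sg)}
  {es : Fin Ξ.length → Expr Sg}

/-- Rules are closed and use only the metavariables of their premises, so a morphism applied to an
instance of a rule affects just the instantiation. Instances of specific rules are thus sent to
instances of the same rules. -/
theorem Expr.Valid.hom_act_assign {e : Expr Sg} {k : ℕ} {c : SynClass} (he : e.Valid Ξ [] k c)
    (hΞ : (dom Ξ).Nodup) (hes : ∀ i, (es i).Valid Θ X (Ξ.get i).2.arity.2 (Ξ.get i).2.arity.1)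
    (H : HomValid Θ X Θ' X' σ I) :
    (e.act (assign Ξ es)).hom σ I = e.act (assign Ξ fun i => (es i).hom σ I) := by
  rw [Expr.act_eq_hom, Expr.act_eq_hom, he.hom_hom (assign_homValid hΞ hes)
    (exists_lookup_assign hΞ es) H, map_assign]
  exact he.hom_congr (fun a ha => by cases ha) fun _ _ _ => rfl

theorem Bdry.Valid.hom_act_assign {B : Bdry Sg} {k : ℕ} (hB : B.Valid Ξ [] k)
    (hΞ : (dom Ξ).Nodup) (hes : ∀ i, (es i).Valid Θ X (Ξ.get i).2.arity.2 (Ξ.get i).2.arity.1)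
    (H : HomValid Θ X Θ' X' σ I) :
    (B.act (assign Ξ es)).map (Expr.hom σ I) = B.act (assign Ξ fun i => (es i).hom σ I) := by
  rw [Bdry.act, Bdry.act, Bdry.map_map]
  exact hB.map_congr fun e c he => he.hom_act_assign hΞ hes H

theorem ABdry.map_congr_of_valid {BB : ABdry Sg} {k : ℕ} (h : BB.toStmt.Valid Θ X k)
    {f g : Expr Sg → Expr Sg} (hfg : ∀ e k c, e.Valid Θ X k c → f e = g e) :
    BB.map f = BB.map g := by
  induction BB generalizing k with
  | thesis B => exact congrArg _ (Bdry.Valid.map_congr h fun e c => hfg e k c)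
  | abs A BB ih => simp only [ABdry.map, hfg _ _ _ h.1, ih h.2]

theorem ABdry.map_map (f g : Expr Sg → Expr Sg) (BB : ABdry Sg) :
    (BB.map f).map g = BB.map fun e => g (f e) := by
  induction BB with
  | thesis B => simp only [ABdry.map, Bdry.map_map]
  | abs A BB ih => simp only [ABdry.map, ih]

theorem premBdry_hom (hΞ : MCtx.Valid Ξ)
    (hes : ∀ i, (es i).Valid Θ X (Ξ.get i).2.arity.2 (Ξ.get i).2.arity.1)
    (H : HomValid Θ X Θ' X' σ I) (i : Fin Ξ.length) :
    (premBdry Ξ es i).map (Expr.hom σ I) = premBdry Ξ (fun i => (es i).hom σ I) i := by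
  rw [premBdry_eq hΞ, premBdry_eq hΞ, ABdry.map_map, ← Expr.act_eq_hom, ← Expr.act_eq_hom]
  exact ABdry.map_congr_of_valid (hΞ.lookup (lookup_get hΞ.1 i)) fun e k c he =>
    he.hom_act_assign hΞ.1 hes H

theorem arity_premBdry (i : Fin Ξ.length) : (premBdry Ξ es i).arity = (Ξ.get i).2.arity := by
  rw [premBdry, ABdry.act_eq_map, ABdry.arity_map]

theorem valid_of_fill_premBdry {i : Fin Ξ.length}
    (h : ((premBdry Ξ es i).fill (es i)).Valid Θ X 0) :
    (es i).Valid Θ X (Ξ.get i).2.arity.2 (Ξ.get i).2.arity.1 := by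
  have := (ABdry.fill_valid_iff.1 h).2
  rwa [arity_premBdry, Nat.zero_add] at this

/-! ### Instantiations of metavariables -/

theorem Bdry.Valid.mono {B : Bdry Sg} {k : ℕ} (h : B.Valid Θ X k)
    (hΘ : ∀ M BB, Θ.lookup M = some BB → Θ'.lookup M = some BB) (hX : X ⊆ X') :
    B.Valid Θ' X' k :=
  AStmt.Valid.mono (J := .thesis (.bdry B)) h hΘ hX

theorem ABdry.tel_get_valid {BB : ABdry Sg} (h : BB.toStmt.Valid Θ [] 0)
    (j : Fin BB.tel.length) : (BB.tel.get j).Valid Θ X j .ty := by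
  have := h.tel (j := j) (A := BB.tel.get j) (by simp)
  rw [Nat.zero_add] at this
  exact this.mono (fun _ _ h => h) (by simp) le_rfl

theorem ABdry.concl_valid {BB : ABdry Sg} (h : BB.toStmt.Valid Θ [] 0) :
    BB.concl.Valid Θ X BB.tel.length := by
  have := h.concl
  rw [ABdry.concl_toStmt, ABdry.tel_toStmt, Nat.zero_add] at this
  exact Bdry.Valid.mono (X := []) (Θ := Θ) this (fun _ _ h => h) (by simp)

theorem Bdry.Valid.hom_inst {B : Bdry Sg} {n k : ℕ} (h : B.Valid Θ X n)
    (H : HomValid Θ X Θ' X' σ I) {ts : Fin n → Expr Sg} (ht : ∀ j, (ts j).Valid Θ X k .tm) :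
    (B.map (Expr.inst ts)).map (Expr.hom σ I) =
      (B.map (Expr.hom σ I)).map (Expr.inst fun j => (ts j).hom σ I) := by
  rw [Bdry.map_map, Bdry.map_map]
  exact h.map_congr fun e c he => he.hom_inst H ht

end

/-! ### Action on derivations -/

/-- A class of morphisms between variable contexts, which act by `Expr.hom σ I`, for which the
action preserves derivability by the variable and metavariable rules. -/
structure HomClass (T : RawTT.{u, v} Sg) (Θ Θ' : MCtx Sg) (I : List (ℕ × Expr Sg))
    (R : VCtx Sg → VCtx Sg → (ℕ → Expr Sg) → Prop) : Prop where
  mctx : MCtx.Valid Θ'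
  vctx : ∀ {Γ Γ' σ}, R Γ Γ' σ → VCtx.Valid Θ' Γ'
  homValid : ∀ {Γ Γ' σ}, R Γ Γ' σ → HomValid Θ (dom Γ) Θ' (dom Γ') σ I
  extend : ∀ {Γ Γ' σ a b A}, R Γ Γ' σ → VCtx.Valid Θ (Γ ++ [(a, A)]) → b ∉ dom Γ' →
    R (Γ ++ [(a, A)]) (Γ' ++ [(b, A.hom σ I)]) (Function.update σ a (.fvar b))
  var : ∀ {Γ Γ' σ a A}, R Γ Γ' σ → Γ.lookup a = some A →
    Der T Θ' Γ' (isTm (σ a) (A.hom σ I))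
  mvar : ∀ {Γ Γ' σ M} {BB : ABdry Sg} {ts : Fin BB.tel.length → Expr Sg}, R Γ Γ' σ →
    BB.toStmt.Valid Θ [] 0 → Θ.lookup M = some BB →
    HValid Θ' Γ' ((AStmt.thesis (.jdg (BB.concl.map (Expr.inst ts))
      (mapp BB.concl.cls M ts))).map (Expr.hom σ I)) →
    (∀ j, (ts j).Valid Θ (dom Γ) 0 .tm) →
    (∀ j, Der T Θ' Γ' ((isTm (ts j)
      ((BB.tel.get j).inst fun i : Fin j => ts (i.castLE j.isLt.le))).map (Expr.hom σ I))) →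
    Der T Θ' Γ' ((bdry (BB.concl.map (Expr.inst ts))).map (Expr.hom σ I)) →
    Der T Θ' Γ' ((AStmt.thesis (.jdg (BB.concl.map (Expr.inst ts))
      (mapp BB.concl.cls M ts))).map (Expr.hom σ I))
  mvarCongr : ∀ {Γ Γ' σ M} {BB : ABdry Sg} {ss ts : Fin BB.tel.length → Expr Sg}, R Γ Γ' σ →
    BB.toStmt.Valid Θ [] 0 → Θ.lookup M = some BB → BB.isObj = true →
    HValid Θ' Γ' (((BB.concl.map (Expr.inst ss)).fillEq
      (mapp BB.concl.cls M ss) (mapp BB.concl.cls M ts)).map (Expr.hom σ I)) →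
    (∀ j, (ss j).Valid Θ (dom Γ) 0 .tm) → (∀ j, (ts j).Valid Θ (dom Γ) 0 .tm) →
    (∀ j, Der T Θ' Γ' ((isTm (ss j)
      ((BB.tel.get j).inst fun i : Fin j => ss (i.castLE j.isLt.le))).map (Expr.hom σ I))) →
    (∀ j, Der T Θ' Γ' ((isTm (ts j)
      ((BB.tel.get j).inst fun i : Fin j => ts (i.castLE j.isLt.le))).map (Expr.hom σ I))) →
    (∀ j, Der T Θ' Γ' ((eqTm (ss j) (ts j)
      ((BB.tel.get j).inst fun i : Fin j => ss (i.castLE j.isLt.le))).map (Expr.hom σ I))) →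
    (∀ C, BB.concl = .isTm C →
      Der T Θ' Γ' ((eqTy (C.inst ss) (C.inst ts)).map (Expr.hom σ I))) →
    Der T Θ' Γ' (((BB.concl.map (Expr.inst ss)).fillEq
      (mapp BB.concl.cls M ss) (mapp BB.concl.cls M ts)).map (Expr.hom σ I))

section
variable {T : RawTT.{u, v} Sg} {Θ Θ' : MCtx Sg} {I : List (ℕ × Expr Sg)}

theorem HValid.concat {Γ : VCtx Sg} {A : Expr Sg} {J : AStmt Sg} (h : HValid Θ Γ (.abs A J))
    {a : ℕ} (ha : a ∉ dom Γ) : HValid Θ (Γ ++ [(a, A)]) (J.openVar a) := by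
  refine ⟨h.1, VCtx.valid_concat.2 ⟨h.2.1, ha, h.2.2.1⟩, ?_⟩
  refine (h.2.2.2.mono (fun _ _ h => h) ?_).openVar ?_
  · simp [dom]
  · simp [dom]

theorem isTm_valid {Γ : VCtx Sg} {t A : Expr Sg} (h : HValid Θ Γ (isTm t A)) :
    t.Valid Θ (dom Γ) 0 .tm := h.2.2.2

/-- Apart from the variable and metavariable rules, which `HomClass` takes care of, every rule is a
schema commuting with `Expr.hom`. -/
theorem Der.hom {R : VCtx Sg → VCtx Sg → (ℕ → Expr Sg) → Prop} (hR : HomClass T Θ Θ' I R)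
    {Γ Γ' : VCtx Sg} {σ : ℕ → Expr Sg} {J : AStmt Sg} (h : Der T Θ Γ J) (hσ : R Γ Γ' σ) :
    Der T Θ' Γ' (J.map (Expr.hom σ I)) := by
  have hval {Γ Γ' : VCtx Sg} {σ : ℕ → Expr Sg} (hσ : R Γ Γ' σ) {J : AStmt Sg}
      (hv : HValid Θ Γ J) : HValid Θ' Γ' (J.map (Expr.hom σ I)) :=
    ⟨hR.mctx, hR.vctx hσ, hv.2.2.hom (hR.homValid hσ)⟩
  induction h generalizing Γ' σ with
  | var hv ha => exact hR.var hσ ha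
  | mvar ts hv hM ht hB iht ihB =>
    exact hR.mvar hσ (hv.1.lookup hM) hM (hval hσ hv) (fun j => isTm_valid (ht j).valid)
      (fun j => iht j hσ) (ihB hσ)
  | mvarCongr ss ts hv hM hobj hs ht hst hC ihs iht ihst ihC =>
    exact hR.mvarCongr hσ (hv.1.lookup hM) hM hobj (hval hσ hv)
      (fun j => isTm_valid (hs j).valid) (fun j => isTm_valid (ht j).valid)
      (fun j => ihs j hσ) (fun j => iht j hσ) (fun j => ihst j hσ) (fun C h => ihC C h hσ)
  | @abstr Γ A J a hv hA ha hJ ihA ihJ =>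
    -- The variable `a` may already be declared in the target context, so the abstraction is
    -- reopened there with a new name.
    obtain ⟨b, hb⟩ := exists_not_mem_dom Γ'
    have hσ' := hR.extend (b := b) hσ (VCtx.valid_concat.2 ⟨hv.2.1, ha, hv.2.2.1⟩) hb
    refine .abstr b (hval hσ hv) (ihA hσ) hb ?_
    have := ihJ hσ'
    have hX := hR.homValid hσ'
    rw [dom_append] at hX
    rwa [hv.2.2.2.hom_openVar (σ := σ) ?_ (Function.update_self ..) hX] at this
    intro x hx
    exact Function.update_of_ne (fun h : x = a => ha (h ▸ hx)) _ _
  | tyRefl hv h ih => exact .tyRefl (hval hσ hv) (ih hσ)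
  | tySym hv h ih => exact .tySym (hval hσ hv) (ih hσ)
  | tyTran hv h₁ h₂ ih₁ ih₂ => exact .tyTran (hval hσ hv) (ih₁ hσ) (ih₂ hσ)
  | tmRefl hv h ih => exact .tmRefl (hval hσ hv) (ih hσ)
  | tmSym hv h ih => exact .tmSym (hval hσ hv) (ih hσ)
  | tmTran hv h₁ h₂ ih₁ ih₂ => exact .tmTran (hval hσ hv) (ih₁ hσ) (ih₂ hσ)
  | convTm hv h₁ h₂ ih₁ ih₂ => exact .convTm (hval hσ hv) (ih₁ hσ) (ih₂ hσ)
  | convEq hv h₁ h₂ ih₁ ih₂ => exact .convEq (hval hσ hv) (ih₁ hσ) (ih₂ hσ)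
  | bdryTy hv => exact .bdryTy (hval hσ hv)
  | bdryTm hv hA ihA => exact .bdryTm (hval hσ hv) (ihA hσ)
  | bdryEqTy hv hA hB ihA ihB => exact .bdryEqTy (hval hσ hv) (ihA hσ) (ihB hσ)
  | bdryEqTm hv hA hs ht ihA ihs iht =>
    exact .bdryEqTm (hval hσ hv) (ihA hσ) (ihs hσ) (iht hσ)
  | rule r es hv hp hq ihp ihq =>
    have H := hR.homValid hσ
    have hes i := valid_of_fill_premBdry (hp i).valid.2.2
    obtain ⟨hΞ, -, hB, he⟩ := T.rule_valid r
    have e₁ := hB.hom_act_assign hΞ.1 hes H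
    have e₂ := he.hom_act_assign hΞ.1 hes H
    have hv' := hval hσ hv
    have hq' := ihq hσ
    simp only [AStmt.map, Thesis.map, FTT.bdry, e₁, e₂] at hv' hq' ⊢
    refine .rule r _ hv' (fun i => ?_) hq'
    have := ihp i hσ
    rwa [ABdry.map_fill, premBdry_hom hΞ hes H] at this
  | ruleCongr r fs gs hv hobj hf hg hfg hB ihf ihg ihfg ihB =>
    have H := hR.homValid hσ
    have hfs i := valid_of_fill_premBdry (hf i).valid.2.2
    have hgs i := valid_of_fill_premBdry (hg i).valid.2.2
    obtain ⟨hΞ, -, hBv, he⟩ := T.rule_valid r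
    have hv' := hval hσ hv
    rw [Bdry.map_fillEq fun _ => rfl, hBv.hom_act_assign hΞ.1 hfs H,
      he.hom_act_assign hΞ.1 hfs H, he.hom_act_assign hΞ.1 hgs H] at hv' ⊢
    refine .ruleCongr r _ _ hv' hobj (fun i => ?_) (fun i => ?_) (fun i hi => ?_) fun B hBB => ?_
    · have := ihf i hσ
      rwa [ABdry.map_fill, premBdry_hom hΞ hfs H] at this
    · have := ihg i hσ
      rwa [ABdry.map_fill, premBdry_hom hΞ hgs H] at this
    · have := ihfg i hi hσ
      rwa [ABdry.map_fillEq fun _ => rfl, premBdry_hom hΞ hfs H] at this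
    · have := ihB B hBB hσ
      rw [hBB] at hBv
      have hBv : B.Valid (T.rule r).prem [] 0 .ty := hBv
      have e₁ := hBv.hom_act_assign hΞ.1 hfs H
      have e₂ := hBv.hom_act_assign hΞ.1 hgs H
      rw [← e₁, ← e₂]
      exact this

end

/-! ### Morphisms that leave all metavariables in place -/

section
variable {T : RawTT.{u, v} Sg} {Θ Θ' : MCtx Sg}

theorem Expr.Valid.hom_nil_of_closed {e : Expr Sg} {k : ℕ} {c : SynClass} (h : e.Valid Θ [] k c)
    (σ : ℕ → Expr Sg) : e.hom σ [] = e := by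
  rw [h.hom_congr (σ' := .fvar) (I' := []) (fun a ha => by cases ha) fun _ _ _ => rfl,
    Expr.hom_fvar_nil]

theorem mapp_hom_nil (c : SynClass) (M : ℕ) {n : ℕ} (ts : Fin n → Expr Sg) (σ : ℕ → Expr Sg) :
    (mapp c M ts).hom σ [] = mapp c M fun j => (ts j).hom σ [] := by
  unfold mapp
  split_ifs <;> rfl

theorem concl_inst_hom_nil {X X' : List ℕ} {σ : ℕ → Expr Sg} {BB : ABdry Sg}
    {ts : Fin BB.tel.length → Expr Sg} (hB : BB.toStmt.Valid Θ [] 0)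
    (H : HomValid Θ X Θ' X' σ []) (ht : ∀ j, (ts j).Valid Θ X 0 .tm) :
    (BB.concl.map (Expr.inst ts)).map (Expr.hom σ []) =
      BB.concl.map (Expr.inst fun j => (ts j).hom σ []) := by
  rw [(ABdry.concl_valid hB).hom_inst H ht,
    (ABdry.concl_valid (X := []) hB).map_congr (g := fun e => e)
      fun e c he => he.hom_nil_of_closed σ, Bdry.map_id fun _ => rfl]

theorem tel_inst_hom_nil {X X' : List ℕ} {σ : ℕ → Expr Sg} {BB : ABdry Sg}
    {ts : Fin BB.tel.length → Expr Sg} (hB : BB.toStmt.Valid Θ [] 0)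
    (H : HomValid Θ X Θ' X' σ []) (ht : ∀ j, (ts j).Valid Θ X 0 .tm) (j : Fin BB.tel.length) :
    ((BB.tel.get j).inst fun i : Fin j => ts (i.castLE j.isLt.le)).hom σ [] =
      (BB.tel.get j).inst fun i : Fin j => (ts (i.castLE j.isLt.le)).hom σ [] := by
  rw [(ABdry.tel_get_valid hB j).hom_inst H fun i => ht _,
    (ABdry.tel_get_valid (X := []) hB j).hom_nil_of_closed]

/-- Boundaries declared in `Θ` are closed, hence fixed when no metavariable is assigned. The
metavariable rules therefore map to themselves with new arguments, and only contexts and variables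
remain to be dealt with. -/
theorem HomClass.of_nil {R : VCtx Sg → VCtx Sg → (ℕ → Expr Sg) → Prop} (mctx : MCtx.Valid Θ')
    (hΘ : ∀ M BB, Θ.lookup M = some BB → Θ'.lookup M = some BB)
    (vctx : ∀ {Γ Γ' σ}, R Γ Γ' σ → VCtx.Valid Θ' Γ')
    (homValid : ∀ {Γ Γ' σ}, R Γ Γ' σ → HomValid Θ (dom Γ) Θ' (dom Γ') σ [])
    (extend : ∀ {Γ Γ' σ a b A}, R Γ Γ' σ → VCtx.Valid Θ (Γ ++ [(a, A)]) → b ∉ dom Γ' →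
      R (Γ ++ [(a, A)]) (Γ' ++ [(b, A.hom σ [])]) (Function.update σ a (.fvar b)))
    (var : ∀ {Γ Γ' σ a A}, R Γ Γ' σ → Γ.lookup a = some A →
      Der T Θ' Γ' (isTm (σ a) (A.hom σ []))) :
    HomClass T Θ Θ' [] R where
  mctx := mctx
  vctx := vctx
  homValid := homValid
  extend := extend
  var := var
  mvar {Γ Γ' σ M BB ts} hσ hBB hM hv hts ht hB := by
    have H := homValid hσ
    have e₁ := concl_inst_hom_nil hBB H hts
    simp only [AStmt.map, Thesis.map, FTT.bdry, e₁, mapp_hom_nil] at hv hB ⊢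
    simp only [AStmt.map, Thesis.map, FTT.isTm, Bdry.map, tel_inst_hom_nil hBB H hts] at ht
    exact .mvar _ hv (hΘ _ _ hM) ht hB
  mvarCongr {Γ Γ' σ M BB ss ts} hσ hBB hM hobj hv hss hts hs ht hst hC := by
    have H := homValid hσ
    have e₁ := concl_inst_hom_nil hBB H hss
    rw [Bdry.map_fillEq fun _ => rfl, e₁, mapp_hom_nil, mapp_hom_nil] at hv ⊢
    simp only [AStmt.map, Thesis.map, FTT.isTm, FTT.eqTm, Bdry.map,
      tel_inst_hom_nil hBB H hss, tel_inst_hom_nil hBB H hts] at hs ht hst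
    refine .mvarCongr _ _ hv (hΘ _ _ hM) hobj hs ht hst fun C hCC => ?_
    have := hC C hCC
    have hCv := ABdry.concl_valid (X := []) hBB
    have hCv' := ABdry.concl_valid (X := dom Γ) hBB
    rw [hCC] at hCv hCv'
    have hCv : C.Valid Θ [] BB.tel.length .ty := hCv
    have hCv' : C.Valid Θ (dom Γ) BB.tel.length .ty := hCv'
    have e₁ := hCv'.hom_inst H hss
    have e₂ := hCv'.hom_inst H hts
    rw [hCv.hom_nil_of_closed] at e₁ e₂
    rw [← e₁, ← e₂]
    exact this

theorem lookup_concat {α : Type*} {Γ : List (ℕ × α)} {a x : ℕ} {A B : α} (ha : a ∉ dom Γ)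
    (h : (Γ ++ [(a, A)]).lookup x = some B) :
    (x ≠ a ∧ Γ.lookup x = some B) ∨ (x = a ∧ B = A) := by
  by_cases hx : x ∈ dom Γ
  · obtain ⟨C, hC⟩ := exists_lookup_of_mem_dom hx
    rw [lookup_append_left hC] at h
    exact .inl ⟨fun h' => ha (h' ▸ hx), h ▸ hC⟩
  · rw [lookup_append_right hx, List.lookup_cons] at h
    by_cases hxa : x = a
    · subst hxa
      simp only [beq_self_eq_true, Option.some.injEq] at h
      exact .inr ⟨rfl, h.symm⟩
    · have : (x == a) = false := by simpa using hxa
      rw [this] at h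
      cases h

theorem lookup_concat_self {α : Type*} {Γ : List (ℕ × α)} {a : ℕ} {A : α} (ha : a ∉ dom Γ) :
    (Γ ++ [(a, A)]).lookup a = some A := by
  rw [lookup_append_right ha]
  simp

theorem Expr.Valid.hom_update {e : Expr Sg} {X : List ℕ} {k : ℕ} {c : SynClass}
    (h : e.Valid Θ X k c) {a : ℕ} (ha : a ∉ X) (σ : ℕ → Expr Sg) (t : Expr Sg)
    (I : List (ℕ × Expr Sg)) : e.hom (Function.update σ a t) I = e.hom σ I :=
  h.hom_congr (fun x hx => Function.update_of_ne (fun h : x = a => ha (h ▸ hx)) _ _)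
    fun _ _ _ => rfl

/-- The entries of an extended context are, after the extension of a substitution, the
substituted entries of the given context and of the extension. -/
theorem update_cases {Γ : VCtx Sg} {a x : ℕ} {A B : Expr Sg}
    (hv : VCtx.Valid Θ (Γ ++ [(a, A)])) (σ : ℕ → Expr Sg) (t : Expr Sg)
    (I : List (ℕ × Expr Sg)) (h : (Γ ++ [(a, A)]).lookup x = some B) :
    (Γ.lookup x = some B ∧ Function.update σ a t x = σ x ∧
      B.hom (Function.update σ a t) I = B.hom σ I) ∨
    (x = a ∧ Function.update σ a t x = t ∧ B.hom (Function.update σ a t) I = A.hom σ I) := by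
  obtain ⟨hΓ, ha, hA⟩ := VCtx.valid_concat.1 hv
  rcases lookup_concat ha h with ⟨hx, h⟩ | ⟨rfl, rfl⟩
  · exact .inl ⟨h, Function.update_of_ne hx _ _, (hΓ.lookup h).hom_update ha σ t I⟩
  · exact .inr ⟨rfl, Function.update_self .., hA.hom_update ha σ t I⟩

/-! ### Renaming and weakening -/

def IsRenaming (Θ' : MCtx Sg) (Γ Γ' : VCtx Sg) (σ : ℕ → Expr Sg) : Prop :=
  VCtx.Valid Θ' Γ' ∧
    ∀ a A, Γ.lookup a = some A → ∃ b, σ a = .fvar b ∧ Γ'.lookup b = some (A.hom σ [])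

theorem homValid_nil {Γ : VCtx Sg} {X' : List ℕ} {σ : ℕ → Expr Sg}
    (hΘ : ∀ M BB, Θ.lookup M = some BB → Θ'.lookup M = some BB)
    (hσ : ∀ a A, Γ.lookup a = some A → (σ a).Valid Θ' X' 0 .tm) :
    HomValid Θ (dom Γ) Θ' X' σ [] where
  var a ha := (exists_lookup_of_mem_dom ha).elim fun A hA => hσ a A hA
  mvar M BB _ e he := by cases he
  none M BB hM _ := hΘ M BB hM

theorem VCtx.Valid.concat_hom {Γ Γ' : VCtx Sg} {σ : ℕ → Expr Sg} {I : List (ℕ × Expr Sg)}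
    {a b : ℕ} {A : Expr Sg} (hΓ' : VCtx.Valid Θ' Γ')
    (H : HomValid Θ (dom Γ) Θ' (dom Γ') σ I) (hv : VCtx.Valid Θ (Γ ++ [(a, A)]))
    (hb : b ∉ dom Γ') : VCtx.Valid Θ' (Γ' ++ [(b, A.hom σ I)]) :=
  VCtx.valid_concat.2 ⟨hΓ', hb, (VCtx.valid_concat.1 hv).2.2.hom H⟩

theorem IsRenaming.homValid {Γ Γ' : VCtx Sg} {σ : ℕ → Expr Sg}
    (hΘ : ∀ M BB, Θ.lookup M = some BB → Θ'.lookup M = some BB) (h : IsRenaming Θ' Γ Γ' σ) :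
    HomValid Θ (dom Γ) Θ' (dom Γ') σ [] :=
  homValid_nil hΘ fun a A hA => by
    obtain ⟨b, hb, hb'⟩ := h.2 a A hA
    rw [hb]
    exact fvar_valid (mem_dom_of_lookup hb')

/-- Variables go to variables, so passing under a binder needs nothing about derivations. Hence this
case can come first; its corollary, weakening, is what the extension of a general substitution
relies on. -/
theorem homClass_isRenaming (hΘ' : MCtx.Valid Θ')
    (hΘ : ∀ M BB, Θ.lookup M = some BB → Θ'.lookup M = some BB) :
    HomClass T Θ Θ' [] (IsRenaming Θ') := by
  refine .of_nil hΘ' hΘ (fun h => h.1) (fun h => h.homValid hΘ) ?_ ?_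
  · intro Γ Γ' σ a b A h hv hb
    refine ⟨h.1.concat_hom (h.homValid hΘ) hv hb, fun x B hB => ?_⟩
    rcases update_cases hv σ (.fvar b) [] hB with ⟨hx, e₁, e₂⟩ | ⟨-, e₁, e₂⟩
    · rw [e₁, e₂]
      obtain ⟨y, hy, hy'⟩ := h.2 x B hx
      exact ⟨y, hy, lookup_append_left hy'⟩
    · rw [e₁, e₂]
      exact ⟨b, rfl, lookup_concat_self hb⟩
  · intro Γ Γ' σ a A h ha
    have H := h.homValid hΘ
    obtain ⟨b, hb, hb'⟩ := h.2 a A ha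
    rw [hb]
    exact .var ⟨hΘ', h.1, h.1.lookup hb', fvar_valid (mem_dom_of_lookup hb')⟩ hb'

theorem AStmt.map_id {f : Expr Sg → Expr Sg} (hf : ∀ e, f e = e) (J : AStmt Sg) :
    J.map f = J := by
  induction J with
  | thesis θ => exact congrArg _ (Thesis.map_id hf θ)
  | abs A J ih => simp only [AStmt.map, hf, ih]

theorem Der.weaken {Γ Γ' : VCtx Sg} {J : AStmt Sg} (h : Der T Θ Γ J) (hΘ' : MCtx.Valid Θ')
    (hΓ' : VCtx.Valid Θ' Γ') (hΘ : ∀ M BB, Θ.lookup M = some BB → Θ'.lookup M = some BB)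
    (hΓ : ∀ a A, Γ.lookup a = some A → Γ'.lookup a = some A) : Der T Θ' Γ' J := by
  rw [← AStmt.map_id Expr.hom_fvar_nil J]
  refine h.hom (homClass_isRenaming hΘ' hΘ) ⟨hΓ', fun a A hA => ⟨a, rfl, ?_⟩⟩
  rw [Expr.hom_fvar_nil]
  exact hΓ a A hA

theorem Der.weaken_concat {Γ : VCtx Sg} {J : AStmt Sg} {a : ℕ} {A : Expr Sg} (h : Der T Θ Γ J)
    (hv : VCtx.Valid Θ (Γ ++ [(a, A)])) : Der T Θ (Γ ++ [(a, A)]) J :=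
  h.weaken h.valid.1 hv (fun _ _ h => h) fun _ _ => lookup_append_left

theorem Der.fvar {Γ : VCtx Sg} {a : ℕ} {A : Expr Sg} (hΘ : MCtx.Valid Θ) (hΓ : VCtx.Valid Θ Γ)
    (ha : Γ.lookup a = some A) : Der T Θ Γ (isTm (.fvar a) A) :=
  .var ⟨hΘ, hΓ, hΓ.lookup ha, fvar_valid (mem_dom_of_lookup ha)⟩ ha

/-! ### Substitution -/

/-- `σ` maps the variables of `Γ` to terms over `Γ'` of the substituted types. -/
def IsSubst (T : RawTT.{u, v} Sg) (Θ' : MCtx Sg) (I : List (ℕ × Expr Sg)) (Γ Γ' : VCtx Sg)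
    (σ : ℕ → Expr Sg) : Prop :=
  VCtx.Valid Θ' Γ' ∧ ∀ a A, Γ.lookup a = some A → Der T Θ' Γ' (isTm (σ a) (A.hom σ I))

/-- The declared type `A'` of the new variable is kept apart from the substituted type of `A`: for a
pair of equal substitutions, one of the two has to convert. -/
theorem IsSubst.extend_of_der {Γ Γ' : VCtx Sg} {σ : ℕ → Expr Sg} {I : List (ℕ × Expr Sg)}
    {a b : ℕ} {A A' : Expr Sg} (h : IsSubst T Θ' I Γ Γ' σ)
    (hv : VCtx.Valid Θ (Γ ++ [(a, A)])) (hv' : VCtx.Valid Θ' (Γ' ++ [(b, A')]))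
    (hA : Der T Θ' (Γ' ++ [(b, A')]) (isTm (.fvar b) (A.hom σ I))) :
    IsSubst T Θ' I (Γ ++ [(a, A)]) (Γ' ++ [(b, A')]) (Function.update σ a (.fvar b)) := by
  refine ⟨hv', fun x B hB => ?_⟩
  rcases update_cases hv σ (.fvar b) I hB with ⟨hx, e₁, e₂⟩ | ⟨-, e₁, e₂⟩
  · rw [e₁, e₂]
    exact (h.2 x B hx).weaken_concat hv'
  · rw [e₁, e₂]
    exact hA

theorem IsSubst.extend {Γ Γ' : VCtx Sg} {σ : ℕ → Expr Sg} {I : List (ℕ × Expr Sg)}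
    {a b : ℕ} {A : Expr Sg} (hΘ' : MCtx.Valid Θ') (h : IsSubst T Θ' I Γ Γ' σ)
    (H : HomValid Θ (dom Γ) Θ' (dom Γ') σ I)
    (hv : VCtx.Valid Θ (Γ ++ [(a, A)])) (hb : b ∉ dom Γ') :
    IsSubst T Θ' I (Γ ++ [(a, A)]) (Γ' ++ [(b, A.hom σ I)])
      (Function.update σ a (.fvar b)) :=
  have hv' := h.1.concat_hom H hv hb
  h.extend_of_der hv hv' (.fvar hΘ' hv' (lookup_concat_self hb))

theorem IsSubst.homValid {Γ Γ' : VCtx Sg} {σ : ℕ → Expr Sg} (h : IsSubst T Θ [] Γ Γ' σ) :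
    HomValid Θ (dom Γ) Θ (dom Γ') σ [] :=
  homValid_nil (fun _ _ h => h) fun a A hA => isTm_valid (h.2 a A hA).valid

theorem homClass_isSubst (hΘ : MCtx.Valid Θ) : HomClass T Θ Θ [] (IsSubst T Θ []) :=
  .of_nil hΘ (fun _ _ h => h) (fun h => h.1) IsSubst.homValid
    (fun h hv hb => h.extend hΘ h.homValid hv hb) fun h ha => h.2 _ _ ha

/-! ### Substitution of equal terms -/

/-- The equation between the heads of two filled object boundaries, or between the types of
two term boundaries. -/
def AStmt.eqv : AStmt Sg → AStmt Sg → Option (AStmt Sg)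
  | .thesis (.jdg .isTy A), .thesis (.jdg .isTy A') => some (FTT.eqTy A A')
  | .thesis (.jdg (.isTm A) t), .thesis (.jdg (.isTm _) t') => some (FTT.eqTm t t' A)
  | .thesis (.bdry (.isTm A)), .thesis (.bdry (.isTm A')) => some (FTT.eqTy A A')
  | .abs A J, .abs _ J' => (J.eqv J').map (.abs A)
  | _, _ => none

theorem AStmt.eqv_valid {X : List ℕ} {k : ℕ} {J J' K : AStmt Sg} (h : J.Valid Θ X k)
    (h' : J'.Valid Θ X k) (hK : J.eqv J' = some K) : K.Valid Θ X k := by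
  induction J generalizing k J' K with
  | thesis θ =>
    unfold AStmt.eqv at hK
    split at hK
    · rename_i A A' e
      cases e; cases hK
      exact ⟨⟨h.2, h'.2⟩, rfl, rfl⟩
    · rename_i A t A' t' e
      cases e; cases hK
      exact ⟨⟨h.2, h'.2, h.1⟩, rfl, rfl⟩
    · rename_i A A' e
      cases e; cases hK
      exact ⟨⟨h, h'⟩, rfl, rfl⟩
    · rename_i e
      cases e
    · cases hK
  | abs A J ih =>
    cases J' with
    | thesis θ => simp [AStmt.eqv] at hK
    | abs A' J' =>
      simp only [AStmt.eqv, Option.map_eq_some_iff] at hK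
      obtain ⟨K, hK, rfl⟩ := hK
      exact ⟨h.1, ih h.2 h'.2 hK⟩

theorem AStmt.eqv_subst (τ : ℕ → Expr Sg) {J J' K : AStmt Sg} (h : J.eqv J' = some K) :
    (J.subst τ).eqv (J'.subst τ) = some (K.subst τ) := by
  induction J generalizing J' K τ with
  | thesis θ =>
    unfold AStmt.eqv at h
    split at h
    iterate 3
      rename_i e
      cases e; cases h
      rfl
    · rename_i e
      cases e
    · cases h
  | abs A J ih =>
    cases J' with
    | thesis θ => simp [AStmt.eqv] at h
    | abs A' J' =>
      simp only [AStmt.eqv, Option.map_eq_some_iff] at h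
      obtain ⟨K, hK, rfl⟩ := h
      simp only [AStmt.subst, AStmt.eqv, ih _ hK, Option.map_some]

theorem AStmt.eqv_thesis {B : Bdry Sg} {f g : Expr Sg → Expr Sg} {e e' : Expr Sg} {K : AStmt Sg}
    (h : (AStmt.thesis (.jdg (B.map f) e)).eqv (.thesis (.jdg (B.map g) e')) = some K) :
    B.cls.isObj = true ∧ K = (B.map f).fillEq e e' := by
  cases B <;> simp_all [Bdry.map, AStmt.eqv, Bdry.cls, SynClass.isObj, Bdry.fillEq]

theorem AStmt.eqv_thesis_of_isObj {B : Bdry Sg} (hB : B.cls.isObj = true)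
    (f g : Expr Sg → Expr Sg) (e e' : Expr Sg) :
    (AStmt.thesis (.jdg (B.map f) e)).eqv (.thesis (.jdg (B.map g) e')) =
      some ((B.map f).fillEq e e') := by
  cases B <;> simp_all [Bdry.map, AStmt.eqv, Bdry.cls, SynClass.isObj, Bdry.fillEq]

theorem AStmt.eqv_fill {BB : ABdry Sg} (hB : BB.isObj = true) (f g : Expr Sg → Expr Sg)
    (e e' : Expr Sg) :
    ((BB.map f).fill e).eqv ((BB.map g).fill e') = some ((BB.map f).fillEq e e') := by
  induction BB with
  | thesis B => exact AStmt.eqv_thesis_of_isObj hB f g e e'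
  | abs A BB ih => simp only [ABdry.map, ABdry.fill, AStmt.eqv, ih hB, Option.map_some,
      ABdry.fillEq]

/-- `σ` and `τ` map the variables of `Γ` to judgementally equal terms. -/
def IsEqSubst (T : RawTT.{u, v} Sg) (Θ : MCtx Sg) (Γ Γ' : VCtx Sg) (σ τ : ℕ → Expr Sg) : Prop :=
  IsSubst T Θ [] Γ Γ' σ ∧ IsSubst T Θ [] Γ Γ' τ ∧
    ∀ a A, Γ.lookup a = some A → Der T Θ Γ' (eqTm (σ a) (τ a) (A.hom σ []))

theorem Der.refl_tm {Γ : VCtx Sg} {t A : Expr Sg} (h : Der T Θ Γ (isTm t A)) :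
    Der T Θ Γ (eqTm t t A) :=
  have hv := h.valid
  .tmRefl ⟨hv.1, hv.2.1, ⟨hv.2.2.2, hv.2.2.2, hv.2.2.1⟩, rfl, rfl⟩ h

theorem IsEqSubst.extend {Γ Γ' : VCtx Sg} {σ τ : ℕ → Expr Sg} {a b : ℕ} {A : Expr Sg}
    (hΘ : MCtx.Valid Θ) (h : IsEqSubst T Θ Γ Γ' σ τ) (hv : VCtx.Valid Θ (Γ ++ [(a, A)]))
    (hb : b ∉ dom Γ') (hA : Der T Θ Γ' (eqTy (A.hom σ []) (A.hom τ []))) :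
    IsEqSubst T Θ (Γ ++ [(a, A)]) (Γ' ++ [(b, A.hom σ [])])
      (Function.update σ a (.fvar b)) (Function.update τ a (.fvar b)) := by
  have hσ := h.1.extend hΘ h.1.homValid hv hb
  have hvar : Der T Θ (Γ' ++ [(b, A.hom σ [])]) (isTm (.fvar b) (A.hom σ [])) :=
    .fvar hΘ hσ.1 (lookup_concat_self hb)
  have hA' := hA.weaken_concat hσ.1
  -- Both extensions share the variable `b`, declared with the type given by `σ`; the type required
  -- by `τ` is reached by converting along `hA'`.
  have hτ := h.2.1.extend_of_der hv hσ.1 (.convTm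
    ⟨hΘ, hσ.1, hA'.valid.2.2.1.2, isTm_valid hvar.valid⟩ hvar hA')
  refine ⟨hσ, hτ, fun x B hB => ?_⟩
  rcases update_cases hv σ (.fvar b) [] hB with ⟨hx, e₁, e₂⟩ | ⟨rfl, e₁, e₂⟩
  · rcases update_cases hv τ (.fvar b) [] hB with ⟨-, e₁', -⟩ | ⟨rfl, -, -⟩
    · rw [e₁, e₁', e₂]
      exact (h.2.2 x B hx).weaken_concat hσ.1
    · exact absurd (mem_dom_of_lookup hx) (VCtx.valid_concat.1 hv).2.1
  · rw [e₁, e₂, Function.update_self]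
    exact hvar.refl_tm

/-- Each object rule is answered by its congruence rule. A congruence rule also asks that the two
types of its sides be equal; this comes from the premise stating that the boundary is well-formed,
and is the reason why `AStmt.eqv` covers term boundaries too. -/
theorem Der.hom_eqv {Γ Γ' : VCtx Sg} {σ τ : ℕ → Expr Sg} {J K : AStmt Sg} (h : Der T Θ Γ J)
    (hστ : IsEqSubst T Θ Γ Γ' σ τ)
    (hK : (J.map (Expr.hom σ [])).eqv (J.map (Expr.hom τ [])) = some K) : Der T Θ Γ' K := by
  have hΘ : MCtx.Valid Θ := h.valid.1
  have hvalid {Γ Γ' : VCtx Sg} {σ τ : ℕ → Expr Sg} (hσ : IsEqSubst T Θ Γ Γ' σ τ)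
      {J K : AStmt Sg} (hv : HValid Θ Γ J)
      (hK : (J.map (Expr.hom σ [])).eqv (J.map (Expr.hom τ [])) = some K) : HValid Θ Γ' K :=
    ⟨hΘ, hσ.1.1, AStmt.eqv_valid (hv.2.2.hom hσ.1.homValid) (hv.2.2.hom hσ.2.1.homValid) hK⟩
  have homσ {Γ Γ' : VCtx Sg} {σ : ℕ → Expr Sg} {J : AStmt Sg} (h : Der T Θ Γ J)
      (hσ : IsSubst T Θ [] Γ Γ' σ) := h.hom (homClass_isSubst hΘ) hσ
  induction h generalizing Γ' σ τ K with
  | @var Γ a A hv ha =>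
    simp only [FTT.isTm, AStmt.map, Thesis.map, Bdry.map, AStmt.eqv, Option.some.injEq] at hK
    subst hK
    exact hστ.2.2 a A ha
  | @mvar Γ M BB ts hv hM ht hB iht ihB =>
    have hBB := hv.1.lookup hM
    have hts j := isTm_valid (ht j).valid
    have eσ := tel_inst_hom_nil hBB hστ.1.homValid hts
    have eτ := tel_inst_hom_nil hBB hστ.2.1.homValid hts
    have hvK := hvalid hστ hv hK
    simp only [AStmt.map, Thesis.map, concl_inst_hom_nil hBB hστ.1.homValid hts,
      concl_inst_hom_nil hBB hστ.2.1.homValid hts, mapp_hom_nil] at hK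
    obtain ⟨hobj, rfl⟩ := AStmt.eqv_thesis hK
    refine .mvarCongr _ _ hvK hM hobj (fun j => ?_) (fun j => ?_) (fun j => ?_) fun C hC => ?_
    · rw [← eσ]
      exact homσ (ht j) hστ.1
    · rw [← eτ]
      exact homσ (ht j) hστ.2.1
    · rw [← eσ]
      exact iht j hστ rfl
    · have e₁ := concl_inst_hom_nil hBB hστ.1.homValid hts
      have e₂ := concl_inst_hom_nil hBB hστ.2.1.homValid hts
      refine ihB hστ ?_
      simp only [AStmt.map, Thesis.map, FTT.bdry, e₁, e₂]
      rw [hC]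
      rfl
  | @abstr Γ A J a hv hA ha hJ ihA ihJ =>
    have hvK := hvalid hστ hv hK
    simp only [AStmt.map, AStmt.eqv, Option.map_eq_some_iff] at hK
    obtain ⟨K, hK, rfl⟩ := hK
    obtain ⟨b, hb⟩ := exists_not_mem_dom Γ'
    -- The type premise of the abstraction rule makes the two images of `A` equal, as the extension
    -- demands.
    have hστ' := hστ.extend hΘ (VCtx.valid_concat.2 ⟨hv.2.1, ha, hv.2.2.1⟩) hb (ihA hστ rfl)
    refine .abstr b hvK (homσ hA hστ.1) hb (ihJ hστ' ?_)
    have hσX := hστ'.1.homValid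
    have hτX := hστ'.2.1.homValid
    rw [dom_append] at hσX hτX
    have hup (ρ : ℕ → Expr Sg) (x : ℕ) (hx : x ∈ dom Γ) :
        Function.update ρ a (.fvar b) x = ρ x :=
      Function.update_of_ne (fun h : x = a => ha (h ▸ hx)) _ _
    rw [hv.2.2.2.hom_openVar (hup σ) (Function.update_self ..) hσX,
      hv.2.2.2.hom_openVar (hup τ) (Function.update_self ..) hτX]
    exact AStmt.eqv_subst _ hK
  -- The conclusion is an equation or a boundary without a comparison equation: `AStmt.eqv` returns
  -- `none`, and there is nothing to prove.
  | tyRefl | tySym | tyTran | tmRefl | tmSym | tmTran | convEq | bdryTy | bdryEqTy | bdryEqTm =>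
    cases hK
  | convTm hv h₁ h₂ ih₁ ih₂ =>
    have hvK := hvalid hστ hv hK
    simp only [FTT.isTm, AStmt.map, Thesis.map, Bdry.map, AStmt.eqv, Option.some.injEq] at hK
    subst hK
    exact .convEq hvK (ih₁ hστ rfl) (homσ h₂ hστ.1)
  | bdryTm hv hA ihA =>
    simp only [FTT.bdry, AStmt.map, Thesis.map, Bdry.map, AStmt.eqv, Option.some.injEq] at hK
    subst hK
    exact ihA hστ rfl
  | @rule Γ r es hv hp hq ihp ihq =>
    have hes i := valid_of_fill_premBdry (hp i).valid.2.2
    obtain ⟨hΞ, -, hB, he⟩ := T.rule_valid r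
    have hvK := hvalid hστ hv hK
    have Hσ := hστ.1.homValid
    have Hτ := hστ.2.1.homValid
    have e₁ := hB.hom_act_assign hΞ.1 hes Hσ
    have e₂ := hB.hom_act_assign hΞ.1 hes Hτ
    have e₃ := he.hom_act_assign hΞ.1 hes Hσ
    have e₄ := he.hom_act_assign hΞ.1 hes Hτ
    simp only [AStmt.map, Thesis.map, e₁, e₂, e₃, e₄] at hK
    obtain ⟨hobj, rfl⟩ := AStmt.eqv_thesis hK
    refine .ruleCongr r _ _ hvK hobj (fun i => ?_) (fun i => ?_) (fun i hi => ?_) fun B hBB => ?_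
    · rw [← premBdry_hom hΞ hes Hσ, ← ABdry.map_fill]
      exact homσ (hp i) hστ.1
    · rw [← premBdry_hom hΞ hes Hτ, ← ABdry.map_fill]
      exact homσ (hp i) hστ.2.1
    · refine ihp i hστ ?_
      rw [ABdry.map_fill, ABdry.map_fill, ← premBdry_hom hΞ hes Hσ]
      refine AStmt.eqv_fill ?_ _ _ _ _
      have := arity_premBdry (es := es) i
      rw [ABdry.isObj, show (premBdry _ es i).concl.cls = _ from congrArg Prod.fst this]
      exact hi
    · refine ihq hστ ?_
      simp only [AStmt.map, Thesis.map, FTT.bdry, e₁, e₂]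
      rw [hBB]
      rfl
  | mvarCongr ss ts hv hM hobj hs ht hst hC ihs iht ihst ihC =>
    rename_i BB
    cases hB : BB.concl <;> rw [hB] at hK <;> cases hK
  | ruleCongr r fs gs hv hobj hf hg hfg hB ihf ihg ihfg ihB =>
    cases hB : (T.rule r).bdry <;> rw [hB] at hK <;> cases hK

end

/-! ### Opening all abstractions of a statement -/

/-- The expression `e[a₁/x₁, …, aₙ/xₙ]` for free variables `a₁, …, aₙ`. -/
def Expr.instVars (a : ℕ → ℕ) (n : ℕ) (e : Expr Sg) : Expr Sg :=
  e.inst fun i : Fin n => .fvar (a i)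

theorem Expr.instVars_succ (a : ℕ → ℕ) (n : ℕ) (e : Expr Sg) :
    (e.subst (liftSub n (instSub fun _ : Fin 1 => .fvar (a 0)))).instVars (fun j => a (j + 1)) n =
      e.instVars a (n + 1) :=
  Expr.inst_succ (fun i : Fin (n + 1) => .fvar (a i)) e

/-- `Γ'` is `Γ` extended with distinct variables `a₁, …, aₙ` for the abstracted variables
of types `As`. -/
structure Opens (As : List (Expr Sg)) (Γ Γ' : VCtx Sg) (a : ℕ → ℕ) : Prop where
  inj : ∀ i < As.length, ∀ j < As.length, a i = a j → i = j
  fresh : ∀ i < As.length, a i ∉ dom Γ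
  old : ∀ x B, Γ.lookup x = some B → Γ'.lookup x = some B
  new : ∀ j A, As[j]? = some A → Γ'.lookup (a j) = some (A.instVars a j)
  cases : ∀ x B, Γ'.lookup x = some B → Γ.lookup x = some B ∨
    ∃ j A, As[j]? = some A ∧ x = a j ∧ B = A.instVars a j

/-- `R` is the property inverted at each abstraction and `Q` the one rebuilt on the way back. The
rebuilding is uniform in the body, so the thesis may be exchanged for another below the same
abstractions. Stated for a general `R` because both derivability and naturality are opened this way.
-/
theorem exists_opens {R Q : VCtx Sg → AStmt Sg → Prop}
    (hR : ∀ Γ A J, R Γ (.abs A J) → ∃ a, a ∉ dom Γ ∧ R (Γ ++ [(a, A)]) (J.openVar a) ∧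
      ∀ J', Q (Γ ++ [(a, A)]) (J'.openVar a) → Q Γ (.abs A J'))
    {n : ℕ} {Γ : VCtx Sg} {J : AStmt Sg} (hn : J.tel.length = n) (h : R Γ J) :
    ∃ (a : ℕ → ℕ) (Γ' : VCtx Sg), Opens J.tel Γ Γ' a ∧
      R Γ' (.thesis (J.concl.map (Expr.instVars a n))) ∧
      ∀ θ : Thesis Sg, Q Γ' (.thesis (θ.map (Expr.instVars a n))) → Q Γ (J.withConcl θ) := by
  induction n generalizing Γ J with
  | zero =>
    cases J with
    | abs A J => simp [AStmt.tel] at hn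
    | thesis θ =>
      have e (θ : Thesis Sg) : θ.map (Expr.instVars (fun _ => 0) 0) = θ :=
        Thesis.map_id (fun e => Expr.inst_zero _ e) θ
      refine ⟨fun _ => 0, Γ, ⟨?_, ?_, ?_, ?_, ?_⟩, ?_, fun θ' hθ' => ?_⟩
      · intro i hi; simp [AStmt.tel] at hi
      · intro i hi; simp [AStmt.tel] at hi
      · exact fun _ _ h => h
      · intro i hi; simp [AStmt.tel]
      · exact fun _ _ h => .inl h
      · rw [e]; exact h
      · rw [e] at hθ'; exact hθ'
  | succ n ih =>
    cases J with
    | thesis θ => simp [AStmt.tel] at hn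
    | abs A J =>
      simp only [AStmt.tel, List.length_cons, Nat.add_right_cancel_iff] at hn
      obtain ⟨a₀, ha₀, hJ, hQ⟩ := hR Γ A J h
      have hlen : (J.openVar a₀).tel.length = n := by
        rw [AStmt.openVar, AStmt.length_tel_subst, hn]
      obtain ⟨a', Γ', ho, hJ', hQ'⟩ := ih hlen hJ
      -- The outermost variable gets index 0, in the order of the list of abstracted types.
      let a : ℕ → ℕ := fun i => Nat.casesOn i a₀ a'
      have ha : (fun j => a (j + 1)) = a' := rfl
      have hne : ∀ i < n, a' i ≠ a₀ := fun i hi h => by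
        refine ho.fresh i (by omega) ?_
        rw [h, dom_append]
        simp [dom]
      have hinst (m : ℕ) (e : Expr Sg) :
          (e.subst (liftSub m (instSub fun _ : Fin 1 => .fvar a₀))).instVars a' m =
            e.instVars a (m + 1) := Expr.instVars_succ a m e
      have htel (j : ℕ) : (J.openVar a₀).tel[j]? =
          J.tel[j]?.map (Expr.subst (liftSub j (instSub fun _ : Fin 1 => .fvar a₀))) :=
        AStmt.tel_subst _ _ _
      have h₀ : A.instVars a 0 = A := Expr.inst_zero _ _
      refine ⟨a, Γ', ⟨?_, ?_, ?_, ?_, ?_⟩, ?_, fun θ hθ => ?_⟩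
      · intro i hi j hj hij
        simp only [AStmt.tel, List.length_cons] at hi hj
        rcases i with _ | i <;> rcases j with _ | j
        · rfl
        · exact absurd hij.symm (hne j (by omega))
        · exact absurd hij (hne i (by omega))
        · rw [ho.inj i (by omega) j (by omega) hij]
      · intro i hi
        simp only [AStmt.tel, List.length_cons] at hi
        rcases i with _ | i
        · exact ha₀
        · intro h
          refine ho.fresh i (by omega) ?_
          rw [dom_append]
          exact List.mem_append_left _ h
      · exact fun x B h => ho.old x B (lookup_append_left h)
      · intro j B hj
        rcases j with _ | j
        · simp only [AStmt.tel, List.getElem?_cons_zero, Option.some.injEq] at hj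
          rw [← hj, h₀]
          exact ho.old _ _ (lookup_concat_self ha₀)
        · simp only [AStmt.tel, List.getElem?_cons_succ] at hj
          rw [← hinst]
          exact ho.new j _ (by rw [htel, hj]; rfl)
      · intro x B hx
        rcases ho.cases x B hx with h | ⟨j, C, hC, rfl, rfl⟩
        · rcases lookup_concat ha₀ h with ⟨-, h⟩ | ⟨rfl, rfl⟩
          · exact .inl h
          · exact .inr ⟨0, _, rfl, rfl, h₀.symm⟩
        · rw [htel, Option.map_eq_some_iff] at hC
          obtain ⟨C, hC, rfl⟩ := hC
          exact .inr ⟨j + 1, C, hC, rfl, hinst j C⟩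
      · rw [AStmt.openVar, AStmt.concl_subst, Thesis.map_map, hn] at hJ'
        simp only [hinst] at hJ'
        exact hJ'
      · refine hQ _ ?_
        rw [AStmt.openVar, AStmt.withConcl_subst, hn]
        refine hQ' _ ?_
        rw [Thesis.map_map]
        simp only [hinst]
        exact hθ

/-! ### Application of abstracted judgements to terms -/

section
variable {T : RawTT.{u, v} Sg} {Θ Θ' : MCtx Sg}

theorem Der.abs_inv {Γ : VCtx Sg} {A : Expr Sg} {J : AStmt Sg} (h : Der T Θ Γ (.abs A J)) :
    Der T Θ Γ (FTT.isTy A) ∧ ∃ a, a ∉ dom Γ ∧ Der T Θ (Γ ++ [(a, A)]) (J.openVar a) := by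
  generalize hJ : AStmt.abs A J = J' at h
  cases h with
  | abstr a hv hA ha hJ' =>
    cases hJ
    exact ⟨hA, a, ha, hJ'⟩
  | mvarCongr ss ts hv hM hobj hs ht hst hC =>
    rename_i BB
    cases hB : BB.concl <;> rw [hB] at hJ <;> cases hJ
  | ruleCongr r fs gs hv hobj hf hg hfg hB =>
    cases hB : (T.rule r).bdry <;> rw [hB] at hJ <;> cases hJ
  | _ => cases hJ

theorem Der.exists_opens {n : ℕ} {Γ : VCtx Sg} {J : AStmt Sg} (hn : J.tel.length = n)
    (h : Der T Θ Γ J) :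
    ∃ (a : ℕ → ℕ) (Γ' : VCtx Sg), Opens J.tel Γ Γ' a ∧
      Der T Θ Γ' (.thesis (J.concl.map (Expr.instVars a n))) ∧
      ∀ θ : Thesis Sg, (HValid Θ Γ' (.thesis (θ.map (Expr.instVars a n))) →
        Der T Θ Γ' (.thesis (θ.map (Expr.instVars a n)))) →
        HValid Θ Γ (J.withConcl θ) → Der T Θ Γ (J.withConcl θ) := by
  refine FTT.exists_opens (R := Der T Θ) (Q := fun Γ J => HValid Θ Γ J → Der T Θ Γ J)
    (fun Γ A J h => ?_) hn h
  obtain ⟨hA, a, ha, hJ⟩ := h.abs_inv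
  exact ⟨a, ha, hJ, fun J' h hv => .abstr a hv hA ha (h (hv.concat ha))⟩

open Classical in
/-- The substitution of `ss` for the variables `a`. -/
noncomputable def varSubst (n : ℕ) (a : ℕ → ℕ) (ss : ℕ → Expr Sg) (x : ℕ) : Expr Sg :=
  if h : ∃ j, j < n ∧ a j = x then ss h.choose else .fvar x

theorem Opens.varSubst_new {As : List (Expr Sg)} {Γ Γ' : VCtx Sg} {a : ℕ → ℕ}
    (h : Opens As Γ Γ' a) (ss : ℕ → Expr Sg) {j : ℕ} (hj : j < As.length) :
    varSubst As.length a ss (a j) = ss j := by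
  have hex : ∃ i, i < As.length ∧ a i = a j := ⟨j, hj, rfl⟩
  rw [varSubst, dif_pos hex]
  rw [h.inj _ hex.choose_spec.1 j hj hex.choose_spec.2]

theorem Opens.varSubst_old {As : List (Expr Sg)} {Γ Γ' : VCtx Sg} {a : ℕ → ℕ}
    (h : Opens As Γ Γ' a) (ss : ℕ → Expr Sg) {x : ℕ} (hx : x ∈ dom Γ) :
    varSubst As.length a ss x = .fvar x := by
  rw [varSubst, dif_neg]
  rintro ⟨j, hj, rfl⟩
  exact h.fresh j hj hx

theorem Opens.dom_subset {As : List (Expr Sg)} {Γ Γ' : VCtx Sg} {a : ℕ → ℕ}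
    (h : Opens As Γ Γ' a) : dom Γ ⊆ dom Γ' := fun x hx => by
  obtain ⟨B, hB⟩ := exists_lookup_of_mem_dom hx
  exact mem_dom_of_lookup (h.old x B hB)

theorem Opens.mem_dom {As : List (Expr Sg)} {Γ Γ' : VCtx Sg} {a : ℕ → ℕ}
    (h : Opens As Γ Γ' a) {j : ℕ} (hj : j < As.length) : a j ∈ dom Γ' :=
  mem_dom_of_lookup (h.new j _ (List.getElem?_eq_getElem hj))

/-- The terms `ss` have the types `As`, each of which may depend on the preceding terms. -/
def TelDer (T : RawTT.{u, v} Sg) (Θ : MCtx Sg) (Γ : VCtx Sg) (As : List (Expr Sg))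
    (ss : ℕ → Expr Sg) : Prop :=
  ∀ j A, As[j]? = some A → Der T Θ Γ (isTm (ss j) (A.inst fun i : Fin j => ss i))

section
variable {As : List (Expr Sg)} {Γ Γ' : VCtx Sg} {a : ℕ → ℕ} {ss ts : ℕ → Expr Sg}

theorem TelDer.homValid (hs : TelDer T Θ Γ As ss) (ho : Opens As Γ Γ' a) :
    HomValid Θ (dom Γ') Θ (dom Γ) (varSubst As.length a ss) [] :=
  homValid_nil (fun _ _ h => h) fun x B hx => by
    rcases ho.cases x B hx with h | ⟨j, A, hA, rfl, -⟩
    · have := mem_dom_of_lookup h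
      rw [ho.varSubst_old ss this]
      exact fvar_valid this
    · rw [ho.varSubst_new ss (List.getElem?_eq_some_iff.1 hA).1]
      exact isTm_valid (hs j A hA).valid

theorem Opens.hom_of_valid (ho : Opens As Γ Γ' a) (ss : ℕ → Expr Sg) {e : Expr Sg} {k : ℕ}
    {c : SynClass} (he : e.Valid Θ (dom Γ) k c) : e.hom (varSubst As.length a ss) [] = e := by
  rw [he.hom_congr (σ' := .fvar) (I' := []) (fun x hx => ho.varSubst_old ss hx)
    fun _ _ _ => rfl, Expr.hom_fvar_nil]

theorem TelDer.hom_instVars (hs : TelDer T Θ Γ As ss) (ho : Opens As Γ Γ' a) {e : Expr Sg}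
    {m : ℕ} (hm : m ≤ As.length) {c : SynClass} (he : e.Valid Θ (dom Γ) m c) :
    (e.instVars a m).hom (varSubst As.length a ss) [] = e.inst fun i : Fin m => ss i := by
  have he' : e.Valid Θ (dom Γ') m c := he.mono (fun _ _ h => h) ho.dom_subset le_rfl
  rw [Expr.instVars, he'.hom_inst (hs.homValid ho) (k := 0) fun i =>
    fvar_valid (ho.mem_dom (by omega)), ho.hom_of_valid ss he]
  congr 1
  funext i
  exact ho.varSubst_new ss (by omega)

theorem TelDer.isSubst (hs : TelDer T Θ Γ As ss) (ho : Opens As Γ Γ' a) (hΘ : MCtx.Valid Θ)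
    (hΓ : VCtx.Valid Θ Γ) (hAs : ∀ (j : ℕ) (A : Expr Sg), As[j]? = some A → A.Valid Θ (dom Γ) j .ty) :
    IsSubst T Θ [] Γ' Γ (varSubst As.length a ss) := by
  refine ⟨hΓ, fun x B hx => ?_⟩
  rcases ho.cases x B hx with h | ⟨j, A, hA, rfl, rfl⟩
  · rw [ho.varSubst_old ss (mem_dom_of_lookup h), ho.hom_of_valid ss (hΓ.lookup h)]
    exact .fvar hΘ hΓ h
  · have hj := (List.getElem?_eq_some_iff.1 hA).1
    rw [ho.varSubst_new ss hj, hs.hom_instVars ho hj.le (hAs j A hA)]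
    exact hs j A hA

end

theorem AStmt.Valid.tel_zero {J : AStmt Sg} {X : List ℕ} (h : J.Valid Θ X 0) (j : ℕ)
    (A : Expr Sg) (hj : J.tel[j]? = some A) : A.Valid Θ X j .ty := by
  have := h.tel hj
  rwa [Nat.zero_add] at this

theorem TelDer.map_instVars {Γ Γ' : VCtx Sg} {J : AStmt Sg} {a : ℕ → ℕ} {ss : ℕ → Expr Sg}
    (hs : TelDer T Θ Γ J.tel ss) (ho : Opens J.tel Γ Γ' a) (hJ : J.Valid Θ (dom Γ) 0) :
    (AStmt.thesis (J.concl.map (Expr.instVars a J.tel.length))).map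
        (Expr.hom (varSubst J.tel.length a ss) []) =
      .thesis (J.concl.map (Expr.inst fun i : Fin J.tel.length => ss i)) := by
  have hc := hJ.concl
  rw [Nat.zero_add] at hc
  rw [AStmt.map, Thesis.map_map]
  exact congrArg _ (hc.map_congr fun e c he => hs.hom_instVars ho le_rfl he)

/-- Open all abstractions with fresh variables, then substitute the terms for these variables. -/
theorem Der.apply {Γ : VCtx Sg} {J : AStmt Sg} {ss : ℕ → Expr Sg} {n : ℕ} (h : Der T Θ Γ J)
    (hn : J.tel.length = n) (hs : TelDer T Θ Γ J.tel ss) :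
    Der T Θ Γ (.thesis (J.concl.map (Expr.inst fun i : Fin n => ss i))) := by
  subst hn
  obtain ⟨a, Γ', ho, hJ, -⟩ := h.exists_opens rfl
  obtain ⟨hΘ, hΓ, hv⟩ := h.valid
  rw [← hs.map_instVars ho hv]
  exact hJ.hom (homClass_isSubst hΘ) (hs.isSubst ho hΘ hΓ hv.tel_zero)

theorem Der.apply_eqv {Γ : VCtx Sg} {J K : AStmt Sg} {ss ts : ℕ → Expr Sg} {n : ℕ} (h : Der T Θ Γ J)
    (hn : J.tel.length = n) (hs : TelDer T Θ Γ J.tel ss) (ht : TelDer T Θ Γ J.tel ts)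
    (hst : ∀ j A, J.tel[j]? = some A →
      Der T Θ Γ (eqTm (ss j) (ts j) (A.inst fun i : Fin j => ss i)))
    (hK : (AStmt.thesis (J.concl.map (Expr.inst fun i : Fin n => ss i))).eqv
      (.thesis (J.concl.map (Expr.inst fun i : Fin n => ts i))) = some K) :
    Der T Θ Γ K := by
  subst hn
  obtain ⟨a, Γ', ho, hJ, -⟩ := h.exists_opens rfl
  obtain ⟨hΘ, hΓ, hv⟩ := h.valid
  rw [← hs.map_instVars ho hv, ← ht.map_instVars ho hv] at hK
  refine hJ.hom_eqv ⟨hs.isSubst ho hΘ hΓ hv.tel_zero, ht.isSubst ho hΘ hΓ hv.tel_zero,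
    fun x B hx => ?_⟩ hK
  rcases ho.cases x B hx with h | ⟨j, A, hA, rfl, rfl⟩
  · have hx := mem_dom_of_lookup h
    rw [ho.varSubst_old ss hx, ho.varSubst_old ts hx, ho.hom_of_valid ss (hΓ.lookup h)]
    exact (Der.fvar hΘ hΓ h).refl_tm
  · have hj := (List.getElem?_eq_some_iff.1 hA).1
    rw [ho.varSubst_new ss hj, ho.varSubst_new ts hj,
      hs.hom_instVars ho hj.le (hv.tel_zero j A hA)]
    exact hst j A hA

/-! ### Instantiation of derivations -/

/-- `I` assigns to each metavariable of `Θ` a derivable argument over `Θ'; []`. -/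
def IsInstDer (T : RawTT.{u, v} Sg) (Θ Θ' : MCtx Sg) (I : List (ℕ × Expr Sg)) : Prop :=
  ∀ M BB, Θ.lookup M = some BB → ∃ e, I.lookup M = some e ∧
    Der T Θ' [] ((BB.map (Expr.hom .fvar I)).fill e)

theorem IsInstDer.homValid {I : List (ℕ × Expr Sg)} (hI : IsInstDer T Θ Θ' I) {Γ Γ' : VCtx Sg}
    {σ : ℕ → Expr Sg} (hσ : IsSubst T Θ' I Γ Γ' σ) : HomValid Θ (dom Γ) Θ' (dom Γ') σ I where
  var a ha := by
    obtain ⟨A, hA⟩ := exists_lookup_of_mem_dom ha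
    exact isTm_valid (hσ.2 a A hA).valid
  mvar M BB hM e he := by
    obtain ⟨e', he', hd⟩ := hI M BB hM
    rw [he, Option.some.injEq] at he'
    subst he'
    have := (ABdry.fill_valid_iff.1 hd.valid.2.2).2
    rw [ABdry.arity_map, Nat.zero_add] at this
    exact this.mono (fun _ _ h => h) (by simp [dom]) le_rfl
  none M BB hM h := by
    obtain ⟨e', he', -⟩ := hI M BB hM
    rw [h] at he'
    cases he'

/-- Extension of finitely many arguments to a sequence. -/
def extendArgs {n : ℕ} (ts : Fin n → Expr Sg) (j : ℕ) : Expr Sg :=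
  if h : j < n then ts ⟨j, h⟩ else .dummy .ty

theorem extendArgs_of_lt {n : ℕ} (ts : Fin n → Expr Sg) (j : Fin n) :
    extendArgs ts j = ts j := by
  simp [extendArgs]

theorem extendArgs_eta {n : ℕ} (ts : Fin n → Expr Sg) :
    (fun j : Fin n => extendArgs ts j) = ts :=
  funext fun j => extendArgs_of_lt ts j

theorem extendArgs_castLE {n : ℕ} (ts : Fin n → Expr Sg) (j : Fin n) :
    (fun i : Fin j => extendArgs ts i) = fun i : Fin j => ts (i.castLE j.isLt.le) :=
  funext fun i => extendArgs_of_lt ts (i.castLE j.isLt.le)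

theorem getElem?_map_get {α β : Type*} {As : List α} {f : α → β} {j : ℕ} {B : β}
    (h : (As.map f)[j]? = some B) : ∃ i : Fin As.length, j = i ∧ B = f (As.get i) := by
  rw [List.getElem?_map, Option.map_eq_some_iff] at h
  obtain ⟨A, hA, rfl⟩ := h
  obtain ⟨hj, rfl⟩ := List.getElem?_eq_some_iff.1 hA
  exact ⟨⟨j, hj⟩, rfl, rfl⟩

theorem telDer_extendArgs {Γ : VCtx Sg} {As : List (Expr Sg)} {f : Expr Sg → Expr Sg}
    {ts : Fin As.length → Expr Sg}
    (h : ∀ j : Fin As.length, Der T Θ Γ (isTm (ts j)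
      ((f (As.get j)).inst fun i : Fin j => ts (i.castLE j.isLt.le)))) :
    TelDer T Θ Γ (As.map f) (extendArgs ts) := by
  intro j A hA
  obtain ⟨i, rfl, rfl⟩ := getElem?_map_get hA
  rw [extendArgs_of_lt, extendArgs_castLE]
  exact h i

/-- For an object metavariable this is the definition of the action. For an equality one, a valid
argument can only be ⋆, which no instantiation of variables changes. -/
theorem HomValid.mapp {I : List (ℕ × Expr Sg)} {X X' : List ℕ} {σ : ℕ → Expr Sg}
    (H : HomValid Θ X Θ' X' σ I) {M : ℕ} {BB : ABdry Sg} (hM : Θ.lookup M = some BB)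
    {e : Expr Sg} (he : I.lookup M = some e) (ts : Fin BB.tel.length → Expr Sg) :
    (mapp BB.concl.cls M ts).hom σ I = e.inst fun j => (ts j).hom σ I := by
  unfold FTT.mapp
  split_ifs with h
  · simp only [Expr.hom, he]
  · have := H.mvar M BB hM e he
    rw [ABdry.arity] at this
    cases e with
    | dummy c =>
      obtain ⟨rfl, -⟩ := this
      rfl
    | fvar a => obtain ⟨h', -⟩ := this; simp only at h'; rw [h'] at h; exact absurd rfl h
    | bvar i => obtain ⟨h', -⟩ := this; simp only at h'; rw [h'] at h; exact absurd rfl h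
    | sym S args =>
      obtain ⟨h', -⟩ := this
      simp only at h'
      rw [h'] at h
      exact absurd (Sg.cls_isObj S) h
    | mvar N n us => exact absurd this.1 h

theorem tel_inst_hom {I : List (ℕ × Expr Sg)} {X X' : List ℕ} {σ : ℕ → Expr Sg} {BB : ABdry Sg}
    {ts : Fin BB.tel.length → Expr Sg} (hB : BB.toStmt.Valid Θ [] 0)
    (H : HomValid Θ X Θ' X' σ I) (ht : ∀ j, (ts j).Valid Θ X 0 .tm) (j : Fin BB.tel.length) :
    ((BB.tel.get j).inst fun i : Fin j => ts (i.castLE j.isLt.le)).hom σ I =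
      ((BB.tel.get j).hom σ I).inst fun i : Fin j => (ts (i.castLE j.isLt.le)).hom σ I :=
  (ABdry.tel_get_valid hB j).hom_inst H fun _ => ht _

/-- A metavariable application becomes the assigned abstraction {x}e applied to the mapped terms:
`Der.apply` replaces the metavariable rule, and `Der.apply_eqv` its congruence rule. The arguments
live over the empty variable context and are first weakened. -/
theorem homClass_of_isInstDer {I : List (ℕ × Expr Sg)} (hΘ' : MCtx.Valid Θ')
    (hI : IsInstDer T Θ Θ' I) : HomClass T Θ Θ' I (IsSubst T Θ' I) where
  mctx := hΘ'
  vctx h := h.1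
  homValid h := hI.homValid h
  extend h hv hb := h.extend hΘ' (hI.homValid h) hv hb
  var h ha := h.2 _ _ ha
  mvar {Γ Γ' σ M BB ts} hσ hBB hM hv hts ht hB := by
    have H := hI.homValid hσ
    obtain ⟨e, he, hd⟩ := hI M BB hM
    have hd := hd.weaken (Γ' := Γ') hΘ' hσ.1 (fun _ _ h => h) (by simp)
    rw [ABdry.map_hom_of_valid hBB .fvar σ I] at hd
    simp only [AStmt.map, Thesis.map, FTT.isTm, Bdry.map, tel_inst_hom hBB H hts] at ht
    have := hd.apply (n := BB.tel.length) (by simp)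
      (by simpa only [ABdry.tel_fill, ABdry.tel_map] using
        telDer_extendArgs (ts := fun j => (ts j).hom σ I) ht)
    rw [extendArgs_eta, ABdry.concl_fill, ABdry.concl_map] at this
    simp only [AStmt.map, Thesis.map, H.mapp hM he, (ABdry.concl_valid hBB).hom_inst H hts]
    exact this
  mvarCongr {Γ Γ' σ M BB ss ts} hσ hBB hM hobj hv hss hts hs ht hst hC := by
    have H := hI.homValid hσ
    obtain ⟨e, he, hd⟩ := hI M BB hM
    have hd := hd.weaken (Γ' := Γ') hΘ' hσ.1 (fun _ _ h => h) (by simp)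
    rw [ABdry.map_hom_of_valid hBB .fvar σ I] at hd
    simp only [AStmt.map, Thesis.map, FTT.isTm, FTT.eqTm, Bdry.map, tel_inst_hom hBB H hss,
      tel_inst_hom hBB H hts] at hs ht hst
    rw [Bdry.map_fillEq fun _ => rfl, H.mapp hM he, H.mapp hM he,
      (ABdry.concl_valid hBB).hom_inst H hss]
    refine hd.apply_eqv (n := BB.tel.length) (by simp)
      (by simpa only [ABdry.tel_fill, ABdry.tel_map] using
        telDer_extendArgs (ts := fun j => (ss j).hom σ I) hs)
      (by simpa only [ABdry.tel_fill, ABdry.tel_map] using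
        telDer_extendArgs (ts := fun j => (ts j).hom σ I) ht)
      (fun j A hA => ?_) ?_
    · rw [ABdry.tel_fill, ABdry.tel_map] at hA
      obtain ⟨i, rfl, rfl⟩ := getElem?_map_get hA
      rw [extendArgs_of_lt, extendArgs_of_lt, extendArgs_castLE]
      exact hst i
    · rw [extendArgs_eta, extendArgs_eta, ABdry.concl_fill, ABdry.concl_map]
      exact AStmt.eqv_thesis_of_isObj (B := BB.concl.map (Expr.hom σ I)) (by rw [Bdry.cls_map]; exact hobj) _ _ _ _

/-- Admissibility of instantiation. -/
theorem Der.instantiate {I : List (ℕ × Expr Sg)} {J : AStmt Sg} (h : Der T Θ [] J)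
    (hΘ' : MCtx.Valid Θ') (hI : IsInstDer T Θ Θ' I) : Der T Θ' [] (J.map (Expr.hom .fvar I)) :=
  h.hom (homClass_of_isInstDer hΘ' hI) ⟨VCtx.valid_nil, fun a A h => by cases h⟩

end

/-! ### Inversion and generic applications -/

theorem Expr.Valid.eq_dummy {Θ : MCtx Sg} {X : List ℕ} {k : ℕ} {c : SynClass} {e : Expr Sg}
    (h : e.Valid Θ X k c) (hc : c.isObj = false) : e = .dummy c := by
  cases e with
  | dummy c' => rw [h.1]
  | fvar a => obtain ⟨rfl, -⟩ := h; cases hc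
  | bvar i => obtain ⟨rfl, -⟩ := h; cases hc
  | sym S args =>
    obtain ⟨rfl, -⟩ := h
    rw [Sg.cls_isObj] at hc
    cases hc
  | mvar M n ts =>
    rw [h.1] at hc
    cases hc

section
variable {T : RawTT.{u, v} Sg} {Θ Ξ : MCtx Sg}

/-- The generic application of an equality metavariable is ⋆. Under fresh variables for its
abstractions, the metavariable rule applies to these variables, with the opened boundary as its last
premise. -/
theorem Der.fill_dummy {M : ℕ} {BB : ABdry Sg} (h : Der T Θ [] BB.toStmt)
    (hM : Θ.lookup M = some BB) (hB : BB.isObj = false) :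
    Der T Θ [] (BB.fill (.dummy BB.concl.cls)) := by
  obtain ⟨a, Γ', ho, hJ, hrep⟩ := h.exists_opens (n := BB.tel.length) (by simp)
  obtain ⟨hΘ, hΓ, hv⟩ := h.valid
  have hB' : BB.concl.cls.isObj = false := hB
  have := hrep (.jdg BB.concl (.dummy BB.concl.cls)) (fun hv' => ?_)
  · rw [ABdry.withConcl_toStmt] at this
    exact this ⟨hΘ, hΓ, ABdry.fill_valid_iff.2 ⟨hv, rfl, hB⟩⟩
  · have e : mapp BB.concl.cls M (fun j : Fin BB.tel.length => (.fvar (a j) : Expr Sg)) =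
        .dummy BB.concl.cls := by simp [mapp, hB']
    have hv'' := hv'
    simp only [Thesis.map, Expr.instVars, Expr.inst, Expr.subst] at hv'' ⊢
    rw [← e] at hv'' ⊢
    simp only [ABdry.concl_toStmt] at hJ
    rw [ABdry.tel_toStmt] at ho
    exact .mvar _ hv'' hM (fun j => .fvar hJ.valid.1 hJ.valid.2.1
      (ho.new j _ (List.getElem?_eq_getElem j.isLt))) hJ

theorem hom_genApp {I : List (ℕ × Expr Sg)} {M : ℕ} {BB : ABdry Sg} {X : List ℕ} {e : Expr Sg}
    {σ : ℕ → Expr Sg} (he : I.lookup M = some e) (hv : e.Valid Θ X BB.arity.2 BB.arity.1) :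
    (genApp M BB).hom σ I = e := by
  unfold genApp mapp
  split_ifs with h
  · simp only [Expr.hom, he]
    exact hv.inst_generic
  · rw [hv.eq_dummy (by simpa [ABdry.arity] using h)]
    rfl

theorem RawRule.IsSymbolRule.args_get {R : RawRule Sg} {S : Sg.Sym} (h : R.IsSymbolRule S)
    (hl : R.prem.length = (Sg.args S).length) (i : Fin R.prem.length) :
    (Sg.args S).get (i.cast hl) = (R.prem.get i).2.arity := by
  have := List.getElem_of_eq h.2.2.1 (i := i) (by omega)
  simpa using this

/-- Only a conversion or a specific rule can conclude a judgement with head S(e₁, …, eₙ).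
Conversions alter the boundary alone, which is why `B` is arbitrary and absent from the result. -/
theorem Der.sym_inv (hT : T.IsStandard) {Γ : VCtx Sg} {B : Bdry Sg} {S : Sg.Sym}
    {es : Fin (Sg.args S).length → Expr Sg} (h : Der T Θ Γ (.thesis (.jdg B (.sym S es))))
    {r : T.Idx} (hr : (T.rule r).IsSymbolRule S)
    (hl : (T.rule r).prem.length = (Sg.args S).length) (i : Fin (T.rule r).prem.length) :
    Der T Θ Γ ((premBdry (T.rule r).prem (fun k => es (k.cast hl)) i).fill (es (i.cast hl))) := by
  generalize hJ : AStmt.thesis (.jdg B (.sym S es)) = J at h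
  induction h generalizing B with
  | mvar ts hv hM ht hB =>
    simp only [AStmt.thesis.injEq, Thesis.jdg.injEq, mapp] at hJ
    split_ifs at hJ <;> cases hJ.2
  | @mvarCongr _ _ BB =>
    cases hB : BB.concl <;> rw [hB] at hJ <;> cases hJ
  | ruleCongr r =>
    cases hB : (T.rule r).bdry <;> rw [hB] at hJ <;> cases hJ
  | convTm hv h₁ h₂ ih₁ ih₂ =>
    cases hJ
    exact ih₁ rfl
  | rule r' es' hv hp hq ihp ihq =>
    simp only [AStmt.thesis.injEq, Thesis.jdg.injEq] at hJ
    have hes i := valid_of_fill_premBdry (hp i).valid.2.2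
    -- A head starting with a symbol has an object class, so `r'` is a symbol rule; instantiating
    -- its generic applications returns the arguments, and uniqueness of the rule for `S` identifies
    -- `r'` with `r`.
    have hobj : (T.rule r').bdry.cls.isObj = true := by
      have := hv.2.2.2
      rw [← hJ.2, Bdry.act, Bdry.cls_map] at this
      rw [this.1]
      exact Sg.cls_isObj S
    obtain ⟨S', hS'⟩ := hT.2.1 r' hobj
    obtain ⟨hl', hhead⟩ := hS'.2.2.2
    have hJ := hJ.2
    have hnd := (T.rule_valid r').1.1
    rw [hhead, Expr.act_eq_hom] at hJ
    simp only [Expr.hom, hom_genApp (lookup_assign hnd es' _) (hes _)] at hJ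
    cases hJ
    obtain rfl := (hT.2.2 S).unique hS' hr
    exact hp i
  | _ => cases hJ

/-! ### Judgements that are natural for variables -/

theorem Natural.valid {Γ : VCtx Sg} {J : AStmt Sg} (h : Natural T Θ Γ J) : HValid Θ Γ J := by
  cases h <;> assumption

theorem Natural.abs_inv {Γ : VCtx Sg} {A : Expr Sg} {J : AStmt Sg}
    (h : Natural T Θ Γ (.abs A J)) :
    ∃ a, a ∉ dom Γ ∧ Natural T Θ (Γ ++ [(a, A)]) (J.openVar a) := by
  generalize hJ : AStmt.abs A J = J' at h
  cases h with
  | abstr a hv ha hJ' =>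
    cases hJ
    exact ⟨a, ha, hJ'⟩
  | _ => cases hJ

theorem Natural.fvar_inv {Γ : VCtx Sg} {a : ℕ} {A : Expr Sg}
    (h : Natural T Θ Γ (isTm (.fvar a) A)) : Γ.lookup a = some A := by
  generalize hJ : FTT.isTm (.fvar a) A = J at h
  cases h with
  | var hv ha =>
    cases hJ
    exact ha
  | _ => cases hJ

theorem Natural.mvar_inv {Γ : VCtx Sg} {B : Bdry Sg} {M n : ℕ} {ts : Fin n → Expr Sg}
    (h : Natural T Θ Γ (.thesis (.jdg B (.mvar M n ts)))) :
    ∃ (BB : ABdry Sg) (hn : BB.tel.length = n), Θ.lookup M = some BB ∧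
      B = BB.concl.map (Expr.inst fun j => ts (j.cast hn)) ∧
      ∀ j : Fin BB.tel.length, Natural T Θ Γ (isTm (ts (j.cast hn))
        ((BB.tel.get j).inst fun i : Fin j => ts ((i.castLE j.isLt.le).cast hn))) := by
  generalize hJ : AStmt.thesis (.jdg B (.mvar M n ts)) = J at h
  cases h with
  | tyMvar ts hv hM hB ht =>
    rename_i BB
    cases hJ
    exact ⟨BB, rfl, hM, by rw [hB]; rfl, ht⟩
  | tmMvar ts hv hM hB ht =>
    rename_i BB C
    cases hJ
    exact ⟨BB, rfl, hM, by rw [hB]; rfl, ht⟩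
  | _ => cases hJ

theorem Natural.sym_inv {Γ : VCtx Sg} {B : Bdry Sg} {S : Sg.Sym}
    {es : Fin (Sg.args S).length → Expr Sg}
    (h : Natural T Θ Γ (.thesis (.jdg B (.sym S es)))) :
    ∃ (r : T.Idx) (hl : (T.rule r).prem.length = (Sg.args S).length),
      (T.rule r).IsSymbolRule S ∧ ∀ i, ((T.rule r).prem.get i).2.isObj = true →
        Natural T Θ Γ
          ((premBdry (T.rule r).prem (fun k => es (k.cast hl)) i).fill (es (i.cast hl))) := by
  generalize hJ : AStmt.thesis (.jdg B (.sym S es)) = J at h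
  cases h with
  | sym r S' B' es' hv hS hl he =>
    cases hJ
    exact ⟨r, hl, hS, he⟩
  | _ => cases hJ

/-- Free and bound variables. -/
def Expr.IsVar : Expr Sg → Prop
  | .fvar _ => True
  | .bvar _ => True
  | _ => False

theorem Expr.IsVar.rename {e : Expr Sg} (h : e.IsVar) (ρ : ℕ → ℕ) : (e.rename ρ).IsVar := by
  cases e <;> trivial

theorem Expr.IsVar.rename_injective {e e' : Expr Sg} (h : e.IsVar) (h' : e'.IsVar) {n : ℕ}
    (he : e.rename (· + n) = e'.rename (· + n)) : e = e' := by
  cases e <;> cases e' <;> first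
    | exact h.elim
    | exact h'.elim
    | simpa only [Expr.rename, Expr.bvar.injEq, Nat.add_right_cancel_iff] using he
    | cases he

theorem Expr.IsVar.rename_ne_bvar {e : Expr Sg} (h : e.IsVar) {n i : ℕ} (hi : i < n) :
    e.rename (· + n) ≠ .bvar i := by
  cases e with
  | bvar j =>
    simp only [Expr.rename, ne_eq, Expr.bvar.injEq]
    omega
  | fvar a => simp [Expr.rename]
  | _ => exact h.elim

theorem liftSub_isVar {k n : ℕ} {τ : ℕ → Expr Sg} (hτ : ∀ i < k, (τ i).IsVar) :
    ∀ i < k + n, (liftSub n τ i).IsVar := by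
  intro i hi
  unfold liftSub
  split_ifs with h
  · trivial
  · exact (hτ _ (by omega)).rename _

theorem liftSub_injective {k n : ℕ} {τ : ℕ → Expr Sg} (hτ : ∀ i < k, (τ i).IsVar)
    (hinj : ∀ i < k, ∀ j < k, τ i = τ j → i = j) :
    ∀ i < k + n, ∀ j < k + n, liftSub n τ i = liftSub n τ j → i = j := by
  intro i hi j hj h
  unfold liftSub at h
  split_ifs at h with h₁ h₂ h₂
  · simpa using h
  · exact absurd h.symm ((hτ _ (by omega)).rename_ne_bvar h₁)
  · exact absurd h ((hτ _ (by omega)).rename_ne_bvar h₂)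
  · have := hinj _ (by omega) _ (by omega)
      ((hτ (i - n) (by omega)).rename_injective (hτ (j - n) (by omega)) h)
    omega

/-- With no free variables in `e` and `e'`, a variable in the result can only stem from a bound
variable, and distinct ones have distinct images. Bound variables count as values since lifting
under a binder creates them. -/
theorem Expr.Valid.subst_injective {k : ℕ} {c c' : SynClass} {e e' : Expr Sg}
    (h : e.Valid Θ [] k c) (h' : e'.Valid Θ [] k c') {τ : ℕ → Expr Sg}
    (hτ : ∀ i < k, (τ i).IsVar) (hinj : ∀ i < k, ∀ j < k, τ i = τ j → i = j)
    (he : e.subst τ = e'.subst τ) : e = e' := by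
  induction e generalizing k c c' e' τ with
  | fvar a => cases h.2
  | bvar i =>
    have := hτ i h.2
    simp only [Expr.subst] at he
    cases e' with
    | fvar a => cases h'.2
    | bvar j => rw [hinj i h.2 j h'.2 he]
    | _ => rw [he] at this; exact this.elim
  | sym S args ih =>
    simp only [Expr.subst] at he
    cases e' with
    | fvar a => cases h'.2
    | bvar j =>
      have := hτ j h'.2
      simp only [Expr.subst] at he
      rw [← he] at this
      exact this.elim
    | sym S' args' =>
      simp only [Expr.subst, Expr.sym.injEq] at he
      obtain ⟨rfl, he⟩ := he
      congr 1
      funext j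
      exact ih j (h.2 j) (h'.2 j) (liftSub_isVar hτ) (liftSub_injective hτ hinj)
        (congrFun (eq_of_heq he) j)
    | _ => cases he
  | mvar M n ts ih =>
    simp only [Expr.subst] at he
    cases e' with
    | fvar a => cases h'.2
    | bvar j =>
      have := hτ j h'.2
      simp only [Expr.subst] at he
      rw [← he] at this
      exact this.elim
    | mvar M' n' ts' =>
      simp only [Expr.subst, Expr.mvar.injEq] at he
      obtain ⟨rfl, rfl, he⟩ := he
      congr 1
      funext j
      exact ih j (h.2.2 j) (h'.2.2 j) hτ hinj (congrFun (eq_of_heq he) j)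
    | _ => cases he
  | dummy d =>
    cases e' with
    | fvar a => cases h'.2
    | bvar j =>
      have := hτ j h'.2
      simp only [Expr.subst] at he
      rw [← he] at this
      exact this.elim
    | dummy d' => exact he
    | _ => cases he

theorem Expr.Valid.instVars_injective {n : ℕ} {c c' : SynClass} {e e' : Expr Sg}
    (h : e.Valid Θ [] n c) (h' : e'.Valid Θ [] n c') {a : ℕ → ℕ}
    (ha : ∀ i < n, ∀ j < n, a i = a j → i = j) (he : e.instVars a n = e'.instVars a n) :
    e = e' := by
  refine h.subst_injective h' (fun i hi => ?_) (fun i hi j hj hij => ?_) he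
  · simp [instSub, hi, Expr.IsVar]
  · simp only [instSub, hi, hj, dif_pos, Expr.fvar.injEq, Fin.val_rev] at hij
    have := ha _ (by omega) _ (by omega) hij
    omega

theorem Bdry.Valid.instVars_injective {n : ℕ} {B B' : Bdry Sg} (h : B.Valid Θ [] n)
    (h' : B'.Valid Θ [] n) {a : ℕ → ℕ} (ha : ∀ i < n, ∀ j < n, a i = a j → i = j)
    (he : B.map (Expr.instVars a n) = B'.map (Expr.instVars a n)) : B = B' := by
  cases B <;> cases B' <;> simp only [Bdry.map, reduceCtorEq, Bdry.isTm.injEq, Bdry.eqTy.injEq,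
    Bdry.eqTm.injEq] at he ⊢
  · exact Expr.Valid.instVars_injective h h' ha he
  · exact ⟨h.1.instVars_injective h'.1 ha he.1, h.2.instVars_injective h'.2 ha he.2⟩
  · exact ⟨h.1.instVars_injective h'.1 ha he.1, h.2.1.instVars_injective h'.2.1 ha he.2.1,
      h.2.2.instVars_injective h'.2.2 ha he.2.2⟩

/-- After opening, naturality types each fresh variable both by its declaration, from `BB`, and by
the boundary of `M`. Without conversion these types coincide syntactically, and closed expressions
are recovered from their openings at distinct variables. -/
theorem Natural.lookup_of_generic {BB : ABdry Sg} {M n : ℕ} (hn : BB.tel.length = n)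
    (h : Natural T Θ [] (BB.fill (.mvar M n fun j : Fin n => .bvar (Fin.rev j)))) :
    Θ.lookup M = some BB := by
  obtain ⟨a, Γ', ho, hJ, -⟩ := FTT.exists_opens (R := Natural T Θ) (Q := fun _ _ => True)
    (fun Γ A J h => h.abs_inv.imp fun a h => ⟨h.1, h.2, fun _ _ => trivial⟩)
    (n := n) (by simpa using hn) h
  obtain ⟨hΘ, -, hv⟩ := h.valid
  have hBB := (ABdry.fill_valid_iff.1 hv).1
  have e : (Expr.mvar M n fun j : Fin n => (.bvar (Fin.rev j) : Expr Sg)).instVars a n =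
      .mvar M n fun j : Fin n => .fvar (a j) := by
    simp only [Expr.instVars, Expr.inst, Expr.subst, Expr.mvar.injEq, heq_eq_eq, true_and]
    funext j
    rw [instSub, dif_pos (Fin.rev j).isLt, Fin.eta, Fin.rev_rev]
  rw [ABdry.concl_fill, Thesis.map, e] at hJ
  obtain ⟨BB', hn', hM, hB, ht⟩ := hJ.mvar_inv
  have hBB' := hΘ.lookup hM
  rw [ABdry.tel_fill] at ho
  rw [hM]
  congr 1
  subst hn'
  symm
  apply ABdry.ext_tel_concl
  · refine List.ext_getElem hn fun j hj hj' => ?_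
    have h₁ := ho.new j _ (List.getElem?_eq_getElem hj)
    have h₂ := (ht ⟨j, hj'⟩).fvar_inv
    have h₃ : Γ'.lookup (a j) = some (BB'.tel[j].instVars a j) := h₂
    rw [h₁, Option.some.injEq] at h₃
    exact Expr.Valid.instVars_injective (ABdry.tel_get_valid hBB ⟨j, hj⟩)
      (ABdry.tel_get_valid hBB' ⟨j, hj'⟩)
      (fun x hx y hy => ho.inj x (by omega) y (by omega)) h₃
  · have h₁ : BB.concl.Valid Θ [] BB.tel.length := ABdry.concl_valid hBB
    rw [hn] at h₁
    exact h₁.instVars_injective (ABdry.concl_valid hBB')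
      (fun x hx y hy => ho.inj x (by omega) y (by omega)) hB

/-! ### Patterns -/

/-- The number of variables bound by a pattern. -/
def PatKind.depth : PatKind → ℕ
  | .ty => 0
  | .tm => 0
  | .arg n => n

theorem IsPattern.isObj {κ : PatKind} {e : Expr Sg} (hP : IsPattern κ e) {X : List ℕ} {k : ℕ}
    {c : SynClass} (h : e.Valid Θ X k c) : c.isObj = true := by
  induction hP with
  | tyMvar => exact h.1
  | tySym S => rw [h.1]; exact Sg.cls_isObj S
  | tmSym S => rw [h.1]; exact Sg.cls_isObj S
  | argMvar => exact h.1
  | argTy P hP ih => exact ih h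
  | argTm P hP ih => exact ih h

section
variable {I I' : List (ℕ × Expr Sg)}

/-- If I(M) = {x}e, then M(x) is sent to e[x/x] = e, so the value of `M` is visible in the image. -/
theorem hom_generic {X X' : List ℕ} (H : HomValid Ξ [] Θ X' .fvar I) {M n k : ℕ} {c : SynClass}
    (hI : ∀ M BB, Ξ.lookup M = some BB → ∃ e, I.lookup M = some e)
    (h : (Expr.mvar M n fun j : Fin n => (.bvar (Fin.rev j) : Expr Sg)).Valid Ξ X k c) :
    I.lookup M =
      some ((Expr.mvar M n fun j : Fin n => (.bvar (Fin.rev j) : Expr Sg)).hom .fvar I) := by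
  obtain ⟨-, ⟨BB, hM, hB⟩, -⟩ := h
  obtain ⟨e, he⟩ := hI M BB hM
  have hv := H.mvar M BB hM e he
  rw [hB] at hv
  simp only [Expr.hom, he]
  exact congrArg some hv.inst_generic.symm

theorem mvar_zero_eq_generic (M : ℕ) (ts : Fin 0 → Expr Sg) :
    Expr.mvar M 0 ts = .mvar M 0 fun j : Fin 0 => .bvar (Fin.rev j) := by
  congr 1
  funext j
  exact j.elim0

theorem mv_generic {M n M' : ℕ}
    (h : M' ∈ (Expr.mvar M n fun j : Fin n => (.bvar (Fin.rev j) : Expr Sg)).mv) : M' = M := by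
  simpa [Expr.mv] using h

/-- Symbols are preserved by both actions, so equality descends to the leaves, where the image is
the assigned value. -/
theorem IsPattern.lookup_eq_of_hom_eq {κ : PatKind} {e : Expr Sg} (hP : IsPattern κ e)
    {X : List ℕ} (H : HomValid Ξ [] Θ X .fvar I) (H' : HomValid Ξ [] Θ X .fvar I')
    (hI : ∀ M BB, Ξ.lookup M = some BB → ∃ e, I.lookup M = some e)
    (hI' : ∀ M BB, Ξ.lookup M = some BB → ∃ e, I'.lookup M = some e)
    {k : ℕ} {c : SynClass} (h : e.Valid Ξ [] k c) (he : e.hom .fvar I = e.hom .fvar I') :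
    ∀ M ∈ e.mv, I.lookup M = I'.lookup M := by
  intro N hN
  induction hP generalizing k c with
  | tyMvar M ts =>
    rw [mvar_zero_eq_generic] at h he hN
    rw [mv_generic hN, hom_generic H hI h, hom_generic H' hI' h, he]
  | argMvar M n => rw [mv_generic hN, hom_generic H hI h, hom_generic H' hI' h, he]
  | tySym S qs hS hq hd ih =>
    simp only [Expr.mv, Set.mem_iUnion] at hN
    obtain ⟨j, hN⟩ := hN
    simp only [Expr.hom, Expr.sym.injEq, heq_eq_eq, true_and] at he
    exact ih j (h.2 j) (congrFun he j) hN
  | tmSym S qs hS hq hd ih =>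
    simp only [Expr.mv, Set.mem_iUnion] at hN
    obtain ⟨j, hN⟩ := hN
    simp only [Expr.hom, Expr.sym.injEq, heq_eq_eq, true_and] at he
    exact ih j (h.2 j) (congrFun he j) hN
  | argTy P hP ih => exact ih h he hN
  | argTm P hP ih => exact ih h he hN

/-- One step of the parallel descent: naturality before, derivability after the action of `I`,
passed on to an object argument. The boundary `CC` is the premise of the symbol rule instantiated by
the arguments of the pattern, and `I` commutes with that. -/
theorem Natural.der_arg (hT : T.IsStandard) (H : HomValid Ξ [] Θ [] .fvar I)
    {S : Sg.Sym} {qs : Fin (Sg.args S).length → Expr Sg} {BB : ABdry Sg}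
    (hn : BB.tel.length = 0) (hnat : Natural T Ξ [] (BB.fill (.sym S qs)))
    (hd : Der T Θ [] ((BB.fill (.sym S qs)).map (Expr.hom .fvar I)))
    (j : Fin (Sg.args S).length) (hj : ((Sg.args S).get j).1.isObj = true) :
    ∃ CC : ABdry Sg, CC.tel.length = ((Sg.args S).get j).2 ∧ Natural T Ξ [] (CC.fill (qs j)) ∧
      Der T Θ [] ((CC.fill (qs j)).map (Expr.hom .fvar I)) := by
  cases BB with
  | abs A BB => simp [ABdry.tel] at hn
  | thesis B =>
    obtain ⟨r, hl, hr, hprem⟩ := hnat.sym_inv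
    have hargs := hr.args_get hl
    have hΞ := (T.rule_valid r).1
    obtain ⟨i, rfl⟩ : ∃ i : Fin (T.rule r).prem.length, i.cast hl = j :=
      ⟨j.cast hl.symm, rfl⟩
    have hv := hnat.valid.2.2.2
    have hqs (i : Fin (T.rule r).prem.length) : (qs (i.cast hl)).Valid Ξ []
        ((T.rule r).prem.get i).2.arity.2 ((T.rule r).prem.get i).2.arity.1 := by
      have := hv.2 (i.cast hl)
      rwa [hargs, Nat.zero_add] at this
    have hi := arity_premBdry (es := fun k => qs (k.cast hl)) i
    rw [hargs] at hj
    refine ⟨premBdry (T.rule r).prem (fun k => qs (k.cast hl)) i, ?_, hprem i hj, ?_⟩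
    · rw [hargs]
      exact congrArg Prod.snd hi
    · rw [ABdry.map_fill, premBdry_hom hΞ hqs H]
      exact hd.sym_inv hT hr hl i

/-- In a pattern, variables are bound only directly around a metavariable. The condition on the
depth records this, so that symbols are met only under unabstracted boundaries and the descent never
leaves the empty variable context. -/
theorem IsPattern.der_of_natural (hT : T.IsStandard) {κ : PatKind} {e : Expr Sg}
    (hP : IsPattern κ e) (H : HomValid Ξ [] Θ [] .fvar I)
    (hI : ∀ M BB, Ξ.lookup M = some BB → ∃ e, I.lookup M = some e) {BB : ABdry Sg}
    (hn : BB.tel.length = κ.depth) (hnat : Natural T Ξ [] (BB.fill e))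
    (hd : Der T Θ [] ((BB.fill e).map (Expr.hom .fvar I))) :
    ∀ M ∈ e.mv, ∃ CC e', Ξ.lookup M = some CC ∧ I.lookup M = some e' ∧
      Der T Θ [] ((CC.map (Expr.hom .fvar I)).fill e') := by
  intro N hN
  have hgen {M n : ℕ} {BB : ABdry Sg} (hn : BB.tel.length = n)
      (hnat : Natural T Ξ [] (BB.fill (.mvar M n fun j : Fin n => .bvar (Fin.rev j))))
      (hd : Der T Θ [] ((BB.fill (.mvar M n fun j : Fin n => .bvar (Fin.rev j))).map
        (Expr.hom .fvar I))) : ∃ CC e', Ξ.lookup M = some CC ∧ I.lookup M = some e' ∧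
      Der T Θ [] ((CC.map (Expr.hom .fvar I)).fill e') := by
    have hv := (ABdry.fill_valid_iff.1 hnat.valid.2.2).2
    rw [ABdry.map_fill] at hd
    exact ⟨BB, _, hnat.lookup_of_generic hn, hom_generic H hI hv, hd⟩
  have hsym {S : Sg.Sym} {qs : Fin (Sg.args S).length → Expr Sg} {BB : ABdry Sg}
      (hq : ∀ i, IsPattern (.arg ((Sg.args S).get i).2) (qs i))
      (hn : BB.tel.length = 0) (hnat : Natural T Ξ [] (BB.fill (.sym S qs)))
      (hd : Der T Θ [] ((BB.fill (.sym S qs)).map (Expr.hom .fvar I)))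
      (j : Fin (Sg.args S).length) :=
    hnat.der_arg hT H hn hd j
      ((hq j).isObj ((ABdry.fill_valid_iff.1 hnat.valid.2.2).2.2 j))
  induction hP generalizing BB with
  | tyMvar M ts =>
    rw [mvar_zero_eq_generic] at hnat hd hN
    rw [mv_generic hN]
    exact hgen hn hnat hd
  | argMvar M n =>
    rw [mv_generic hN]
    exact hgen hn hnat hd
  | tySym S qs hS hq hdj ih =>
    simp only [Expr.mv, Set.mem_iUnion] at hN
    obtain ⟨j, hN⟩ := hN
    obtain ⟨CC, hC, hnC, hdC⟩ := hsym hq hn hnat hd j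
    exact ih j hC hnC hdC hN
  | tmSym S qs hS hq hdj ih =>
    simp only [Expr.mv, Set.mem_iUnion] at hN
    obtain ⟨j, hN⟩ := hN
    obtain ⟨CC, hC, hnC, hdC⟩ := hsym hq hn hnat hd j
    exact ih j hC hnC hdC hN
  | argTy P hP ih => exact ih hn hnat hd hN
  | argTm P hP ih => exact ih hn hnat hd hN

end
end

/-! ### Metavariable contexts and residues -/

section
variable {T : RawTT.{u, v} Sg} {Θ Ξ : MCtx Sg}

theorem MCtxDer.concat_inv {M : ℕ} {BB : ABdry Sg} (h : MCtxDer T (Θ ++ [(M, BB)])) :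
    MCtxDer T Θ ∧ Der T Θ [] BB.toStmt := by
  generalize hΘ : Θ ++ [(M, BB)] = Θ' at h
  cases h with
  | empty => simp at hΘ
  | extend h hB hM =>
    obtain ⟨rfl, hx⟩ := List.append_inj' hΘ rfl
    cases hx
    exact ⟨h, hB⟩

theorem MCtxDer.of_append {Θ' : MCtx Sg} (h : MCtxDer T (Θ ++ Θ')) : MCtxDer T Θ := by
  induction Θ' using List.reverseRecOn with
  | nil => simpa using h
  | append_singleton L x ih =>
    rw [← List.append_assoc] at h
    exact ih h.concat_inv.1

theorem MCtxDer.valid (h : MCtxDer T Θ) : MCtx.Valid Θ := by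
  cases h with
  | empty => exact MCtx.valid_nil
  | extend h hB hM => exact MCtx.valid_concat.2 ⟨hB.valid.1, hM, hB.valid.2.2⟩

theorem MCtxDer.get (h : MCtxDer T Θ) (i : Fin Θ.length) :
    Der T (Θ.take i) [] (Θ.get i).2.toStmt := by
  revert i
  induction h with
  | empty => exact fun i => i.elim0
  | extend h hB hM ih =>
    exact (forall_concat (p := fun (L : List (ℕ × ABdry Sg)) x => Der T L [] x.2.toStmt)).2 ⟨ih, hB⟩

/-- Tailored to the residue: once instantiated, the equational premises mention metavariables of `Θ`
only, not one another. -/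
theorem MCtx.Valid.append {L : MCtx Sg} (h : MCtx.Valid Θ) (hL : (dom L).Nodup)
    (hd : ∀ M ∈ dom L, M ∉ dom Θ) (hB : ∀ p ∈ L, p.2.toStmt.Valid Θ [] 0) :
    MCtx.Valid (Θ ++ L) := by
  induction L using List.reverseRecOn with
  | nil => simpa using h
  | append_singleton L x ih =>
    obtain ⟨M, BB⟩ := x
    obtain ⟨hL, hM⟩ := nodup_dom_concat.1 hL
    rw [← List.append_assoc]
    refine MCtx.valid_concat.2 ⟨ih hL (fun N hN => hd N ?_) (fun p hp => hB p (by simp [hp])), ?_, ?_⟩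
    · rw [dom_append]
      exact List.mem_append_left _ hN
    · rw [dom_append, List.mem_append, not_or]
      exact ⟨hd M (by simp [dom]), hM⟩
    · exact (hB (M, BB) (by simp)).mono (fun _ _ => lookup_append_left) fun _ h => h

theorem Der.bdryTm_inv {Γ : VCtx Sg} {A : Expr Sg} (h : Der T Θ Γ (bdry (.isTm A))) :
    Der T Θ Γ (FTT.isTy A) := by
  generalize hJ : FTT.bdry (.isTm A) = J at h
  cases h with
  | bdryTm hv hA =>
    cases hJ
    exact hA
  | @mvarCongr _ _ BB =>
    cases hB : BB.concl <;> rw [hB] at hJ <;> cases hJ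
  | ruleCongr r =>
    cases hB : (T.rule r).bdry <;> rw [hB] at hJ <;> cases hJ
  | _ => cases hJ

theorem mem_residue_iff {es : Fin Ξ.length → Expr Sg} {p : ℕ × ABdry Sg} :
    p ∈ residue Ξ Θ es ↔ p ∈ Θ ∨ ∃ i, (Ξ.get i).2.isObj = false ∧
      p = ((Ξ.get i).1, premBdry Ξ es i) := by
  simp only [residue, List.mem_append, List.mem_filterMap, List.mem_finRange, true_and]
  refine or_congr_right (exists_congr fun i => ?_)
  cases (Ξ.get i).2.isObj <;> simp [eq_comm]

theorem fst_get_injective (hΞ : (dom Ξ).Nodup) {i j : Fin Ξ.length}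
    (h : (Ξ.get i).1 = (Ξ.get j).1) : i = j := by
  have hi : (i : ℕ) < (dom Ξ).length := by simp [dom]
  have hj : (j : ℕ) < (dom Ξ).length := by simp [dom]
  have := (hΞ.getElem_inj_iff (hi := hi) (hj := hj)).1 (by simpa [dom] using h)
  exact Fin.ext this

theorem residue_valid {es : Fin Ξ.length → Expr Sg} (hΘ : MCtx.Valid Θ) (hΞ : MCtx.Valid Ξ)
    (hd : List.Disjoint (dom Ξ) (dom Θ)) (H : HomValid Ξ [] Θ [] .fvar (assign Ξ es)) :
    MCtx.Valid (residue Ξ Θ es) := by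
  refine hΘ.append ?_ ?_ ?_
  · rw [dom, List.map_filterMap]
    refine List.Nodup.filterMap (fun i j M hi hj => ?_) (List.nodup_finRange _)
    split_ifs at hi hj <;> simp_all only [Option.map_none, Option.mem_def, reduceCtorEq,
      Option.map_some, Option.some.injEq]
    exact fst_get_injective hΞ.1 (hi.trans hj.symm)
  · intro M hM
    simp only [dom, List.mem_map, List.mem_filterMap] at hM
    obtain ⟨p, ⟨i, -, hi⟩, rfl⟩ := hM
    split_ifs at hi
    cases hi
    exact fun h => hd (List.mem_map_of_mem (List.get_mem _ i)) h
  · intro p hp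
    simp only [List.mem_filterMap] at hp
    obtain ⟨i, -, hi⟩ := hp
    split_ifs at hi
    cases hi
    rw [premBdry_eq hΞ, ← ABdry.map_toStmt]
    exact (hΞ.lookup (lookup_get hΞ.1 i)).hom H

/-- At equality metavariables both instantiations are forced to be ⋆. The residual instantiation
thus differs from the given one only in the context over which it is considered. -/
theorem residualInst_eq {es : Fin Ξ.length → Expr Sg} {X : List ℕ}
    (he : ∀ i, (es i).Valid Θ X (Ξ.get i).2.arity.2 (Ξ.get i).2.arity.1) :
    residualInst Ξ es = es := by
  funext i
  unfold residualInst
  split_ifs with h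
  · rfl
  · have h' : (Ξ.get i).2.concl.cls.isObj = false := by simpa [ABdry.isObj] using h
    rw [(he i).eq_dummy h']
    simp only [genApp, mapp, h']
    rfl

/-! ### Pattern rules -/

theorem tyRule_deterministic {P : Expr Sg} (hΞ : MCtx.Valid Ξ) (hP : IsPattern .ty P)
    (hmv : P.mv = objmv Ξ) (hPv : P.Valid Ξ [] 0 .ty) : (tyRule Ξ P).Deterministic := by
  intro Θ Γ J _ (es : Fin Ξ.length → Expr Sg) (es' : Fin Ξ.length → Expr Sg) hes hes' h h'
  have he : P.act (assign Ξ es) = P.act (assign Ξ es') := by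
    have := h.trans h'.symm
    simp only [tyRule, AStmt.thesis.injEq, Thesis.jdg.injEq] at this
    exact this.2
  rw [Expr.act_eq_hom, Expr.act_eq_hom] at he
  replace hes : ∀ i, (es i).Valid Θ (dom Γ) (Ξ.get i).2.arity.2 (Ξ.get i).2.arity.1 := hes.2.2
  replace hes' : ∀ i, (es' i).Valid Θ (dom Γ) (Ξ.get i).2.arity.2 (Ξ.get i).2.arity.1 := hes'.2.2
  funext i
  cases hi : (Ξ.get i).2.isObj with
  | false => rw [(hes i).eq_dummy hi, (hes' i).eq_dummy hi]
  | true =>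
    have hM : (Ξ.get i).1 ∈ P.mv := by
      rw [hmv]
      exact ⟨_, List.get_mem Ξ i, hi⟩
    have := hP.lookup_eq_of_hom_eq (assign_homValid hΞ.1 hes) (assign_homValid hΞ.1 hes')
      (exists_lookup_assign hΞ.1 es) (exists_lookup_assign hΞ.1 es') hPv he _ hM
    rwa [lookup_assign hΞ.1, lookup_assign hΞ.1, Option.some.injEq] at this

/-- Object arguments are weakened from `Θ`. For an equational premise, the earlier arguments are
derivable by induction, so its boundary can be instantiated; the residue has a metavariable with
just this boundary. -/
theorem instDer_residue {es : Fin Ξ.length → Expr Sg} (hΞ : MCtxDer T Ξ) (hΘ : MCtxDer T Θ)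
    (hes : ∀ i, (es i).Valid Θ [] (Ξ.get i).2.arity.2 (Ξ.get i).2.arity.1)
    (hd : List.Disjoint (dom Ξ) (dom Θ))
    (hobj : ∀ i, (Ξ.get i).2.isObj = true → Der T Θ [] ((premBdry Ξ es i).fill (es i))) :
    InstDer T Ξ (residue Ξ Θ es) [] es := by
  have hΞv := hΞ.valid
  have hR := residue_valid hΘ.valid hΞv hd (assign_homValid hΞv.1 hes)
  suffices h : ∀ (n : ℕ) (i : Fin Ξ.length), (i : ℕ) = n →
      Der T (residue Ξ Θ es) [] ((premBdry Ξ es i).fill (es i)) from fun i => h i i rfl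
  intro n
  induction n using Nat.strong_induction_on with
  | _ n ih =>
    rintro i rfl
    cases hi : (Ξ.get i).2.isObj with
    | true =>
      exact (hobj i hi).weaken hR VCtx.valid_nil (fun _ _ => lookup_append_left) fun _ _ h => h
    | false =>
      -- The full assignment serves for the prefix as well, since only metavariables of `Ξ.take i`
      -- are looked up.
      have hI : IsInstDer T (Ξ.take i) (residue Ξ Θ es) (assign Ξ es) := by
        intro M BB hM
        obtain ⟨⟨j, hj⟩, hget⟩ := exists_get_of_lookup hM
        rw [List.length_take, lt_min_iff] at hj
        have hget' : Ξ.get ⟨j, hj.2⟩ = (M, BB) := by simpa using hget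
        have h₁ := ih j hj.1 ⟨j, hj.2⟩ rfl
        have h₂ := lookup_assign hΞv.1 es ⟨j, hj.2⟩
        rw [premBdry_eq hΞv] at h₁
        rw [hget'] at h₁ h₂
        exact ⟨_, h₂, h₁⟩
      have hB := (hΞ.get i).instantiate hR hI
      rw [ABdry.map_toStmt, ← premBdry_eq hΞv] at hB
      have hcls : (premBdry Ξ es i).concl.cls = (Ξ.get i).2.concl.cls :=
        congrArg Prod.fst (arity_premBdry (es := es) i)
      rw [(hes i).eq_dummy hi, show (Ξ.get i).2.arity.1 = _ from hcls.symm]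
      refine hB.fill_dummy (lookup_of_mem hR.1 (mem_residue_iff.2 (.inr ⟨i, hi, rfl⟩))) ?_
      rw [ABdry.isObj, hcls]
      exact hi

/-- Every object metavariable occurs in `P`, so the descent through the pattern yields all the
object arguments; the equational ones then follow over the residue. -/
theorem tyRule_objectInvertible (hT : T.IsStandard) {P : Expr Sg} (hΞ : MCtxDer T Ξ)
    (hP : IsPattern .ty P) (hmv : P.mv = objmv Ξ) (hnat : Natural T Ξ [] (isTy P))
    (hder : Der T Ξ [] (isTy P)) : (tyRule Ξ P).ObjectInvertible T := by
  refine ⟨hder, fun Θ (es : Fin Ξ.length → Expr Sg) hes hΘ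
    (hd : List.Disjoint (dom Ξ) (dom Θ)) h => ?_⟩
  have hes : ∀ i, (es i).Valid Θ [] (Ξ.get i).2.arity.2 (Ξ.get i).2.arity.1 := hes.2.2
  have hΞv := hΞ.valid
  change Der T Θ [] (isTy (P.act (assign Ξ es))) at h
  change InstDer T Ξ (residue Ξ Θ es) [] (residualInst Ξ es)
  rw [Expr.act_eq_hom] at h
  rw [residualInst_eq hes]
  refine instDer_residue hΞ hΘ hes hd fun i hi => ?_
  have hM : (Ξ.get i).1 ∈ P.mv := by
    rw [hmv]
    exact ⟨_, List.get_mem Ξ i, hi⟩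
  obtain ⟨CC, e, hC, he, hd⟩ := hP.der_of_natural hT (assign_homValid hΞv.1 hes)
    (exists_lookup_assign hΞv.1 es) (BB := .thesis .isTy) rfl hnat h _ hM
  rw [lookup_get hΞv.1, Option.some.injEq] at hC
  rw [lookup_assign hΞv.1, Option.some.injEq] at he
  rw [premBdry_eq hΞv, hC, he]
  exact hd

end
end FTT

/-! ### The proposition -/

theorem mainTheorem5 {Sg : FTT.Signature.{u}} (T : FTT.RawTT.{u, v} Sg) (hT : T.IsStandard)
    (Ξ Φ : FTT.MCtx Sg) (s t : ℕ) (P : FTT.Expr Sg)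
    (hder : (FTT.extRule Ξ s t P Φ).Derivable T)
    (hfin : (FTT.extRule Ξ s t P Φ).Finitary T)
    (hΦ : FTT.OnlyEquational Φ)
    (hP : FTT.IsPattern .ty P)
    (hmv : P.mv = FTT.objmv Ξ)
    (hnat : FTT.Natural T Ξ [] (FTT.isTy P)) :
    (FTT.extRule Ξ s t P Φ).IsExtensionalityRule T := by
  -- The premise `s` has boundary `□ : P`, whose well-formedness over `Ξ` contains the derivability
  -- of `P type`, required for object-invertibility.
  have h₁ : FTT.MCtxDer T (Ξ ++ [(s, .thesis (.isTm P))]) := by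
    have h := hfin.1.of_append
    rw [show Ξ ++ [(s, .thesis (.isTm P)), (t, .thesis (.isTm P))] =
      Ξ ++ [(s, FTT.ABdry.thesis (.isTm P))] ++ [(t, .thesis (.isTm P))] by simp] at h
    exact h.concat_inv.1
  obtain ⟨hΞ, hB⟩ := h₁.concat_inv
  have hty : FTT.Der T Ξ [] (FTT.isTy P) := hB.bdryTm_inv
  exact ⟨hder, hfin, Ξ, s, t, P, Φ, rfl, hΦ,
    FTT.tyRule_deterministic hΞ.valid hP hmv hty.valid.2.2.2,
    FTT.tyRule_objectInvertible hT hΞ hP hmv hnat hty⟩
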